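/- **Conventions.** $\mathbb K$ is a field. For a polynomial (or power series) $p=\sum_i p_i x^i$ and integers $j,k$, put $[p]_j^k=p_j+p_{j+1}x+\dots+p_{j+k}x^k$ (with $p_i=0$ for $i<0$, and $[p]_j^k=0$ if $k<0$) and $\mathrm{rev}(p,N)=x^Np(1/x)$; $p \,\mathrm{rem}\, f$ is the remainder of the Euclidean division of $p$ by $f$, and $\mathbb K[x]_{<n}$ is the set of polynomials of degree less than $n$. The model is the computation tree over $\mathbb K$: computation nodes carry constants of $\mathbb K$ or operations $+,-,\times,\div$ on earlier nodes, branching nodes carry zero-tests, and the number of operations is the height of the tree (input nodes included); an algorithm is a family of trees, one for each size of the input. A real number $\omega_2$ is a feasible exponent (over $\mathbb K$) if for every $N\ge 1$ an $N\times N^2$ matrix can be multiplied by an $N^2\times N$ matrix over $\mathbb K$ in $O(N^{\omega_2})$ operations. $\tilde O(c)$ means $O(c\log^e c)$ for some $e$. **Algorithm SimultaneousTruncatedModularMultiplication** (input: $f$ of degree $n$, $p_0,\dots,p_{r-1},q_0,\dots,q_{s-1}\in\mathbb K[x]_{<n}$, $m\ge 1$). 1. Write $n-m-1=\ell m+t$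 with $0\le t<m$ if $m<n$; put $\ell=0$, $t=n-m-1$ if $m\ge n$. 2. $\bar p_i\gets\mathrm{rev}(p_i,n-1)$ and $\bar q_j\gets \mathrm{rev}(q_j,n-1)/\mathrm{rev}(f,n)$ modulo $x^{n-1}$ (power series quotient; read as $0$ if $n=0$). 3. $P_1\gets([\bar p_i]_{jm+t}^{m-1})_{i<r,\,j\le\ell}$, $P_2\gets([\bar p_i]_{jm+t}^{m-1})_{i<r,\,j<\ell}$, $Q_1\gets([\bar q_j]_{(\ell-i)m}^{m-1})_{i\le\ell,\,j<s}$, $Q_2\gets([\bar q_j]_{(\ell-1-i)m}^{m-1})_{i<\ell,\,j<s}$. 4. $(\bar h_{i,j})\gets[P_1Q_1]_0^{m-1}+[P_2Q_2]_m^{m-1}+\big(\big[[\bar p_i]_0^{t-1}[\bar q_j]_{\ell m+1}^{m+t-2}\big]_{t-1}^{m-1}\big)_{i<r,\,j<s}$. 5. Return all $(p_iq_j-\mathrm{rev}(\bar h_{i,j},m-1)f)\,\mathrm{rem}\,x^m$. **Algorithm TruncatedPowers** (input: $f$ of degree $n$, $a,b\in\mathbb K[x]_{<n}$, $m,d\ge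 1$). 1. $r\gets\lceil d^{1/2}\rceil$, $s\gets\lceil d/r\rceil$. 2. $\hat a_0\gets 1$ and $\hat a_i\gets a\,\hat a_{i-1}\,\mathrm{rem}\,f$ for $1\le i\le r$; $\bar a_0\gets b$ and $\bar a_j\gets\hat a_r\,\bar a_{j-1}\,\mathrm{rem}\,f$ for $1\le j<s$. 3. $(c_{i,j})_{i<r,\,j<s}\gets$ SimultaneousTruncatedModularMultiplication$(f,\hat a_0,\dots,\hat a_{r-1},\bar a_0,\dots,\bar a_{s-1},m)$. 4. Return $r_k=c_{i,j}$ for $0\le k<d$, where $k=i+rj$, $0\le i<r$. The basic operations in these algorithms (products of polynomials, products modulo $f$, truncated power series quotients, products of polynomial matrices) are done by subroutines. **Proposition.** Let $f\in\mathbb K[x]$ have degree $n\ge 0$, let $a,b\in\mathbb K[x]_{<n}$, and let $m,d\ge 1$. 1. With any correct subroutines, TruncatedPowers computes the truncations $[a^kb\,\mathrm{rem}\,f]_0^{m-1}$, $0\le k<d$. 2. If $\omega_2$ is a feasible exponent over $\mathbb K$, then there are correct subroutines over $\mathbb K$ with which TruncatedPowers uses $\tilde O(c(d))$ operations in $\mathbb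 K$, where $c(d)=(m+n/d)\,d^{\omega_2/2}$. More precisely, for all real $\omega_2$ and $C_0$ there are a real $C$ and a natural number $e$ such that over every field $\mathbb K$ in which the above matrix products can be computed in at most $C_0N^{\omega_2}$ operations for all $N\ge1$, there are correct subroutines with which, for all $n\ge0$ and $m,d\ge1$, the number of operations is at most $C\,c(d)\,\log(2+c(d))^e$. -/

import Mathlib

open Polynomial

universe u

/-! ### Computation trees -/

/-- The four arithmetic operations at the computation nodes. -/
inductive ArithOp where
  | add | sub | mul | div

/-- The value of an arithmetic operation; division by zero is undefined. -/
def ArithOp.apply {K : Type u} [Field K] [DecidableEq K] : ArithOp → K → K → Option K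
  | .add, x, y => some (x + y)
  | .sub, x, y => some (x - y)
  | .mul, x, y => some (x * y)
  | .div, x, y => if y = 0 then none else some (x / y)

/-- The part of a computation tree over `K` that lies below its input nodes.
Along a path from the root, the input nodes and the computation nodes are numbered `0, 1, 2, …`
from top to bottom, and a reference to an earlier node is its number.
* `leaf a`: an output node with label `a` (for a complete tree, a list of references);
* `const c T`: a computation node labelled by the constant `c`;
* `arith o i j T`: a computation node labelled by the operation `o`, with references `i`, `j`;
* `test i T₀ T₁`: a zero-test of node `i`; go on with `T₀` if its value is zero, else with `T₁`. -/
inductive CTree (K : Type u) (α : Type) : Type u where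
  | leaf : α → CTree K α
  | const : K → CTree K α → CTree K α
  | arith : ArithOp → ℕ → ℕ → CTree K α → CTree K α
  | test : ℕ → CTree K α → CTree K α → CTree K α

namespace CTree

variable {K : Type u}

/-- Maximal number of computation and branching nodes on a path to a leaf. -/
def depth {α : Type} : CTree K α → ℕ
  | leaf _ => 0
  | const _ T => T.depth + 1
  | arith _ _ _ T => T.depth + 1
  | test _ T₀ T₁ => max T₀.depth T₁.depth + 1

/-- The cost of a tree with `s` input nodes: its height, that is, the maximal length of a path from
the root (the first input node) to a leaf. -/
def cost (s : ℕ) (T : CTree K (List ℕ)) : ℕ := s + T.depth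

/-- Evaluation, given the list of the values of the nodes met so far (initially, the input).
The result is `none` when the tree is not evaluable: a division by zero is met, or a reference to
a node that does not exist. -/
def eval [Field K] [DecidableEq K] : CTree K (List ℕ) → List K → Option (List K)
  | leaf out, env => out.mapM fun i => env[i]?
  | const c T, env => T.eval (env ++ [c])
  | arith o i j T, env =>
      env[i]?.bind fun x => env[j]?.bind fun y => (o.apply x y).bind fun v => T.eval (env ++ [v])
  | test i T₀ T₁, env => env[i]?.bind fun x => if x = 0 then T₀.eval env else T₁.eval env

/-- Replace every leaf by a tree that depends on the label of the leaf. -/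
def bind {α β : Type} : CTree K α → (α → CTree K β) → CTree K β
  | leaf a, g => g a
  | const c T, g => const c (T.bind g)
  | arith o i j T, g => arith o i j (T.bind g)
  | test i T₀ T₁, g => test i (T₀.bind g) (T₁.bind g)

/-- Replace the label of every leaf. -/
def map {α β : Type} (g : α → β) (T : CTree K α) : CTree K β := T.bind fun a => leaf (g a)

end CTree

/-! ### Programs that write down trees

A program of type `Build K α` is told the number `N` of nodes that precede it on the path, and
yields the tree that it unrolls to; at each leaf it yields a result in `α` (typically, references)
and the number of nodes that precede what follows. Programs only see references, never values. -/

def Build (K : Type u) (α : Type) : Type u := ℕ → CTree K (α × ℕ)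

namespace Build

variable {K : Type u}

instance : Monad (Build K) where
  pure a := fun N => .leaf (a, N)
  bind p g := fun N => (p N).bind fun x => g x.1 x.2

/-- A node labelled by the constant `c`; the result is a reference to it. -/
def const (c : K) : Build K ℕ := fun N => .const c (.leaf (N, N + 1))

/-- A node labelled by an arithmetic operation; the result is a reference to it. -/
def arith (o : ArithOp) (i j : ℕ) : Build K ℕ := fun N => .arith o i j (.leaf (N, N + 1))

/-- The copy of a tree with input nodes `0, …, args.length - 1` in which these are replaced by the
nodes `args`, and the `k` computation nodes met so far by the nodes from `N` on. -/
def graft (args : List ℕ) (N : ℕ) : ℕ → CTree K (List ℕ) → CTree K (List ℕ × ℕ)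
  | k, .leaf out => .leaf (out.map (ref args N), N + k)
  | k, .const c T => .const c (graft args N (k + 1) T)
  | k, .arith o i j T => .arith o (ref args N i) (ref args N j) (graft args N (k + 1) T)
  | k, .test i T₀ T₁ => .test (ref args N i) (graft args N k T₀) (graft args N k T₁)
where
  ref (args : List ℕ) (N i : ℕ) : ℕ :=
    if h : i < args.length then args[i] else N + (i - args.length)

/-- Call of a subroutine, given by its tree, on the nodes `args`. -/
def call (T : CTree K (List ℕ)) (args : List ℕ) : Build K (List ℕ) := fun N => graft args N 0 T

/-- Run the body for `i = 0, …, k - 1` and collect the results. -/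
def loop {α : Type} (k : ℕ) (body : ℕ → Build K α) : Build K (List α) :=
  match k with
  | 0 => pure []
  | k + 1 => do
      let l ← loop k body
      let x ← body k
      pure (l ++ [x])

/-- The list `[p, step p, …, step^k p]`. -/
def iterates {α : Type} (step : α → Build K α) : ℕ → α → Build K (List α)
  | 0, p => pure [p]
  | k + 1, p => do
      let p' ← step p
      let l ← iterates step k p'
      pure (p :: l)

end Build

/-! ### Specifications of computation trees -/

section Spec

variable {K : Type u} [Field K]

/-- The coefficients of `x^0, …, x^(N-1)` in `p`, that is, `[p]_0^{N-1}`. -/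
def firstCoeffs (p : K[X]) (N : ℕ) : List K := (List.range N).map p.coeff

/-- The entries of a matrix, row by row. -/
def entryList {r s : ℕ} (A : Matrix (Fin r) (Fin s) K) : List K :=
  (List.finRange r).flatMap fun i => (List.finRange s).map fun j => A i j

/-- The first `N` coefficients of the entries of a polynomial matrix, row by row. -/
def polyEntryList {r s : ℕ} (A : Matrix (Fin r) (Fin s) K[X]) (N : ℕ) : List K :=
  (List.finRange r).flatMap fun i => (List.finRange s).flatMap fun j => firstCoeffs (A i j) N

variable [DecidableEq K]

/-- The tree `T` multiplies `N × N²` matrices by `N² × N` matrices over `K`. -/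
def MultipliesRect (T : CTree K (List ℕ)) (N : ℕ) : Prop :=
  ∀ (A : Matrix (Fin N) (Fin (N ^ 2)) K) (B : Matrix (Fin (N ^ 2)) (Fin N) K),
    T.eval (entryList A ++ entryList B) = some (entryList (A * B))

variable (K) in
/-- Over `K`, for all `N ≥ 1`, an `N × N²` matrix can be multiplied by an `N² × N` matrix using at
most `C₀ * N ^ ω₂` operations: `ω₂` is a feasible exponent, with constant `C₀` in the `O(·)`. -/
def FeasibleRectExponent (ω₂ C₀ : ℝ) : Prop :=
  ∀ N : ℕ, 0 < N → ∃ T : CTree K (List ℕ), MultipliesRect T N ∧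
    (T.cost (N * N ^ 2 + N ^ 2 * N) : ℝ) ≤ C₀ * (N : ℝ) ^ ω₂

end Spec

/-- Computation trees for the basic operations on polynomials and polynomial matrices that the
pseudocode of the algorithms uses as single instructions. -/
structure Subroutines (K : Type u) where
  /-- `mul N M`: product of polynomials given by `N` and by `M` coefficients. -/
  mul : ℕ → ℕ → CTree K (List ℕ)
  /-- `mulRem n`: the product modulo `f`, for `f` of degree `n` and factors of degree `< n`. -/
  mulRem : ℕ → CTree K (List ℕ)
  /-- `quo N`: the quotient of two power series at precision `N`. -/
  quo : ℕ → CTree K (List ℕ)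
  /-- `matMul r q s m`: product of an `r × q` and a `q × s` polynomial matrix of degree `< m`. -/
  matMul : ℕ → ℕ → ℕ → ℕ → CTree K (List ℕ)

/-- The subroutines compute, on all their inputs, what they are meant to compute. -/
structure Subroutines.Correct {K : Type u} [Field K] [DecidableEq K] (S : Subroutines K) :
    Prop where
  mul : ∀ (N M : ℕ) (p q : K[X]), p.degree < N → q.degree < M →
    (S.mul N M).eval (firstCoeffs p N ++ firstCoeffs q M) = some (firstCoeffs (p * q) (N + M - 1))
  mulRem : ∀ (n : ℕ) (f p q : K[X]), f.degree = n → p.degree < n → q.degree < n →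
    (S.mulRem n).eval (firstCoeffs f (n + 1) ++ firstCoeffs p n ++ firstCoeffs q n) =
      some (firstCoeffs (p * q % f) n)
  quo : ∀ (N : ℕ) (g h : K[X]), h.coeff 0 ≠ 0 →
    (S.quo N).eval (firstCoeffs g N ++ firstCoeffs h N) =
      some ((List.range N).map fun i =>
        PowerSeries.coeff i ((g : PowerSeries K) * (h : PowerSeries K)⁻¹))
  matMul : ∀ (r q s m : ℕ) (P : Matrix (Fin r) (Fin q) K[X]) (Q : Matrix (Fin q) (Fin s) K[X]),
    (∀ i j, (P i j).degree < m) → (∀ i j, (Q i j).degree < m) →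
    (S.matMul r q s m).eval (polyEntryList P m ++ polyEntryList Q m) =
      some (polyEntryList (P * Q) (2 * m - 1))

/-! ### Polynomials in the programs -/

/-- A polynomial is handled through the references `p i` to its coefficients; for all `i` that are
negative or too large, `p i` refers to a node with value `0`. -/
abbrev RefPoly := ℤ → ℕ

namespace RefPoly

/-- The polynomial with coefficients `l`; `z` refers to a node with value `0`. -/
def ofList (z : ℕ) (l : List ℕ) : RefPoly := fun i => if 0 ≤ i then l.getD i.toNat z else z

/-- The first `N` coefficients. -/
def toList (p : RefPoly) (N : ℕ) : List ℕ := (List.range N).map fun i => p i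

/-- The slice `[p]_j^k = p_j + p_{j+1} x + ⋯ + p_{j+k} x^k`. -/
def slice (z : ℕ) (p : RefPoly) (j k : ℤ) : RefPoly :=
  fun i => if 0 ≤ i ∧ i ≤ k then p (j + i) else z

/-- The reversal `x^N p(1/x)`. -/
def rev (p : RefPoly) (N : ℤ) : RefPoly := fun i => p (N - i)

end RefPoly

/-! ### The algorithms -/

section Algorithms

variable {K : Type u}

/-- Sum (or difference) of two polynomials of degree `< N`, coefficientwise. -/
def addSub (z : ℕ) (o : ArithOp) (N : ℕ) (p q : RefPoly) : Build K RefPoly := do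
  let l ← Build.loop N fun i => Build.arith o (p i) (q i)
  pure (RefPoly.ofList z l)

/-- Product of `p` and `q`, given by their first `N` and `M` coefficients. -/
def mulPoly (S : Subroutines K) (z N M : ℕ) (p q : RefPoly) : Build K RefPoly := do
  let l ← Build.call (S.mul N M) (p.toList N ++ q.toList M)
  pure (RefPoly.ofList z l)

/-- `p * q` modulo `f`, where `f` has degree `n` and `p`, `q` have degree `< n`. -/
def mulRemPoly (S : Subroutines K) (z n : ℕ) (f p q : RefPoly) : Build K RefPoly := do
  let l ← Build.call (S.mulRem n) (f.toList (n + 1) ++ p.toList n ++ q.toList n)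
  pure (RefPoly.ofList z l)

/-- The power series quotient `g / h` modulo `x^N`. -/
def quoPoly (S : Subroutines K) (z N : ℕ) (g h : RefPoly) : Build K RefPoly := do
  let l ← Build.call (S.quo N) (g.toList N ++ h.toList N)
  pure (RefPoly.ofList z l)

/-- Product of an `r × q` by a `q × s` matrix of polynomials of degree `< m`. -/
def mulPolyMatrix (S : Subroutines K) (z r q s m : ℕ) (P Q : ℕ → ℕ → RefPoly) :
    Build K (ℕ → ℕ → RefPoly) := do
  let flat (a b : ℕ) (A : ℕ → ℕ → RefPoly) : List ℕ :=
    (List.range a).flatMap fun i => (List.range b).flatMap fun j => (A i j).toList m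
  let l ← Build.call (S.matMul r q s m) (flat r q P ++ flat q s Q)
  let w := 2 * m - 1
  pure fun i j => RefPoly.ofList z ((l.drop ((i * s + j) * w)).take w)

/-- Simultaneous truncated modular multiplication: all `[p_i q_j rem f]_0^{m-1}` for
`0 ≤ i < r`, `0 ≤ j < s`, where `f` has degree `n` and the `p_i` and `q_j` have degree `< n`.
Here `n - m - 1 = ℓ m + t` is the Euclidean division if `m < n`, and `ℓ = 0`, `t = n - m - 1 < 0`
if `m ≥ n`. -/
def simultaneousTruncatedModularMultiplication (S : Subroutines K) (z n r s : ℕ)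
    (f : RefPoly) (p q : ℕ → RefPoly) (m : ℕ) : Build K (ℕ → ℕ → RefPoly) := do
  let ℓ : ℕ := if n ≤ m then 0 else (n - m - 1) / m
  let t : ℤ := (n : ℤ) - m - 1 - ℓ * m
  let pbar : ℕ → RefPoly := fun i => (p i).rev ((n : ℤ) - 1)
  let qbarList ← Build.loop s fun j =>
    quoPoly S z (n - 1) ((q j).rev ((n : ℤ) - 1)) (f.rev n)
  let qbar : ℕ → RefPoly := fun j => qbarList.getD j fun _ => z
  let P : ℕ → ℕ → RefPoly := fun i j => (pbar i).slice z (j * m + t) (m - 1)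
  let Q₁ : ℕ → ℕ → RefPoly := fun i j => (qbar j).slice z (((ℓ : ℤ) - i) * m) (m - 1)
  let Q₂ : ℕ → ℕ → RefPoly := fun i j => (qbar j).slice z (((ℓ : ℤ) - 1 - i) * m) (m - 1)
  let A ← mulPolyMatrix S z r (ℓ + 1) s m P Q₁
  let B ← mulPolyMatrix S z r ℓ s m P Q₂
  let res ← Build.loop r fun i => Build.loop s fun j => do
    let D ← mulPoly S z t.toNat (m + t - 1).toNat
      ((pbar i).slice z 0 (t - 1)) ((qbar j).slice z (ℓ * m + 1) (m - 1 + t - 1))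
    let AB ← addSub z .add m ((A i j).slice z 0 (m - 1)) ((B i j).slice z m (m - 1))
    let hbar ← addSub z .add m AB (D.slice z (t - 1) (m - 1))
    let pq ← mulPoly S z m m (p i) (q j)
    let hf ← mulPoly S z m m (hbar.rev ((m : ℤ) - 1)) f
    addSub z .sub m pq hf
  pure fun i j => (res.getD i []).getD j fun _ => z

/-- `⌈√d⌉` for `d ≥ 1`. -/
def ceilSqrt (d : ℕ) : ℕ := Nat.sqrt (d - 1) + 1

theorem ceilSqrt_eq (d : ℕ) (hd : 0 < d) : ceilSqrt d = ⌈Real.sqrt d⌉₊ := by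
  refine le_antisymm ?_ ?_
  · rw [ceilSqrt, Nat.add_one_le_iff, Nat.lt_ceil]
    apply Real.lt_sqrt_of_sq_lt
    have h : Nat.sqrt (d - 1) ^ 2 < d := lt_of_le_of_lt (Nat.sqrt_le' _) (by omega)
    exact_mod_cast h
  · rw [Nat.ceil_le, Real.sqrt_le_left (by positivity)]
    have h : d ≤ (ceilSqrt d) ^ 2 := by
      have := Nat.lt_succ_sqrt' (d - 1)
      simp only [ceilSqrt, Nat.succ_eq_add_one] at this ⊢
      omega
    exact_mod_cast h

/-- Truncated powers: all `[a^k b rem f]_0^{m-1}` for `0 ≤ k < d`, where `f` has degree `n` and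
`a`, `b` have degree `< n`, with baby steps `a^i rem f`, `0 ≤ i < r = ⌈√d⌉`, and giant steps
`b a^(j r) rem f`, `0 ≤ j < s = ⌈d / r⌉`; here `z` and `one` refer to nodes with values
`0` and `1`. -/
def truncatedPowersProgram (S : Subroutines K) (z one n : ℕ) (f a b : RefPoly) (m d : ℕ) :
    Build K (ℕ → RefPoly) := do
  let r := ceilSqrt d
  let s := d ⌈/⌉ r
  let ahatList ← Build.iterates (fun p => mulRemPoly S z n f a p) r (RefPoly.ofList z [one])
  let ahat : ℕ → RefPoly := fun i => ahatList.getD i fun _ => z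
  let abarList ← Build.iterates (fun p => mulRemPoly S z n f (ahat r) p) (s - 1) b
  let abar : ℕ → RefPoly := fun j => abarList.getD j fun _ => z
  let c ← simultaneousTruncatedModularMultiplication S z n r s f ahat abar m
  pure fun k => c (k % r) (k / r)

/-- The computation tree of the algorithm for given sizes `n`, `m`, `d`, with `3 n + 1` input nodes:
the `n + 1` coefficients of `f`, the `n` coefficients of `a`, and the `n` coefficients of `b`.
The output consists of `d` blocks of `m` coefficients. -/
def truncatedPowers [Zero K] [One K] (S : Subroutines K) (n m d : ℕ) : CTree K (List ℕ) :=
  let program : Build K (List ℕ) := do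
    let z ← Build.const 0
    let one ← Build.const 1
    let f := RefPoly.ofList z (List.range (n + 1))
    let a := RefPoly.ofList z ((List.range n).map fun i => n + 1 + i)
    let b := RefPoly.ofList z ((List.range n).map fun i => 2 * n + 1 + i)
    let c ← truncatedPowersProgram S z one n f a b m d
    pure ((List.range d).flatMap fun k => (c k).toList m)
  (program (3 * n + 1)).map Prod.fst

end Algorithms

/-- `c(d) = (m + n / d) d^(ω₂ / 2)`. -/
noncomputable def bicost (ω₂ : ℝ) (m n d : ℕ) : ℝ := ((m : ℝ) + n / d) * (d : ℝ) ^ (ω₂ / 2)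

/-! Correctness. Since `p q rem f = p q - f (p q div f)`, the truncation modulo x^m needs only the
first m coefficients of the quotient. Reversal turns Euclidean division into division of power
series (`coeff_div_eq_coeff_reflect`): the coefficient of x^i in p q div f is that of x^(n-2-i) in
p̄ q̄, which is a convolution (`coeff_mul_div_eq_sum`). The m wanted coefficients form one slice of
p̄ q̄. When p̄ and q̄ are cut into blocks of length m, this slice is the sum of the low halves of
block products (`P₁ Q₁`), the high halves of the neighbouring ones (`P₂ Q₂`) and a leftover from the
first t coefficients of p̄ (`conv_slices`). For all pairs i, j at once these are two products of
polynomial matrices. A Hoare-style calculus (`Build.Spec`) carries the identities over to trees.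

Complexity. Put N = ⌈√d⌉. The matrices have at most N rows, respectively columns, and inner
dimension about n/m, so they split into about n/(m d) + 1 products of format N × N² by N² × N over
polynomials of degree < m. Each costs Õ(m N^ω₂), in total Õ((m + n/d) d^(ω₂/2)). Baby and giant
steps cost Õ(n √d). As the height of a tree counts the 2 N³ inputs, ω₂ ≥ 3
(`FeasibleRectExponent.three_le`), and so this term is absorbed.

It remains to find quasi-linear subroutines with constants independent of the field. They all come
from `MatMulCost.powerSeries`, on truncated products of matrices of power series: fast Fourier
transforms of Schönhage–Strassen type act on the entries, with radix p = 2, or p = 3 in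
characteristic 2. The ring is K[x]/(1 + x^L + ⋯ + x^((p-1)L)) with L = p^k, where the class z of x
satisfies z^(pL) = 1. Elements are held redundantly as expansions of length p L in powers of z, so
that multiplication by a root of unity is a cyclic shift and costs nothing. The recursion
(`MatMulCost.ring_pow`) never leaves this ring: it only passes from a root y to a power of y and to
shorter expansions. The 1 × 1 case gives products of polynomials; Newton iteration and reversal give
series quotients and remainders. -/

/-! ### Semantics, cost and composition of trees and programs. -/

namespace CTree

variable {K : Type u}

theorem depth_bind_le {α β : Type} (T : CTree K α) (g : α → CTree K β) (c : ℕ)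
    (h : ∀ a, (g a).depth ≤ c) : (T.bind g).depth ≤ T.depth + c := by
  induction T with
  | leaf a => simpa [bind, depth] using h a
  | const _ T ih => simp only [bind, depth]; omega
  | arith _ _ _ T ih => simp only [bind, depth]; omega
  | test _ T₀ T₁ ih₀ ih₁ => simp only [bind, depth]; omega

theorem depth_map {α β : Type} (T : CTree K α) (g : α → β) : (T.map g).depth = T.depth := by
  rw [map]
  induction T with
  | leaf a => rfl
  | const _ T ih => simp only [bind, depth, ih]
  | arith _ _ _ T ih => simp only [bind, depth, ih]
  | test _ T₀ T₁ ih₀ ih₁ => simp only [bind, depth, ih₀, ih₁]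

variable [Field K] [DecidableEq K]

/-- Follow the path determined by the initial values: the label of the leaf that is reached,
and the values of all nodes on the path. -/
def run {α : Type} : CTree K α → List K → Option (α × List K)
  | leaf a, env => some (a, env)
  | const c T, env => T.run (env ++ [c])
  | arith o i j T, env =>
      env[i]?.bind fun x => env[j]?.bind fun y => (o.apply x y).bind fun v => T.run (env ++ [v])
  | test i T₀ T₁, env => env[i]?.bind fun x => if x = 0 then T₀.run env else T₁.run env

theorem run_bind {α β : Type} (T : CTree K α) (g : α → CTree K β) (env : List K) :
    (T.bind g).run env = (T.run env).bind fun r => (g r.1).run r.2 := by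
  induction T generalizing env with
  | leaf a => rfl
  | const _ T ih => exact ih _
  | arith o i j T ih =>
    simp only [bind, run]
    cases env[i]? <;> cases env[j]? <;> simp
    rename_i x y
    cases o.apply x y <;> simp [ih]
  | test i T₀ T₁ ih₀ ih₁ =>
    simp only [bind, run]
    cases env[i]? <;> simp
    split <;> simp [ih₀, ih₁]

theorem eval_eq_run (T : CTree K (List ℕ)) (env : List K) :
    T.eval env = (T.run env).bind fun r => r.1.mapM fun i => r.2[i]? := by
  induction T generalizing env with
  | leaf a => rfl
  | const _ T ih => exact ih _
  | arith o i j T ih =>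
    simp only [eval, run]
    cases env[i]? <;> cases env[j]? <;> simp
    rename_i x y
    cases o.apply x y <;> simp [ih]
  | test i T₀ T₁ ih₀ ih₁ =>
    simp only [eval, run]
    cases env[i]? <;> simp
    split <;> simp [ih₀, ih₁]

end CTree

/-- The nodes `refs` carry the values `vals`. -/
def HasValues {K : Type u} (env : List K) (refs : List ℕ) (vals : List K) : Prop :=
  List.Forall₂ (fun i v => env[i]? = some v) refs vals

namespace HasValues

variable {K : Type u} {env env' : List K}

theorem mapM_eq {refs : List ℕ} {vals : List K} :
    (refs.mapM fun i => env[i]?) = some vals ↔ HasValues env refs vals := by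
  induction refs generalizing vals with
  | nil => cases vals <;> simp [HasValues]
  | cons i l ih =>
    cases vals with
    | nil =>
      cases h : env[i]? <;> cases h' : l.mapM (fun i => env[i]?) <;>
        simp [HasValues, List.mapM_cons, h, h']
    | cons v vals =>
      rw [HasValues, List.forall₂_cons, ← HasValues, ← ih]
      cases h : env[i]? <;> cases h' : l.mapM (fun i => env[i]?) <;>
        simp [List.mapM_cons, h, h']

theorem mono (h : env <+: env') {refs : List ℕ} {vals : List K} (hv : HasValues env refs vals) :
    HasValues env' refs vals :=
  List.Forall₂.imp (fun i v hi => by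
    obtain ⟨t, rfl⟩ := h
    rw [List.getElem?_append_left (List.getElem?_eq_some_iff.1 hi).1]; exact hi) hv

theorem append {l₁ l₂ : List ℕ} {v₁ v₂ : List K} (h₁ : HasValues env l₁ v₁)
    (h₂ : HasValues env l₂ v₂) : HasValues env (l₁ ++ l₂) (v₁ ++ v₂) :=
  List.rel_append h₁ h₂

theorem map {ι : Type*} {l : List ι} {r : ι → ℕ} {v : ι → K}
    (h : ∀ i ∈ l, env[r i]? = some (v i)) : HasValues env (l.map r) (l.map v) := by
  induction l with
  | nil => exact List.Forall₂.nil
  | cons i l ih =>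
    exact List.Forall₂.cons (h i (by simp)) (ih fun j hj => h j (by simp [hj]))

theorem flatMap {ι : Type*} {l : List ι} {r : ι → List ℕ} {v : ι → List K}
    (h : ∀ i ∈ l, HasValues env (r i) (v i)) :
    HasValues env (l.flatMap r) (l.flatMap v) := by
  induction l with
  | nil => exact List.Forall₂.nil
  | cons i l ih =>
    simp only [List.flatMap_cons]
    exact (h i (by simp)).append (ih fun j hj => h j (by simp [hj]))

theorem getElem? {refs : List ℕ} {vals : List K} (h : HasValues env refs vals) {i : ℕ} {v : K}
    (hv : vals[i]? = some v) : ∃ j, refs[i]? = some j ∧ env[j]? = some v := by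
  induction h generalizing i with
  | nil => simp at hv
  | cons h₁ _ ih =>
    cases i with
    | zero => simp at hv; subst hv; exact ⟨_, by simp, h₁⟩
    | succ i => simpa using ih (by simpa using hv)

theorem length_eq {refs : List ℕ} {vals : List K} (h : HasValues env refs vals) :
    refs.length = vals.length := List.Forall₂.length_eq h

end HasValues

theorem List.IsPrefix.getElem?_eq_some_of {α : Type u} {l l' : List α} (h : l <+: l') {i : ℕ} {v : α}
    (hi : l[i]? = some v) : l'[i]? = some v := by
  obtain ⟨t, rfl⟩ := h
  rw [List.getElem?_append_left (List.getElem?_eq_some_iff.1 hi).1]; exact hi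

namespace Build

variable {K : Type u}

theorem depth_graft (args : List ℕ) (N k : ℕ) (T : CTree K (List ℕ)) :
    (graft args N k T).depth = T.depth := by
  induction T generalizing k with
  | leaf a => rfl
  | const _ T ih => simp only [graft, CTree.depth, ih]
  | arith _ _ _ T ih => simp only [graft, CTree.depth, ih]
  | test _ T₀ T₁ ih₀ ih₁ => simp only [graft, CTree.depth, ih₀, ih₁]

/-- Whatever precedes it, the program adds at most `c` computation and branching nodes to a path. -/
def CostLE {α : Type} (p : Build K α) (c : ℕ) : Prop := ∀ N, (p N).depth ≤ c

namespace CostLE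

theorem mono {α : Type} {p : Build K α} {c c' : ℕ} (h : CostLE p c) (hc : c ≤ c') : CostLE p c' :=
  fun N => (h N).trans hc

theorem pure {α : Type} (a : α) : CostLE (Pure.pure a : Build K α) 0 := fun _ => le_rfl

theorem bind {α β : Type} {p : Build K α} {g : α → Build K β} {c c' : ℕ} (hp : CostLE p c)
    (hg : ∀ a, CostLE (g a) c') : CostLE (p >>= g) (c + c') := fun N =>
  (CTree.depth_bind_le (p N) _ c' fun x => hg x.1 x.2).trans (Nat.add_le_add_right (hp N) _)

theorem bind_pure {α β : Type} {p : Build K α} {g : α → β} {c : ℕ} (hp : CostLE p c) :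
    CostLE (p >>= fun a => Pure.pure (g a)) c := hp.bind fun _ => pure _

theorem const (c : K) : CostLE (Build.const c) 1 := fun _ => le_rfl

theorem arith (o : ArithOp) (i j : ℕ) : CostLE (Build.arith (K := K) o i j) 1 := fun _ => le_rfl

theorem call (T : CTree K (List ℕ)) (args : List ℕ) : CostLE (Build.call T args) T.depth :=
  fun N => (depth_graft args N 0 T).le

theorem loop {α : Type} (k : ℕ) {body : ℕ → Build K α} {c : ℕ} (h : ∀ i, CostLE (body i) c) :
    CostLE (Build.loop k body) (k * c) := by
  induction k with
  | zero => exact (pure _).mono (Nat.zero_le _)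
  | succ k ih =>
    rw [Nat.succ_mul]
    exact ih.bind fun l => (h k).bind_pure

theorem iterates {α : Type} {step : α → Build K α} {c : ℕ} (h : ∀ a, CostLE (step a) c) (k : ℕ)
    (p : α) : CostLE (Build.iterates step k p) (k * c) := by
  induction k generalizing p with
  | zero => exact (pure _).mono (Nat.zero_le _)
  | succ k ih =>
    rw [Nat.succ_mul, Nat.add_comm (k * c)]
    exact (h p).bind fun p' => (ih p').bind_pure

end CostLE

theorem getElem?_graft_ref {args : List ℕ} {env vals comp : List K} (h : HasValues env args vals)
    {i : ℕ} {v : K} (hi : (vals ++ comp)[i]? = some v) :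
    (env ++ comp)[graft.ref args env.length i]? = some v := by
  have hl := h.length_eq
  unfold graft.ref
  split_ifs with hlt
  · rw [List.getElem?_append_left (by omega)] at hi
    obtain ⟨j, hj, hv⟩ := h.getElem? hi
    rw [List.getElem?_eq_getElem hlt] at hj
    cases hj
    exact (List.prefix_append env comp).getElem?_eq_some_of hv
  · rw [List.getElem?_append_right (by omega)] at hi
    rw [List.getElem?_append_right (by omega)]
    simpa [hl] using hi

variable [Field K] [DecidableEq K]

/-- Started on the values `env`, the program runs through, and its result and the list of all
values afterwards satisfy `Q`. -/
def Spec {α : Type} (p : Build K α) (env : List K) (Q : α → List K → Prop) : Prop :=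
  ∃ a env', (p env.length).run env = some ((a, env'.length), env') ∧ env <+: env' ∧ Q a env'

theorem Spec.mono {α : Type} {p : Build K α} {env : List K} {Q R : α → List K → Prop}
    (h : Spec p env Q) (hQR : ∀ a env', env <+: env' → Q a env' → R a env') : Spec p env R := by
  obtain ⟨a, env', h₁, h₂, h₃⟩ := h
  exact ⟨a, env', h₁, h₂, hQR _ _ h₂ h₃⟩

theorem spec_pure {α : Type} {a : α} {env : List K} {Q : α → List K → Prop} (h : Q a env) :
    Spec (pure a) env Q := ⟨a, env, rfl, List.prefix_refl _, h⟩

theorem Spec.bind {α β : Type} {p : Build K α} {g : α → Build K β} {env : List K}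
    {Q : α → List K → Prop} {R : β → List K → Prop} (h : Spec p env Q)
    (hg : ∀ a env', env <+: env' → Q a env' → Spec (g a) env' R) : Spec (p >>= g) env R := by
  obtain ⟨a, env', h₁, h₂, h₃⟩ := h
  obtain ⟨b, env'', k₁, k₂, k₃⟩ := hg a env' h₂ h₃
  refine ⟨b, env'', ?_, h₂.trans k₂, k₃⟩
  change ((p env.length).bind fun x => g x.1 x.2).run env = _
  rw [CTree.run_bind, h₁]
  exact k₁

theorem spec_const (c : K) (env : List K) :
    Spec (const c) env fun i env' => env'[i]? = some c :=
  ⟨env.length, env ++ [c], by simp [const, CTree.run], List.prefix_append _ _, by simp⟩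

theorem spec_arith {o : ArithOp} {i j : ℕ} {env : List K} {x y v : K} (hi : env[i]? = some x)
    (hj : env[j]? = some y) (hv : o.apply x y = some v) :
    Spec (arith o i j) env fun k env' => env'[k]? = some v :=
  ⟨env.length, env ++ [v], by simp [arith, CTree.run, hi, hj, hv], List.prefix_append _ _, by simp⟩

/-- The subroutine believes that its nodes are `vals ++ comp`, while the path carries `env ++ comp`;
`graft.ref` translates between the two, and `comp` grows along the induction. -/
theorem run_graft {args : List ℕ} {env vals : List K} (h : HasValues env args vals)
    (T : CTree K (List ℕ)) (comp out : List K) (hT : T.eval (vals ++ comp) = some out) :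
    ∃ l comp', (graft args env.length comp.length T).run (env ++ comp) =
      some ((l, (env ++ comp').length), env ++ comp') ∧ HasValues (env ++ comp') l out := by
  induction T generalizing comp with
  | leaf refs =>
    refine ⟨refs.map (graft.ref args env.length), comp,
      by simp only [graft, CTree.run, List.length_append]; rfl, ?_⟩
    simp only [CTree.eval] at hT
    rw [HasValues.mapM_eq] at hT
    rw [HasValues, List.forall₂_map_left_iff]
    exact List.Forall₂.imp (fun i v hi => getElem?_graft_ref h hi) hT
  | const c T ih =>
    simp only [CTree.eval, List.append_assoc] at hT
    obtain ⟨l, comp', h₁, h₂⟩ := ih _ hT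
    refine ⟨l, comp', ?_, h₂⟩
    simpa [graft, CTree.run] using h₁
  | arith o i j T ih =>
    simp only [CTree.eval, List.append_assoc, Option.bind_eq_some_iff] at hT
    obtain ⟨x, hx, y, hy, v, hv, hT⟩ := hT
    obtain ⟨l, comp', h₁, h₂⟩ := ih _ hT
    refine ⟨l, comp', ?_, h₂⟩
    simpa [graft, CTree.run, getElem?_graft_ref h hx, getElem?_graft_ref h hy, hv] using h₁
  | test i T₀ T₁ ih₀ ih₁ =>
    simp only [CTree.eval, Option.bind_eq_some_iff] at hT
    obtain ⟨x, hx, hT⟩ := hT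
    simp only [graft, CTree.run, getElem?_graft_ref h hx, Option.bind_some]
    split_ifs at hT ⊢
    · exact ih₀ _ hT
    · exact ih₁ _ hT

theorem spec_call {T : CTree K (List ℕ)} {args : List ℕ} {env vals out : List K}
    (h : HasValues env args vals) (hT : T.eval vals = some out) :
    Spec (call T args) env fun l env' => HasValues env' l out := by
  obtain ⟨l, comp', h₁, h₂⟩ := run_graft h T [] out (by simpa using hT)
  exact ⟨l, env ++ comp', by simpa [call] using h₁, List.prefix_append _ _, h₂⟩

/-- Monotonicity of `Q` keeps the results of earlier rounds valid while later rounds append nodes.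
-/
theorem spec_loop {α : Type} {k : ℕ} {body : ℕ → Build K α} {env : List K}
    {Q : ℕ → α → List K → Prop}
    (hmono : ∀ i a env' env'', env' <+: env'' → Q i a env' → Q i a env'')
    (h : ∀ i < k, ∀ env', env <+: env' → Spec (body i) env' (Q i)) :
    Spec (loop k body) env fun l env' =>
      l.length = k ∧ ∀ i < k, ∃ a, l[i]? = some a ∧ Q i a env' := by
  induction k with
  | zero => exact spec_pure ⟨rfl, by simp⟩
  | succ k ih =>
    refine (ih fun i hi => h i (by omega)).bind fun l env' hp hl => ?_
    refine (h k (by omega) env' hp).bind fun a env'' hp' ha => spec_pure ⟨by simp [hl.1], ?_⟩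
    intro i hi
    rcases Nat.lt_succ_iff_lt_or_eq.1 hi with hi | rfl
    · obtain ⟨b, hb, hQ⟩ := hl.2 i hi
      exact ⟨b, by rw [List.getElem?_append_left (by omega), hb], hmono _ _ _ _ hp' hQ⟩
    · exact ⟨a, by rw [List.getElem?_append_right (by omega)]; simp [hl.1], ha⟩

theorem spec_iterates {α : Type} {step : α → Build K α} {k : ℕ} {p : α} {env : List K}
    {Q : ℕ → α → List K → Prop}
    (hmono : ∀ i a env' env'', env' <+: env'' → Q i a env' → Q i a env'')
    (h₀ : Q 0 p env)
    (h : ∀ i < k, ∀ a env', env <+: env' → Q i a env' → Spec (step a) env' (Q (i + 1))) :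
    Spec (iterates step k p) env fun l env' => ∀ i ≤ k, ∃ a, l[i]? = some a ∧ Q i a env' := by
  induction k generalizing p env Q with
  | zero =>
    refine spec_pure fun i hi => ⟨p, ?_⟩
    obtain rfl : i = 0 := by omega
    exact ⟨rfl, h₀⟩
  | succ k ih =>
    refine (h 0 (by omega) p env (List.prefix_refl _) h₀).bind fun p' env' hp hp' => ?_
    refine (ih (Q := fun i => Q (i + 1)) (fun i => hmono (i + 1)) hp' fun i hi a env'' hp'' ha =>
      h (i + 1) (by omega) a env'' (hp.trans hp'') ha).bind fun l env'' hp'' hl => spec_pure ?_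
    rintro (_ | i) hi
    · exact ⟨p, rfl, hmono _ _ _ _ (hp.trans hp'') h₀⟩
    · simpa using hl i (by omega)

theorem Spec.eval_map {p : Build K (List ℕ)} {env out : List K}
    (h : Spec p env fun l env' => HasValues env' l out) :
    ((p env.length).map Prod.fst).eval env = some out := by
  obtain ⟨a, env', h₁, -, h₃⟩ := h
  rw [CTree.eval_eq_run, CTree.map, CTree.run_bind, h₁]
  exact HasValues.mapM_eq.2 h₃

end Build

/-! ### Convolutions and their block decomposition. -/

section Convolution

variable {K : Type u} [Field K]

/-- The product of `∑_{0 ≤ a < N} v_a x^a` and `∑_{0 ≤ b < M} w_b x^b`. -/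
def conv (N M : ℕ) (v w : ℤ → K) (i : ℤ) : K :=
  ∑ a ∈ Finset.range N, ∑ b ∈ Finset.range M, if (a + b : ℤ) = i then v a * w b else 0

/-- The polynomial `∑_{0 ≤ a < N} v_a x^a`. -/
noncomputable def polyOf (N : ℕ) (v : ℤ → K) : K[X] := ∑ a ∈ Finset.range N, monomial a (v a)

/-- The coefficients of a polynomial, as a function on the integers. -/
def zcoeff (P : K[X]) (i : ℤ) : K := if 0 ≤ i then P.coeff i.toNat else 0

@[simp] theorem zcoeff_natCast (P : K[X]) (i : ℕ) : zcoeff P i = P.coeff i := by simp [zcoeff]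

theorem zcoeff_of_neg (P : K[X]) {i : ℤ} (hi : i < 0) : zcoeff P i = 0 := by
  simp [zcoeff, not_le.2 hi]

theorem coeff_polyOf (N : ℕ) (v : ℤ → K) (i : ℕ) :
    (polyOf N v).coeff i = if i < N then v i else 0 := by
  simp [polyOf, coeff_monomial]

theorem degree_polyOf_lt (N : ℕ) (v : ℤ → K) : (polyOf N v).degree < N := by
  rw [degree_lt_iff_coeff_zero]
  intro m hm
  rw [coeff_polyOf, if_neg (by omega)]

theorem firstCoeffs_polyOf (N : ℕ) (v : ℤ → K) :
    firstCoeffs (polyOf N v) N = (List.range N).map fun i : ℕ => v i := by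
  rw [firstCoeffs]
  refine List.map_congr_left fun i hi => ?_
  rw [coeff_polyOf, if_pos (List.mem_range.1 hi)]

theorem zcoeff_polyOf_mul (N M : ℕ) (v w : ℤ → K) :
    zcoeff (polyOf N v * polyOf M w) = conv N M v w := by
  funext i
  rw [conv]
  rcases lt_or_ge i 0 with hi | hi
  · rw [zcoeff_of_neg _ hi, Finset.sum_eq_zero]
    intro a _
    refine Finset.sum_eq_zero fun b _ => if_neg ?_
    omega
  · obtain ⟨i, rfl⟩ := Int.eq_ofNat_of_zero_le hi
    simp only [zcoeff_natCast, polyOf, Finset.sum_mul_sum, monomial_mul_monomial,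
      finsetSum_coeff, coeff_monomial]
    norm_cast

theorem conv_eq (N M : ℕ) (v w : ℤ → K) (i : ℤ) :
    conv N M v w i =
      ∑ a ∈ Finset.range N, if 0 ≤ i - a ∧ i - a < M then v a * w (i - a) else 0 := by
  refine Finset.sum_congr rfl fun a _ => ?_
  split_ifs with h
  · rw [Finset.sum_eq_single (i - a).toNat]
    · rw [if_pos (by omega), Int.toNat_of_nonneg h.1]
    · intro b _ hb
      rw [if_neg (by omega)]
    · intro hb
      exact absurd (Finset.mem_range.2 (by omega)) hb
  · refine Finset.sum_eq_zero fun b hb => if_neg ?_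
    have := Finset.mem_range.1 hb
    omega

theorem conv_congr {N M : ℕ} {v v' w w' : ℤ → K} (hv : ∀ a : ℕ, a < N → v a = v' a)
    (hw : ∀ a : ℕ, a < M → w a = w' a) (i : ℤ) : conv N M v w i = conv N M v' w' i := by
  refine Finset.sum_congr rfl fun a ha => Finset.sum_congr rfl fun b hb => ?_
  rw [hv a (Finset.mem_range.1 ha), hw b (Finset.mem_range.1 hb)]

theorem conv_zcoeff_of_lt (m : ℕ) (P Q : K[X]) {i : ℕ} (hi : i < m) :
    conv m m (zcoeff P) (zcoeff Q) i = (P * Q).coeff i := by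
  rw [conv_eq, coeff_mul, Finset.Nat.sum_antidiagonal_eq_sum_range_succ fun a b => P.coeff a * Q.coeff b]
  symm
  rw [← Finset.sum_subset (Finset.range_mono (show i.succ ≤ m by omega))]
  · refine Finset.sum_congr rfl fun a ha => ?_
    have ha' := Finset.mem_range.1 ha
    rw [if_pos (by omega), show (i : ℤ) - a = ((i - a : ℕ) : ℤ) by omega, zcoeff_natCast,
      zcoeff_natCast]
  · intro a _ ha
    rw [Finset.mem_range] at ha
    rw [if_neg (by omega)]

theorem sum_range_mul {M : Type*} [AddCommMonoid M] (f : ℕ → M) (a b : ℕ) :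
    ∑ k ∈ Finset.range (a * b), f k =
      ∑ i ∈ Finset.range a, ∑ j ∈ Finset.range b, f (i * b + j) := by
  induction a with
  | zero => simp
  | succ a ih => rw [Nat.succ_mul, Finset.sum_range_add, ih, Finset.sum_range_succ]

theorem sum_range_eq_sum_Ico_int (g : ℤ → K) (t : ℤ) (B : ℕ) :
    ∑ k ∈ Finset.range B, g (t + k) = ∑ a ∈ Finset.Ico t (t + B), g a := by
  induction B with
  | zero => simp
  | succ B ih =>
    rw [Finset.sum_range_succ, ih, add_comm, ← Finset.sum_insert (by simp)]
    congr 1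
    ext a
    simp only [Finset.mem_insert, Finset.mem_Ico]
    push_cast
    omega

/-- The slice of length `m` at `ℓ m + t` of a convolution is assembled from convolutions of
slices of length `m`, and of a remaining one. -/
theorem conv_slices (m ℓ : ℕ) (t : ℤ) (p q : ℤ → K) (ht : t < m) (hq : ∀ b < 0, q b = 0)
    (hp : ∀ a < 0, ∀ b, p a * q b = 0) (i : ℤ) (hi : 0 ≤ i) (him : i < m) :
    (∑ j ∈ Finset.range (ℓ + 1),
        conv m m (fun u => p (j * m + t + u)) (fun v => q ((ℓ - j) * m + v)) i) +
      (∑ j ∈ Finset.range ℓ,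
        conv m m (fun u => p (j * m + t + u)) (fun v => q ((ℓ - 1 - j) * m + v)) (m + i)) +
      conv t.toNat (m + t - 1).toNat p (fun v => q (ℓ * m + 1 + v)) (t - 1 + i) =
    ∑ a ∈ Finset.Ico 0 (ℓ * m + t + i + 1), p a * q (ℓ * m + t + i - a) := by
  set E : ℤ := ℓ * m + t + i with hE
  set g : ℤ → K := fun a => p a * q (E - a) with hg
  -- For a < t and 0 ≤ i < m the partner index t - 1 + i - a lies between 0 and m + t - 2, so the
  -- slice of q is just long enough that nothing is cut off. For t ≤ 0 both sides are empty.
  have h3 : conv t.toNat (m + t - 1).toNat p (fun v => q (ℓ * m + 1 + v)) (t - 1 + i) =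
      ∑ a ∈ Finset.Ico 0 t, g a := by
    rw [conv_eq]
    trans ∑ a ∈ Finset.range t.toNat, g (0 + a)
    · refine Finset.sum_congr rfl fun a ha => ?_
      have := Finset.mem_range.1 ha
      rw [if_pos (by omega), zero_add]
      simp only [hg]
      congr 2
      rw [hE]; ring
    · rw [sum_range_eq_sum_Ico_int]
      rcases le_or_gt 0 t with h | h
      · rw [zero_add, Int.toNat_of_nonneg h]
      · rw [Finset.Ico_eq_empty (by omega), Finset.Ico_eq_empty (by omega)]
  have h1 : (∑ j ∈ Finset.range (ℓ + 1),
        conv m m (fun u => p (j * m + t + u)) (fun v => q ((ℓ - j) * m + v)) i) +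
      (∑ j ∈ Finset.range ℓ,
        conv m m (fun u => p (j * m + t + u)) (fun v => q ((ℓ - 1 - j) * m + v)) (m + i)) =
      ∑ a ∈ Finset.Ico t (t + ((ℓ + 1) * m : ℕ)), g a := by
    rw [← sum_range_eq_sum_Ico_int, sum_range_mul]
    -- In the block of p that starts at j m + t, the positions u ≤ i meet block ℓ - j of q and the
    -- positions u > i meet block ℓ - 1 - j. The two families of products therefore cover each block
    -- exactly once.
    have h2 : ∑ j ∈ Finset.range ℓ,
        conv m m (fun u => p (j * m + t + u)) (fun v => q ((ℓ - 1 - j) * m + v)) (m + i) =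
      ∑ j ∈ Finset.range (ℓ + 1),
        ∑ u ∈ Finset.range m, if i < u then g (t + (j * m + u : ℕ)) else 0 := by
      -- The term j = ℓ can be added for uniformity: there the argument of q is i - u < 0.
      rw [Finset.sum_range_succ, Finset.sum_eq_zero (s := Finset.range m), add_zero]
      · refine Finset.sum_congr rfl fun j hj => ?_
        rw [conv_eq]
        refine Finset.sum_congr rfl fun u hu => ?_
        have := Finset.mem_range.1 hu
        by_cases hiu : i < u
        · rw [if_pos (by omega), if_pos hiu]
          simp only [hg]
          congr 2
          · push_cast; ring
          · rw [hE]; push_cast; ring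
        · rw [if_neg (by omega), if_neg hiu]
      · intro u hu
        split_ifs with hiu
        · simp only [hg]
          rw [hq, mul_zero]
          rw [hE]; push_cast; linarith
        · rfl
    rw [h2, ← Finset.sum_add_distrib]
    refine Finset.sum_congr rfl fun j hj => ?_
    rw [conv_eq, ← Finset.sum_add_distrib]
    refine Finset.sum_congr rfl fun u hu => ?_
    have := Finset.mem_range.1 hu
    by_cases hiu : i < u
    · rw [if_neg (by omega), if_pos hiu, zero_add]
    · rw [if_pos (by omega), if_neg hiu, add_zero]
      simp only [hg]
      congr 2
      · push_cast; ring
      · rw [hE]; push_cast; ring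
  rw [h1, h3, add_comm]
  have hB : ((((ℓ + 1) * m : ℕ) : ℤ)) = ℓ * m + m := by push_cast; ring
  have hlm : (0 : ℤ) ≤ ℓ * m := by positivity
  rw [hB, ← Finset.sum_union (by
    rw [Finset.disjoint_left]; intro a; simp only [Finset.mem_Ico]; omega)]
  symm
  -- The blocks may overshoot the range 0 ≤ a ≤ E. Indices a < 0 occur only if t < 0 and are killed
  -- by `hp`; indices a > E are killed by `hq`.
  refine Finset.sum_subset ?_ ?_
  · intro a
    simp only [Finset.mem_union, Finset.mem_Ico]
    omega
  · intro a ha ha'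
    simp only [Finset.mem_union, Finset.mem_Ico] at ha ha'
    rcases lt_or_ge a 0 with h | h
    · exact hp _ h _
    · change p a * q (E - a) = 0
      rw [hq _ (by omega), mul_zero]

end Convolution

/-! ### Euclidean quotients through reversed power series. -/

section Quotient

variable {K : Type u} [Field K]

theorem natDegree_div_field (R : K[X]) {f : K[X]} (hf : f ≠ 0) :
    (R / f).natDegree = R.natDegree - f.natDegree := by
  rw [div_def, natDegree_C_mul (inv_ne_zero (leadingCoeff_ne_zero.2 hf)),
    natDegree_divByMonic _ (monic_mul_leadingCoeff_inv hf),
    natDegree_mul_C (inv_ne_zero (leadingCoeff_ne_zero.2 hf))]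

theorem natDegree_le_sub_one {R : Type*} [Semiring R] {n : ℕ} {P : R[X]} (h : P.degree < n) : P.natDegree ≤ n - 1 := by
  rw [natDegree_le_iff_coeff_eq_zero]
  exact fun N hN => (degree_lt_iff_coeff_zero _ _).1 h N (by omega)

theorem coeff_reflect_of_le {N i : ℕ} (P : K[X]) (hi : i ≤ N) :
    (reflect N P).coeff i = P.coeff (N - i) := by
  rw [coeff_reflect, revAt_le hi]

theorem coeff_reflect_zero_ne_zero {n : ℕ} {f : K[X]} (hf : f.degree = n) :
    (reflect n f).coeff 0 ≠ 0 := by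
  rw [coeff_reflect_of_le f (Nat.zero_le n), Nat.sub_zero]
  exact coeff_ne_zero_of_eq_degree hf

/-- The coefficients of a Euclidean quotient, from a quotient of power series. -/
theorem coeff_div_eq_coeff_reflect {n : ℕ} {f R : K[X]} (hf : f.degree = n) (hn : 2 ≤ n)
    (hR : R.natDegree ≤ 2 * n - 2) {i : ℕ} (hi : i ≤ n - 2) :
    (R / f).coeff i = PowerSeries.coeff (n - 2 - i)
      ((reflect (2 * n - 2) R : PowerSeries K) * (reflect n f : PowerSeries K)⁻¹) := by
  have hf0 : f ≠ 0 := by rintro rfl; simp at hf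
  have hfn : f.natDegree = n := natDegree_eq_of_degree_eq_some hf
  have hdiv : (R / f).natDegree ≤ n - 2 := by
    rw [natDegree_div_field _ hf0]; omega
  have hmod : (R % f).degree < n := hf ▸ degree_mod_lt R hf0
  -- Reversal with respect to 2n - 2 makes the remainder, of degree < n, divisible by x^(n-1). Hence
  -- it does not disturb the coefficients up to n - 2 after division by the reversal of f, and these
  -- are the reversed quotient.
  have hsplit : reflect (2 * n - 2) R =
      reflect n f * reflect (n - 2) (R / f) + reflect (2 * n - 2) (R % f) := by
    conv_lhs => rw [← EuclideanDomain.div_add_mod R f, reflect_add]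
    rw [← reflect_mul f (R / f) hfn.le hdiv, show n + (n - 2) = 2 * n - 2 by omega]
  have hunit : (reflect n f : PowerSeries K) * (reflect n f : PowerSeries K)⁻¹ = 1 := by
    refine PowerSeries.mul_inv_cancel _ ?_
    rw [← PowerSeries.coeff_zero_eq_constantCoeff_apply, coeff_coe]
    exact coeff_reflect_zero_ne_zero hf
  rw [hsplit, Polynomial.coe_add, Polynomial.coe_mul, add_mul, mul_right_comm, hunit, one_mul, map_add, coeff_coe,
    coeff_reflect_of_le _ (by omega), show n - 2 - (n - 2 - i) = i by omega]
  rw [PowerSeries.coeff_mul, Finset.sum_eq_zero, add_zero]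
  intro x hx
  rw [Finset.HasAntidiagonal.mem_antidiagonal] at hx
  rw [coeff_coe, coeff_reflect_of_le _ (by omega),
    (degree_lt_iff_coeff_zero _ _).1 hmod _ (by omega), zero_mul]

/-- The coefficients of the power series `rev(Q, n - 1) / rev(f, n)` modulo `x^(n-1)`. -/
noncomputable def revQuotient (n : ℕ) (f Q : K[X]) (b : ℤ) : K :=
  if 0 ≤ b ∧ b < (n - 1 : ℕ) then PowerSeries.coeff b.toNat
    ((reflect (n - 1) Q : PowerSeries K) * (reflect n f : PowerSeries K)⁻¹) else 0

/-- The coefficients of the quotient of a product, as a convolution of the reversal of the first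
factor with a truncated quotient of power series. -/
theorem coeff_mul_div_eq_sum {n : ℕ} {f P Q : K[X]} (hf : f.degree = n) (hP : P.degree < n ∨ n = 0)
    (hQ : Q.degree < n) (i : ℕ) :
    (P * Q / f).coeff i = ∑ a ∈ Finset.Ico (0 : ℤ) (n - 2 - i + 1), zcoeff P (n - 1 - a) *
      revQuotient n f Q (n - 2 - i - a) := by
  have hfn : f.natDegree = n := natDegree_eq_of_degree_eq_some hf
  have hf0 : f ≠ 0 := by rintro rfl; simp at hf
  by_cases hn : n = 0
  · subst hn
    have hQ0 : Q = 0 := by rw [← degree_eq_bot]; exact Nat.WithBot.lt_zero_iff.1 (by simpa using hQ)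
    rw [Finset.Ico_eq_empty (by push_cast; omega)]
    simp [hQ0]
  have hP := hP.resolve_right hn
  have hPn : P.natDegree ≤ n - 1 := natDegree_le_sub_one hP
  have hQn : Q.natDegree ≤ n - 1 := natDegree_le_sub_one hQ
  have hPQ : (P * Q).natDegree ≤ 2 * n - 2 := natDegree_mul_le.trans (by omega)
  rcases Nat.lt_or_ge (n - 2) i with hi | hi
  · rw [Finset.Ico_eq_empty (by omega), Finset.sum_empty]
    exact coeff_eq_zero_of_natDegree_lt (by rw [natDegree_div_field _ hf0]; omega)
  -- The subtraction n - 2 is truncated, so for n = 1 the index i = 0 is still open; there constants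
  -- are divided by a polynomial of degree 1.
  rcases Nat.lt_or_ge n 2 with hn2 | hn2
  · obtain rfl : n = 1 := by omega
    obtain rfl : i = 0 := by omega
    rw [Finset.Ico_eq_empty (by norm_num), Finset.sum_empty]
    rw [eq_C_of_natDegree_eq_zero (p := P) (by omega), eq_C_of_natDegree_eq_zero (p := Q) (by omega),
      ← C_mul, (Polynomial.div_eq_zero_iff hf0).2]
    · simp
    · rw [hf]; exact degree_C_le.trans_lt (by norm_num)
  rw [coeff_div_eq_coeff_reflect hf hn2 hPQ hi, show 2 * n - 2 = (n - 1) + (n - 1) by omega,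
    reflect_mul P Q hPn hQn, Polynomial.coe_mul, mul_assoc, PowerSeries.coeff_mul,
    Finset.Nat.sum_antidiagonal_eq_sum_range_succ fun a b => PowerSeries.coeff a
      (reflect (n - 1) P : PowerSeries K) * PowerSeries.coeff b
        ((reflect (n - 1) Q : PowerSeries K) * (reflect n f : PowerSeries K)⁻¹)]
  have hE : ((n - 2 - i).succ : ℤ) = n - 2 - i + 1 := by omega
  have := sum_range_eq_sum_Ico_int (fun a : ℤ => zcoeff P (n - 1 - a) *
      revQuotient n f Q (n - 2 - i - a)) 0 (n - 2 - i).succ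
  rw [zero_add, hE] at this
  rw [← this]
  refine Finset.sum_congr rfl fun a ha => ?_
  have ha' := Finset.mem_range.1 ha
  rw [revQuotient, if_pos (by omega), coeff_coe, coeff_reflect_of_le _ (by omega),
    show (n : ℤ) - 1 - (0 + a) = ((n - 1 - a : ℕ) : ℤ) by omega, zcoeff_natCast,
    show ((n : ℤ) - 2 - i - (0 + a)).toNat = n - 2 - i - a by omega]

end Quotient

/-! ### Polynomials represented by references to nodes. -/

theorem List.getElem?_flatMap_range {α : Type u} {r L : ℕ} {g : ℕ → List α}
    (hg : ∀ i < r, (g i).length = L) {i c : ℕ} (hi : i < r) (hc : c < L) :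
    ((List.range r).flatMap g)[i * L + c]? = (g i)[c]? := by
  induction r with
  | zero => omega
  | succ r ih =>
    have hlen : ((List.range r).flatMap g).length = r * L := by
      rw [List.length_flatMap, List.map_congr_left fun j hj =>
        hg j (Nat.lt_succ_of_lt (List.mem_range.1 hj))]
      simp
    rw [List.range_succ, List.flatMap_append, List.flatMap_singleton]
    rcases Nat.lt_succ_iff_lt_or_eq.1 hi with h | rfl
    · have := Nat.mul_le_mul_right L (Nat.succ_le_of_lt h)
      rw [Nat.succ_mul] at this
      rw [List.getElem?_append_left (by omega), ih (fun j hj => hg j (by omega)) h]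
    · rw [List.getElem?_append_right (by omega), hlen, Nat.add_sub_cancel_left]

theorem RefPoly.toList_eq (p : RefPoly) (N : ℕ) :
    p.toList N = (List.range N).map fun i : ℕ => p i := by
  -- In `RefPoly.toList` the coercion to the integers applies to the whole list, as a `flatMap` of
  -- singletons, and not to its members.
  have : ((List.range N).flatMap fun a : ℕ => [(a : ℤ)]) = (List.range N).map fun a : ℕ => (a : ℤ) :=
    List.map_eq_flatMap.symm
  change List.map (fun i => p i) ((List.range N).flatMap fun a : ℕ => [(a : ℤ)]) = _
  rw [this, List.map_map]
  rfl

section Represents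

variable {K : Type u}

/-- The references of `p` point to nodes with the values `v i`. -/
def Represents (env : List K) (p : RefPoly) (v : ℤ → K) : Prop := ∀ i, env[p i]? = some (v i)

namespace Represents

variable {env env' : List K} {p : RefPoly} {v : ℤ → K} {z : ℕ}

theorem mono (h : Represents env p v) (hp : env <+: env') : Represents env' p v :=
  fun i => hp.getElem?_eq_some_of (h i)

theorem rev (h : Represents env p v) (N : ℤ) :
    Represents env (p.rev N) fun i => v (N - i) := fun _ => h _

variable [Field K]

theorem ofList (hz : env[z]? = some 0) {l : List ℕ} {vals : List K} (h : HasValues env l vals) :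
    Represents env (RefPoly.ofList z l) fun i => if 0 ≤ i then vals.getD i.toNat 0 else 0 := by
  intro i
  dsimp only
  rw [RefPoly.ofList]
  split_ifs with h0
  · rcases lt_or_ge i.toNat vals.length with hi | hi
    · obtain ⟨j, hj, hv⟩ := h.getElem? (List.getElem?_eq_getElem hi)
      simp [List.getD, hj, hv, List.getElem?_eq_getElem hi]
    · rw [List.getD_eq_default _ _ (h.length_eq ▸ hi), List.getD_eq_default _ _ hi, hz]
  · exact hz

theorem ofList_firstCoeffs (hz : env[z]? = some 0) {l : List ℕ} {P : K[X]} {N : ℕ}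
    (hP : P.degree < N) (h : HasValues env l (firstCoeffs P N)) :
    Represents env (RefPoly.ofList z l) (zcoeff P) := by
  intro i
  rw [ofList hz h i, zcoeff]
  dsimp only
  split_ifs
  · rcases lt_or_ge i.toNat N with hi | hi
    · simp [firstCoeffs, List.getD, hi]
    · rw [List.getD_eq_default _ _ (by simpa [firstCoeffs] using hi), (degree_lt_iff_coeff_zero _ _).1 hP _ hi]
  · rfl

theorem slice (hz : env[z]? = some 0) (h : Represents env p v) (j k : ℤ) :
    Represents env (p.slice z j k) fun i => if 0 ≤ i ∧ i ≤ k then v (j + i) else 0 := by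
  intro i
  dsimp only
  rw [RefPoly.slice]
  split_ifs
  · exact h _
  · exact hz

theorem toList (h : Represents env p v) (N : ℕ) :
    HasValues env (p.toList N) (firstCoeffs (polyOf N v) N) := by
  rw [firstCoeffs_polyOf, RefPoly.toList_eq]
  exact HasValues.map (r := fun i : ℕ => p i) (v := fun i : ℕ => v i) fun i _ => h i

theorem toList_zcoeff {P : K[X]} (h : Represents env p (zcoeff P)) (N : ℕ) :
    HasValues env (p.toList N) (firstCoeffs P N) := by
  rw [RefPoly.toList_eq]
  refine HasValues.map (r := fun i : ℕ => p i) fun i _ => ?_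
  rw [h i, zcoeff_natCast]

end Represents

end Represents

theorem polyEntryList_eq {K : Type u} [Field K] {r s : ℕ} (A : ℕ → ℕ → K[X]) (N : ℕ) :
    polyEntryList (Matrix.of fun (i : Fin r) (j : Fin s) => A i j) N =
      (List.range r).flatMap fun i => (List.range s).flatMap fun j => firstCoeffs (A i j) N := by
  simp only [polyEntryList, ← List.map_coe_finRange_eq_range, List.flatMap_map, Matrix.of_apply]

/-! ### Correctness of the algorithms. -/

section Programs

variable {K : Type u} [Field K] [DecidableEq K] {S : Subroutines K} {env : List K} {z : ℕ}

theorem spec_addSub (hz : env[z]? = some 0) {o : ArithOp} {N : ℕ} {p q : RefPoly} {v w u : ℤ → K}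
    (hp : Represents env p v) (hq : Represents env q w)
    (ho : ∀ i, o.apply (v i) (w i) = some (u i)) :
    (addSub z o N p q).Spec env fun r env' =>
      Represents env' r fun i => if 0 ≤ i ∧ i < N then u i else 0 := by
  refine (Build.spec_loop (Q := fun i k env' => env'[k]? = some (u i))
    (fun i a env' env'' h ha => h.getElem?_eq_some_of ha)
    fun i _ env' h => Build.spec_arith ((hp.mono h) i) ((hq.mono h) i) (ho i)).bind ?_
  rintro l env' h ⟨hl, hval⟩
  refine Build.spec_pure fun i => ?_
  dsimp only
  rw [RefPoly.ofList]
  by_cases h₁ : 0 ≤ i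
  · rw [if_pos h₁]
    by_cases h₂ : i < N
    · obtain ⟨a, ha, hv⟩ := hval i.toNat (by omega)
      simpa [List.getD, ha, Int.toNat_of_nonneg h₁, h₁, h₂] using hv
    · rw [List.getD_eq_default _ _ (by omega), if_neg (by tauto)]
      exact h.getElem?_eq_some_of hz
  · rw [if_neg h₁, if_neg (by tauto)]
    exact h.getElem?_eq_some_of hz

variable (hS : S.Correct)
include hS

theorem spec_mulPoly (hz : env[z]? = some 0) {N M : ℕ} {p q : RefPoly} {v w : ℤ → K}
    (hp : Represents env p v) (hq : Represents env q w) :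
    (mulPoly S z N M p q).Spec env fun r env' => Represents env' r (conv N M v w) := by
  refine (Build.spec_call ((hp.toList N).append (hq.toList M))
    (hS.mul N M _ _ (degree_polyOf_lt N v) (degree_polyOf_lt M w))).bind fun l env' h hl => ?_
  refine Build.spec_pure ?_
  rw [← zcoeff_polyOf_mul]
  refine Represents.ofList_firstCoeffs (h.getElem?_eq_some_of hz) ?_ hl
  rw [degree_lt_iff_coeff_zero]
  intro k hk
  rw [← zcoeff_natCast, zcoeff_polyOf_mul, conv]
  refine Finset.sum_eq_zero fun a ha => Finset.sum_eq_zero fun b hb => if_neg ?_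
  rw [Finset.mem_range] at ha hb
  omega

theorem spec_mulRemPoly (hz : env[z]? = some 0) {n : ℕ} {f p q : RefPoly} {F P Q : K[X]}
    (hF : F.degree = n) (hP : P.degree < n ∨ n = 0) (hQ : Q.degree < n ∨ n = 0)
    (hf : Represents env f (zcoeff F)) (hp : Represents env p (zcoeff P))
    (hq : Represents env q (zcoeff Q)) :
    (mulRemPoly S z n f p q).Spec env fun r env' => Represents env' r (zcoeff (P * Q % F)) := by
  have hF0 : F ≠ 0 := by rintro rfl; simp at hF
  have hdeg : (P * Q % F).degree < n := hF ▸ degree_mod_lt _ hF0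
  -- For n = 0 the factors need not have degree < n (the constant 1 occurs), but their coefficient
  -- lists are empty, so they may be replaced by 0; the remainder is 0 anyway.
  by_cases hn : n = 0
  · subst hn
    have h0 (p : RefPoly) : HasValues env (p.toList 0) (firstCoeffs (0 : K[X]) 0) :=
      List.Forall₂.nil
    refine (Build.spec_call (((hf.toList_zcoeff _).append (h0 p)).append (h0 q))
      (hS.mulRem 0 F 0 0 hF (by simp) (by simp))).bind fun l env' h hl => ?_
    exact Build.spec_pure (Represents.ofList_firstCoeffs (h.getElem?_eq_some_of hz) hdeg hl)
  · refine (Build.spec_call (((hf.toList_zcoeff _).append (hp.toList_zcoeff _)).append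
      (hq.toList_zcoeff _)) (hS.mulRem n F P Q hF (hP.resolve_right hn)
        (hQ.resolve_right hn))).bind fun l env' h hl => ?_
    exact Build.spec_pure (Represents.ofList_firstCoeffs (h.getElem?_eq_some_of hz) hdeg hl)

theorem spec_quoPoly (hz : env[z]? = some 0) {N : ℕ} {g h : RefPoly} {v : ℤ → K} {G H : K[X]}
    (hg : ∀ i : ℕ, i < N → env[g i]? = some (G.coeff i))
    (hh : ∀ i : ℕ, i < N → env[h i]? = some (H.coeff i)) (hH : H.coeff 0 ≠ 0)
    (hv : ∀ i : ℤ, v i = if 0 ≤ i ∧ i < N then PowerSeries.coeff i.toNat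
      ((G : PowerSeries K) * (H : PowerSeries K)⁻¹) else 0) :
    (quoPoly S z N g h).Spec env fun r env' => Represents env' r v := by
  rw [quoPoly, RefPoly.toList_eq, RefPoly.toList_eq]
  refine (Build.spec_call (HasValues.append (HasValues.map (r := fun i : ℕ => g i) fun i hi => hg i (List.mem_range.1 hi))
    (HasValues.map (r := fun i : ℕ => h i) fun i hi => hh i (List.mem_range.1 hi))) (hS.quo N G H hH)).bind
      fun l env' h hl => ?_
  refine Build.spec_pure fun i => ?_
  rw [Represents.ofList (h.getElem?_eq_some_of hz) hl i, hv]
  dsimp only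
  by_cases h0 : 0 ≤ i
  · by_cases hN : i < N
    · rw [if_pos h0, if_pos ⟨h0, hN⟩]
      simp [List.getD, show i.toNat < N by omega]
    · rw [if_pos h0, if_neg (by tauto), List.getD_eq_default _ _ (by simp; omega)]
  · rw [if_neg h0, if_neg (by tauto)]

theorem spec_mulPolyMatrix (hz : env[z]? = some 0) {r q s m : ℕ} {P Q : ℕ → ℕ → RefPoly}
    {v w : ℕ → ℕ → ℤ → K} (hP : ∀ i < r, ∀ k < q, Represents env (P i k) (v i k))
    (hQ : ∀ k < q, ∀ j < s, Represents env (Q k j) (w k j)) :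
    (mulPolyMatrix S z r q s m P Q).Spec env fun A env' => ∀ i < r, ∀ j < s,
      Represents env' (A i j) fun c => ∑ k ∈ Finset.range q, conv m m (v i k) (w k j) c := by
  have h₁ := HasValues.flatMap (l := List.range r) fun i hi => HasValues.flatMap (l := List.range q)
    fun k hk => (hP i (List.mem_range.1 hi) k (List.mem_range.1 hk)).toList m
  have h₂ := HasValues.flatMap (l := List.range q) fun k hk => HasValues.flatMap (l := List.range s)
    fun j hj => (hQ k (List.mem_range.1 hk) j (List.mem_range.1 hj)).toList m
  rw [← polyEntryList_eq] at h₁ h₂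
  refine (Build.spec_call (h₁.append h₂) (hS.matMul r q s m _ _
    (fun i j => degree_polyOf_lt _ _) fun i j => degree_polyOf_lt _ _)).bind fun l env' h hl => ?_
  refine Build.spec_pure fun i hi j hj => ?_
  have hmul : (Matrix.of fun (i : Fin r) (k : Fin q) => polyOf m (v i k)) *
      (Matrix.of fun (k : Fin q) (j : Fin s) => polyOf m (w k j)) =
      Matrix.of fun (i : Fin r) (j : Fin s) =>
        ∑ k ∈ Finset.range q, polyOf m (v i k) * polyOf m (w k j) := by
    ext1 i j
    simp only [Matrix.mul_apply, Matrix.of_apply]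
    exact Fin.sum_univ_eq_sum_range (fun k => polyOf m (v i k) * polyOf m (w k j)) q
  rw [hmul, polyEntryList_eq fun i j =>
    ∑ k ∈ Finset.range q, polyOf m (v i k) * polyOf m (w k j)] at hl
  set W := 2 * m - 1 with hW
  set R : K[X] := ∑ k ∈ Finset.range q, polyOf m (v i k) * polyOf m (w k j) with hR
  have hzR : zcoeff R = fun c => ∑ k ∈ Finset.range q, conv m m (v i k) (w k j) c := by
    funext c
    simp only [← zcoeff_polyOf_mul, hR, zcoeff]
    split_ifs <;> simp [finsetSum_coeff]
  have hdeg : R.degree < W := by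
    rw [degree_lt_iff_coeff_zero]
    intro c hc
    rw [← zcoeff_natCast, hzR]
    refine Finset.sum_eq_zero fun k _ => Finset.sum_eq_zero fun a ha =>
      Finset.sum_eq_zero fun b hb => if_neg ?_
    rw [Finset.mem_range] at ha hb
    omega
  rw [← hzR]
  refine Represents.ofList_firstCoeffs (h.getElem?_eq_some_of hz) hdeg ?_
  rw [HasValues]
  -- Row-major layout: position (i s + j) W + c is read as i (s W) + (j W + c).
  convert List.forall₂_take W (List.forall₂_drop ((i * s + j) * W) hl) using 1
  refine List.ext_getElem? fun c => ?_
  rcases lt_or_ge c W with hc | hc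
  · rw [List.getElem?_take_of_lt hc, List.getElem?_drop, Nat.add_mul, mul_assoc, add_assoc,
      List.getElem?_flatMap_range (L := s * W) _ hi, List.getElem?_flatMap_range _ hj hc]
    · intro j _; simp [firstCoeffs]
    · have := Nat.mul_le_mul_right W (Nat.succ_le_of_lt hj)
      rw [Nat.succ_mul] at this
      omega
    · intro i _; simp [firstCoeffs, List.length_flatMap]
  · rw [List.getElem?_eq_none (by simpa [firstCoeffs] using hc),
      List.getElem?_eq_none ((List.length_take_le _ _).trans hc)]

end Programs

section Programs

variable {K : Type u} [Field K] [DecidableEq K] {S : Subroutines K} {env : List K} {z : ℕ}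

theorem spec_simultaneousTruncatedModularMultiplication (hS : S.Correct) (hz : env[z]? = some 0)
    {n r s m : ℕ} (hm : 0 < m) {f : RefPoly} {p q : ℕ → RefPoly} {F : K[X]} {P Q : ℕ → K[X]}
    (hF : F.degree = n) (hP : ∀ i < r, (P i).degree < n ∨ n = 0) (hQ : ∀ j < s, (Q j).degree < n)
    (hf : Represents env f (zcoeff F)) (hp : ∀ i < r, Represents env (p i) (zcoeff (P i)))
    (hq : ∀ j < s, Represents env (q j) (zcoeff (Q j))) :
    (simultaneousTruncatedModularMultiplication S z n r s f p q m).Spec env fun c env' =>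
      ∀ i < r, ∀ j < s, ∀ k : ℕ, k < m → env'[c i j k]? = some ((P i * Q j % F).coeff k) := by
  rw [simultaneousTruncatedModularMultiplication]
  set ℓ : ℕ := if n ≤ m then 0 else (n - m - 1) / m with hℓ
  set t : ℤ := (n : ℤ) - m - 1 - ℓ * m with ht
  have htm : t < m := by
    rw [ht, hℓ]
    split_ifs with h
    · push_cast; omega
    · have := Nat.lt_div_mul_add (a := n - m - 1) hm
      generalize (n - m - 1) / m = x at this
      zify at this
      omega
  have hdeg {i j : ℕ} (hi : i < r) (hj : j < s) (k : ℕ) :=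
    coeff_mul_div_eq_sum hF (hP i hi) (hQ j hj) k
  refine (Build.spec_loop (Q := fun j c env' => Represents env' c (revQuotient n F (Q j)))
    (fun i a env' env'' h ha => ha.mono h) fun j hj env' h => ?_).bind fun qbarList env₁ h₁ hbar => ?_
  · refine spec_quoPoly hS (h.getElem?_eq_some_of hz) (G := reflect (n - 1) (Q j))
      (H := reflect n F) (fun i hi => ?_) (fun i hi => ?_) (coeff_reflect_zero_ne_zero hF)
      fun i => rfl
    · rw [coeff_reflect_of_le _ (by omega), ← zcoeff_natCast, RefPoly.rev,
        show ((n - 1 - i : ℕ) : ℤ) = (n : ℤ) - 1 - i by omega]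
      exact (hq j hj).mono h _
    · rw [coeff_reflect_of_le _ (by omega), ← zcoeff_natCast, RefPoly.rev,
        show ((n - i : ℕ) : ℤ) = (n : ℤ) - i by omega]
      exact hf.mono h _
  have hz₁ := h₁.getElem?_eq_some_of hz
  have hqbar : ∀ j < s, Represents env₁ (qbarList.getD j fun _ => z) (revQuotient n F (Q j)) := by
    intro j hj
    obtain ⟨a, ha, hv⟩ := hbar.2 j hj
    simpa [List.getD, ha] using hv
  have hpbar : ∀ i < r, Represents env₁ ((p i).rev ((n : ℤ) - 1))
    fun a => zcoeff (P i) (n - 1 - a) := fun i hi => ((hp i hi).mono h₁).rev _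
  refine (spec_mulPolyMatrix hS hz₁ (fun i hi k _ => (hpbar i hi).slice hz₁ (k * m + t) (m - 1))
    (fun k _ j hj => (hqbar j hj).slice hz₁ (((ℓ : ℤ) - k) * m) (m - 1))).bind
      fun A env₂ h₂ hA => ?_
  have hz₂ := h₂.getElem?_eq_some_of hz₁
  refine (spec_mulPolyMatrix hS hz₂
    (fun i hi k _ => ((hpbar i hi).mono h₂).slice hz₂ (k * m + t) (m - 1))
    (fun k _ j hj => ((hqbar j hj).mono h₂).slice hz₂ (((ℓ : ℤ) - 1 - k) * m) (m - 1))).bind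
      fun B env₃ h₃ hB => ?_
  have h₁₃ := h₂.trans h₃
  have h₀₃ := h₁.trans h₁₃
  refine (Build.spec_loop (Q := fun i l env' => ∀ j < s, ∃ a, l[j]? = some a ∧
      ∀ k : ℕ, k < m → env'[(a : RefPoly) k]? = some ((P i * Q j % F).coeff k))
    (fun i a env' env'' h ha j hj => ?_) fun i hi env₄ h₄ => (Build.spec_loop (Q := fun j a env' =>
      ∀ k : ℕ, k < m → env'[(a : RefPoly) k]? = some ((P i * Q j % F).coeff k))
        (fun j a env' env'' h ha k hk => h.getElem?_eq_some_of (ha k hk))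
      fun j hj env₅ h₅ => ?_).mono fun l env' _ hl => hl.2).bind fun res env₄ h₄ hres => ?_
  · obtain ⟨b, hb, hv⟩ := ha j hj
    exact ⟨b, hb, fun k hk => h.getElem?_eq_some_of (hv k hk)⟩
  · have h₃₅ := h₄.trans h₅
    have h₁₅ := h₁₃.trans h₃₅
    have h₀₅ := h₀₃.trans h₃₅
    have hz₅ := h₀₅.getElem?_eq_some_of hz
    refine (spec_mulPoly hS hz₅ (((hpbar i hi).mono h₁₅).slice hz₅ 0 (t - 1))
      (((hqbar j hj).mono h₁₅).slice hz₅ (ℓ * m + 1) (m - 1 + t - 1))).bind fun D env₆ h₆ hD => ?_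
    have hz₆ := h₆.getElem?_eq_some_of hz₅
    refine (spec_addSub hz₆ (((hA i hi j hj).mono ((h₃.trans h₃₅).trans h₆)).slice hz₆ 0 (m - 1))
      (((hB i hi j hj).mono (h₃₅.trans h₆)).slice hz₆ m (m - 1)) fun c => rfl).bind
        fun AB env₇ h₇ hAB => ?_
    have hz₇ := h₇.getElem?_eq_some_of hz₆
    refine (spec_addSub hz₇ hAB ((hD.mono h₇).slice hz₇ (t - 1) (m - 1)) fun c => rfl).bind
      fun hbar env₈ h₈ hhbar => ?_
    have hz₈ := h₈.getElem?_eq_some_of hz₇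
    have h₀₈ := ((h₀₅.trans h₆).trans h₇).trans h₈
    refine (spec_mulPoly hS hz₈ ((hp i hi).mono h₀₈) ((hq j hj).mono h₀₈)).bind
      fun pq env₉ h₉ hpq => ?_
    have hz₉ := h₉.getElem?_eq_some_of hz₈
    refine (spec_mulPoly hS hz₉ ((hhbar.mono h₉).rev (m - 1)) (hf.mono (h₀₈.trans h₉))).bind
      fun hf' env₁₀ h₁₀ hhf => ?_
    refine (spec_addSub (h₁₀.getElem?_eq_some_of hz₉) (hpq.mono h₁₀) hhf fun c => rfl).mono
      fun c env' _ hc k hk => ?_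
    rw [hc k]
    dsimp only
    rw [if_pos (by omega)]
    congr 1
    -- Below x^m, the product of f and the quotient depends only on the first m coefficients of
    -- each, which is why `hbar` with m coefficients suffices.
    rw [conv_zcoeff_of_lt m _ _ hk, EuclideanDomain.mod_eq_sub_mul_div, coeff_sub, mul_comm F,
      ← conv_zcoeff_of_lt m (P i * Q j / F) F hk]
    congr 1
    refine conv_congr (fun a ha => ?_) (fun _ _ => rfl) _
    rw [if_pos (by omega), if_pos (by omega), if_pos (by omega), if_pos (by omega),
      if_pos (by omega), zcoeff_natCast, hdeg hi hj]
    -- Position m - 1 - a undoes the reversal of `hbar`; since ℓ m + t = n - m - 1, it is the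
    -- coefficient n - 2 - a of p̄ q̄.
    have key := conv_slices m ℓ t (fun a => zcoeff (P i) (n - 1 - a)) (revQuotient n F (Q j)) htm
      (fun b hb => if_neg (by omega)) (fun a ha b => ?_) (m - 1 - a) (by omega) (by omega)
    · have hE : (ℓ : ℤ) * m + t + (m - 1 - a) = n - 2 - a := by rw [ht]; ring
      rw [hE] at key
      rw [← key]
      refine congrArg₂ _ (congrArg₂ _ ?_ ?_) ?_
      · rw [zero_add]
        refine Finset.sum_congr rfl fun k _ => conv_congr (fun u hu => ?_) (fun u hu => ?_) _
        · rw [if_pos (by omega)]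
        · rw [if_pos (by omega)]
      · refine Finset.sum_congr rfl fun k _ => conv_congr (fun u hu => ?_) (fun u hu => ?_) _
        · rw [if_pos (by omega)]
        · rw [if_pos (by omega)]
      · refine conv_congr (fun u hu => ?_) (fun u hu => ?_) _
        · rw [if_pos (by omega), zero_add]
        · rw [if_pos (by omega)]
    -- Negative positions of p̄ are coefficients of index at least n, hence zero. For n = 0 they may
    -- be nonzero, but then q̄ = 0.
    · rcases hP i hi with h | rfl
      · rw [show zcoeff (P i) (n - 1 - a) = 0 from ?_, zero_mul]
        rw [show (n : ℤ) - 1 - a = ((n - 1 - a : ℤ).toNat : ℤ) by omega, zcoeff_natCast]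
        exact (degree_lt_iff_coeff_zero _ _).1 h _ (by omega)
      · rw [show revQuotient 0 F (Q j) b = 0 from if_neg (by omega), mul_zero]
  · refine Build.spec_pure fun i hi j hj k hk => ?_
    obtain ⟨l, hl, hv⟩ := hres.2 i hi
    obtain ⟨a, ha, hv⟩ := hv j hj
    simpa [List.getD, hl, ha] using hv k hk

theorem spec_truncatedPowersProgram (hS : S.Correct) (hz : env[z]? = some 0) {one : ℕ}
    (hone : env[one]? = some 1) {n m d : ℕ} (hm : 0 < m) (hd : 0 < d) {f a b : RefPoly}
    {F A B : K[X]} (hF : F.degree = n) (hA : A.degree < n) (hB : B.degree < n)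
    (hf : Represents env f (zcoeff F)) (ha : Represents env a (zcoeff A))
    (hb : Represents env b (zcoeff B)) :
    (truncatedPowersProgram S z one n f a b m d).Spec env fun c env' =>
      ∀ k < d, ∀ i : ℕ, i < m → env'[c k i]? = some ((A ^ k * B % F).coeff i) := by
  have hF0 : F ≠ 0 := by rintro rfl; simp at hF
  have hmod (R : K[X]) : (R % F).degree < n := hF ▸ degree_mod_lt R hF0
  have mod_mod (R : K[X]) : R % F % F = R % F := (mod_eq_self_iff hF0).2 (hF ▸ hmod R)
  have mod_mul_mod (R R' : K[X]) : (R * (R' % F)) % F = (R * R') % F := by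
    rw [Polynomial.mul_mod, mod_mod, ← Polynomial.mul_mod]
  rw [truncatedPowersProgram]
  set r := ceilSqrt d with hr
  set s := d ⌈/⌉ r with hs
  have hr0 : 0 < r := Nat.succ_pos _
  have hsd : d ≤ r * s := le_smul_ceilDiv hr0
  have hs0 : 0 < s := Nat.pos_of_ne_zero fun h => by rw [h] at hsd; omega
  -- The program starts from the constant 1, which differs from 1 rem f when n = 0. Only the class
  -- modulo f matters in the products.
  set Ah : ℕ → K[X] := fun i => if i = 0 then 1 else A ^ i % F with hAh
  have hAhdeg (i : ℕ) : (Ah i).degree < n ∨ n = 0 := by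
    rw [hAh]
    dsimp only
    split_ifs
    · rcases Nat.eq_zero_or_pos n with h | h
      · exact Or.inr h
      · left; rw [degree_one]; exact_mod_cast h
    · exact Or.inl (hmod _)
  have hAhmod (i : ℕ) : A ^ i % F = Ah i % F := by
    rw [hAh]
    dsimp only
    split_ifs with h
    · rw [h, pow_zero]
    · rw [mod_mod]
  refine (Build.spec_iterates (Q := fun i c env' => Represents env' c (zcoeff (Ah i)))
    (fun i c env' env'' h hc => hc.mono h) ?_ fun i hi c env' h hc => ?_).bind
      fun ahatList env₁ h₁ hahat => ?_
  · have : Represents env (RefPoly.ofList z [one]) (zcoeff (1 : K[X])) := by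
      refine Represents.ofList_firstCoeffs hz (N := 1) (by simp [degree_one]) ?_
      simpa [firstCoeffs, HasValues] using hone
    simpa [hAh] using this
  · have := spec_mulRemPoly hS (h.getElem?_eq_some_of hz) hF (Or.inl hA) (hAhdeg i) (hf.mono h)
      (ha.mono h) hc
    rwa [← mod_mul_mod, ← hAhmod, mod_mul_mod, ← pow_succ', show A ^ (i + 1) % F = Ah (i + 1) by
      simp [hAh]] at this
  have hz₁ := h₁.getElem?_eq_some_of hz
  have hget : ∀ i ≤ r, Represents env₁ (ahatList.getD i fun _ => z) (zcoeff (Ah i)) := by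
    intro i hi
    obtain ⟨a, ha, hv⟩ := hahat i hi
    simpa [List.getD, ha] using hv
  refine (Build.spec_iterates
    (Q := fun j c env' => Represents env' c (zcoeff (A ^ (r * j) * B % F)))
    (fun i c env' env'' h hc => hc.mono h) ?_ fun i hi c env' h hc => ?_).bind
      fun abarList env₂ h₂ habar => ?_
  · have hB' : B % F = B := (mod_eq_self_iff hF0).2 (hF ▸ hB)
    simpa [hB'] using hb.mono h₁
  · have := spec_mulRemPoly hS (h.getElem?_eq_some_of hz₁) hF (hAhdeg r) (Or.inl (hmod _))
      (hf.mono (h₁.trans h)) ((hget r le_rfl).mono h) hc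
    rwa [mod_mul_mod, mul_comm (Ah r), ← mod_mul_mod, ← hAhmod, mod_mul_mod, mul_right_comm,
      ← pow_add, ← Nat.mul_succ] at this
  have hz₂ := h₂.getElem?_eq_some_of hz₁
  refine (spec_simultaneousTruncatedModularMultiplication hS hz₂ hm (P := Ah)
    (Q := fun j => A ^ (r * j) * B % F) hF (fun i _ => hAhdeg i) (fun j _ => hmod _)
    (hf.mono (h₁.trans h₂)) (fun i hi => (hget i hi.le).mono h₂) (fun j hj => ?_)).bind
      fun c env₃ h₃ hc => Build.spec_pure fun k hk i hi => ?_
  · obtain ⟨a, ha, hv⟩ := habar j (by omega)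
    simpa [List.getD, ha] using hv
  · rw [hc (k % r) (Nat.mod_lt _ hr0) (k / r)
      (Nat.div_lt_of_lt_mul (lt_of_lt_of_le hk hsd)) i hi, mod_mul_mod, mul_comm (Ah _),
      ← mod_mul_mod, ← hAhmod, mod_mul_mod, mul_right_comm, ← pow_add, Nat.div_add_mod]

theorem eval_truncatedPowers (hS : S.Correct) {n m d : ℕ} (hm : 0 < m) (hd : 0 < d)
    {F A B : K[X]} (hF : F.degree = n) (hA : A.degree < n) (hB : B.degree < n) :
    (truncatedPowers S n m d).eval (firstCoeffs F (n + 1) ++ firstCoeffs A n ++ firstCoeffs B n) =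
      some ((List.range d).flatMap fun k => firstCoeffs (A ^ k * B % F) m) := by
  have hlen : 3 * n + 1 =
      (firstCoeffs F (n + 1) ++ firstCoeffs A n ++ firstCoeffs B n).length := by
    simp [firstCoeffs]; omega
  rw [truncatedPowers]
  dsimp only
  rw [hlen]
  set env := firstCoeffs F (n + 1) ++ firstCoeffs A n ++ firstCoeffs B n with henv
  have hfA : HasValues env (List.range (n + 1)) (firstCoeffs F (n + 1)) := by
    have := HasValues.map (env := env) (l := List.range (n + 1)) (r := id) (v := F.coeff)
      fun i hi => ?_
    · simpa [firstCoeffs] using this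
    · have := List.mem_range.1 hi
      rw [henv, List.append_assoc, List.getElem?_append_left (by simpa [firstCoeffs] using this)]
      simp [firstCoeffs, this]
  have haA : HasValues env ((List.range n).map fun i => n + 1 + i) (firstCoeffs A n) := by
    refine HasValues.map fun i hi => ?_
    have := List.mem_range.1 hi
    rw [henv, List.append_assoc, List.getElem?_append_right (by simp [firstCoeffs]),
      List.getElem?_append_left (by simp [firstCoeffs, this])]
    simp [firstCoeffs, this]
  have hbA : HasValues env ((List.range n).map fun i => 2 * n + 1 + i) (firstCoeffs B n) := by
    refine HasValues.map fun i hi => ?_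
    have := List.mem_range.1 hi
    rw [henv, List.getElem?_append_right (by simp [firstCoeffs]; omega)]
    simp [firstCoeffs, this, show 2 * n + 1 + i - (n + 1 + n) = i by omega]
  refine Build.Spec.eval_map ?_
  refine (Build.spec_const 0 env).bind fun z env₁ h₁ hz₁ => ?_
  refine (Build.spec_const 1 env₁).bind fun one env₂ h₂ hone => ?_
  have hz := h₂.getElem?_eq_some_of hz₁
  have h := h₁.trans h₂
  refine (spec_truncatedPowersProgram hS hz hone hm hd hF hA hB
    (Represents.ofList_firstCoeffs hz (by rw [hF]; exact_mod_cast Nat.lt_succ_self n) (hfA.mono h))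
    (Represents.ofList_firstCoeffs hz hA (haA.mono h))
    (Represents.ofList_firstCoeffs hz hB (hbA.mono h))).bind fun c env₃ h₃ hc => ?_
  refine Build.spec_pure (HasValues.flatMap fun k hk => ?_)
  rw [RefPoly.toList_eq]
  exact HasValues.map (r := fun i : ℕ => c k i) fun i hi =>
    hc k (List.mem_range.1 hk) i (List.mem_range.1 hi)

end Programs

/-! ### A calculus of quantities computable at bounded cost. -/

section Knowledge

variable {K : Type u} [Field K] [DecidableEq K] {X : Type u}

/-- On every instance `x`, given nodes with the values `g x` for all `g ∈ S`, the list `U x` can be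
computed at cost `c`, by a tree that does not depend on `x`. -/
def Solvable (S : Set (X → K)) (U : X → List K) (c : ℕ) : Prop :=
  ∀ (N : ℕ) (ρ : (X → K) → ℕ), ∃ T : CTree K (List ℕ), T.depth ≤ c ∧
    ∀ x env, env.length = N → (∀ g ∈ S, env[ρ g]? = some (g x)) → T.eval env = some (U x)

/-- Knowing the quantities in `S`, one can at cost `c` come to know a set of quantities that
contains `S` and satisfies `Φ`. -/
def Obtainable (S : Set (X → K)) (c : ℕ) (Φ : Set (X → K) → Prop) : Prop :=
  ∃ T, S ⊆ T ∧ Φ T ∧ ∀ U c', Solvable T U c' → Solvable S U (c' + c)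

theorem Solvable.mono {S T : Set (X → K)} {U : X → List K} {c c' : ℕ} (h : Solvable S U c)
    (hS : S ⊆ T) (hc : c ≤ c') : Solvable T U c' := fun N ρ => by
  obtain ⟨t, ht, hval⟩ := h N ρ
  exact ⟨t, ht.trans hc, fun x env hN hg => hval x env hN fun g hgS => hg g (hS hgS)⟩

namespace Obtainable

variable {S : Set (X → K)} {c c' : ℕ} {Φ Ψ : Set (X → K) → Prop}

theorem of (h : Φ S) (c : ℕ) : Obtainable S c Φ :=
  ⟨S, subset_rfl, h, fun _ _ hU => hU.mono subset_rfl (Nat.le_add_right _ _)⟩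

theorem mono (h : Obtainable S c Φ) (hc : c ≤ c') (hΦ : ∀ T, S ⊆ T → Φ T → Ψ T) :
    Obtainable S c' Ψ := by
  obtain ⟨T, hT, hΦT, hU⟩ := h
  exact ⟨T, hT, hΦ T hT hΦT, fun U k hk => (hU U k hk).mono subset_rfl (by omega)⟩

theorem bind (h : Obtainable S c Φ) (hΦ : ∀ T, S ⊆ T → Φ T → Obtainable T c' Ψ) :
    Obtainable S (c + c') Ψ := by
  obtain ⟨T, hT, hΦT, hU⟩ := h
  obtain ⟨T', hT', hΨ, hU'⟩ := hΦ T hT hΦT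
  exact ⟨T', hT.trans hT', hΨ, fun U k hk =>
    (hU U _ (hU' U k hk)).mono subset_rfl (by omega)⟩

/-- The tasks are done one after the other; monotonicity of each Φ keeps what was obtained before.
-/
theorem all {ι : Type*} (s : Finset ι) {Φ : ι → Set (X → K) → Prop}
    (hmono : ∀ i ∈ s, ∀ T T', T ⊆ T' → Φ i T → Φ i T')
    (h : ∀ i ∈ s, ∀ T, S ⊆ T → Obtainable T c (Φ i)) :
    Obtainable S (s.card * c) fun T => ∀ i ∈ s, Φ i T := by
  classical
  induction s using Finset.induction_on with
  | empty => exact of (by simp) _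
  | insert i s hi ih =>
    rw [Finset.card_insert_of_notMem hi, Nat.succ_mul]
    refine (ih (fun j hj => hmono j (Finset.mem_insert_of_mem hj))
      fun j hj => h j (Finset.mem_insert_of_mem hj)).bind fun T hT hall => ?_
    refine (h i (Finset.mem_insert_self i s) T hT).mono le_rfl fun T' hT' hi' j hj => ?_
    rcases Finset.mem_insert.1 hj with rfl | hj
    · exact hi'
    · exact hmono j (Finset.mem_insert_of_mem hj) T T' hT' (hall j hj)

theorem arith {o : ArithOp} {f g h : X → K} (hf : f ∈ S) (hg : g ∈ S)
    (ho : ∀ x, o.apply (f x) (g x) = some (h x)) : Obtainable S 1 (h ∈ ·) := by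
  classical
  refine ⟨insert h S, Set.subset_insert _ _, Set.mem_insert _ _, fun U k hU N ρ => ?_⟩
  obtain ⟨t, ht, hval⟩ := hU (N + 1) (Function.update ρ h N)
  refine ⟨.arith o (ρ f) (ρ g) t, by simpa [CTree.depth] using ht, fun x env hN hρ => ?_⟩
  simp only [CTree.eval, hρ f hf, hρ g hg, ho, Option.bind_some]
  refine hval x _ (by simp [hN]) fun g' hg' => ?_
  by_cases hgh : g' = h
  · subst hgh; simp [hN]
  · rw [Function.update_of_ne hgh]
    exact (List.prefix_append _ _).getElem?_eq_some_of (hρ g' (hg'.resolve_left hgh))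

theorem add {f g : X → K} (hf : f ∈ S) (hg : g ∈ S) : Obtainable S 1 (f + g ∈ ·) :=
  arith (o := .add) hf hg fun _ => rfl

theorem sub {f g : X → K} (hf : f ∈ S) (hg : g ∈ S) : Obtainable S 1 (f - g ∈ ·) :=
  arith (o := .sub) hf hg fun _ => rfl

theorem mul {f g : X → K} (hf : f ∈ S) (hg : g ∈ S) : Obtainable S 1 (f * g ∈ ·) :=
  arith (o := .mul) hf hg fun _ => rfl

theorem div {f g : X → K} (hf : f ∈ S) (hg : g ∈ S) (h0 : ∀ x, g x ≠ 0) :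
    Obtainable S 1 (f / g ∈ ·) :=
  arith (o := .div) hf hg fun x => by simp [ArithOp.apply, h0 x]

theorem const (a : K) : Obtainable S 1 ((fun _ => a) ∈ ·) := by
  classical
  refine ⟨insert (fun _ => a) S, Set.subset_insert _ _, Set.mem_insert _ _, fun U k hU N ρ => ?_⟩
  obtain ⟨t, ht, hval⟩ := hU (N + 1) (Function.update ρ (fun _ => a) N)
  refine ⟨.const a t, by simpa [CTree.depth] using ht, fun x env hN hρ => ?_⟩
  refine hval x _ (by simp [hN]) fun g' hg' => ?_
  by_cases hgh : g' = fun _ => a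
  · subst hgh; simp [hN]
  · rw [Function.update_of_ne hgh]
    exact (List.prefix_append _ _).getElem?_eq_some_of (hρ g' (hg'.resolve_left hgh))

theorem sum {ι : Type*} (s : Finset ι) {f : ι → X → K} (hf : ∀ i ∈ s, f i ∈ S) :
    Obtainable S (s.card + 1) ((∑ i ∈ s, f i) ∈ ·) := by
  classical
  induction s using Finset.induction_on with
  | empty => exact const 0
  | insert i s hi ih =>
    rw [Finset.card_insert_of_notMem hi, Finset.sum_insert hi]
    exact (ih fun j hj => hf j (Finset.mem_insert_of_mem hj)).bind fun T hT hsum =>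
      add (hT (hf i (Finset.mem_insert_self i s))) hsum

/-- The results of a tree can be obtained from its inputs. -/
theorem tree (t : CTree K (List ℕ)) {ins outs : List (X → K)} (hins : ∀ f ∈ ins, f ∈ S)
    (ht : ∀ x, t.eval (ins.map (· x)) = some (outs.map (· x))) :
    Obtainable S t.depth fun T => ∀ f ∈ outs, f ∈ T := by
  classical
  refine ⟨S ∪ {f | f ∈ outs}, Set.subset_union_left, fun f hf => Or.inr hf, fun U k hU N ρ => ?_⟩
  choose cont hcont hval using hU
  -- The tree may branch, so the number of nodes and the places of the outputs depend on the leaf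
  -- that is reached; the continuation is chosen separately for each leaf.
  let ρ' (l : List ℕ) : (X → K) → ℕ := fun g => if g ∈ S then ρ g else l.getD (outs.idxOf g) 0
  refine ⟨(Build.call t (ins.map ρ) N).bind fun r => cont r.2 (ρ' r.1), ?_, fun x env hN hρ => ?_⟩
  · refine (CTree.depth_bind_le _ _ k fun r => hcont _ _).trans ?_
    rw [Nat.add_comm]
    exact Nat.add_le_add_left (Build.CostLE.call t (ins.map ρ) N) _
  · obtain ⟨l, env', h₁, h₂, h₃⟩ := Build.spec_call
      (HasValues.map (r := ρ) (v := fun f => f x) fun f hf => hρ f (hins f hf)) (ht x)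
    rw [← hN, CTree.eval_eq_run, CTree.run_bind, h₁, Option.bind_some, ← CTree.eval_eq_run]
    refine hval _ _ x env' rfl fun g hg => ?_
    by_cases hgS : g ∈ S
    · simpa only [ρ', if_pos hgS] using h₂.getElem?_eq_some_of (hρ g hgS)
    · have hgo : g ∈ outs := hg.resolve_left hgS
      simp only [ρ', if_neg hgS]
      obtain ⟨j, hj, hv⟩ := h₃.getElem? (i := outs.idxOf g) (v := g x) (by simp [List.getElem?_idxOf hgo])
      simpa [List.getD, hj] using hv

/-- A tree that computes obtainable quantities. -/
theorem exists_tree {ins outs : List (X → K)}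
    (h : Obtainable {f | f ∈ ins} c fun T => ∀ f ∈ outs, f ∈ T) :
    ∃ t : CTree K (List ℕ), t.depth ≤ c ∧
      ∀ x, t.eval (ins.map (· x)) = some (outs.map (· x)) := by
  classical
  obtain ⟨T, hT, houts, hU⟩ := h
  have : Solvable T (fun x => outs.map (· x)) 0 := fun N ρ =>
    ⟨.leaf (outs.map ρ), le_rfl, fun x env _ hρ => HasValues.mapM_eq.2
      (HasValues.map fun f hf => hρ f (houts f hf))⟩
  obtain ⟨t, ht, hval⟩ := hU _ 0 this ins.length fun f => ins.idxOf f
  refine ⟨t, by simpa using ht, fun x => hval x _ (by simp) fun g hg => ?_⟩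
  simp [List.getElem?_idxOf (show g ∈ ins from hg)]

end Obtainable

end Knowledge

/-! ### Algebra of the radix p fast Fourier transform. -/

section RadixAlgebra

variable {A : Type u} [CommRing A]

/-- The polynomial with coefficients `F 0, …, F (q - 1)`. -/
noncomputable def seqPoly (q : ℕ) (F : ℕ → A) : A[X] := ∑ k ∈ Finset.range q, C (F k) * X ^ k

theorem degree_seqPoly_lt (q : ℕ) (F : ℕ → A) : (seqPoly q F).degree < q := by
  rw [degree_lt_iff_coeff_zero]
  intro m hm
  simp only [seqPoly, finsetSum_coeff, coeff_C_mul_X_pow]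
  exact Finset.sum_eq_zero fun k hk => if_neg (by have := Finset.mem_range.1 hk; omega)

theorem eval_seqPoly (q : ℕ) (F : ℕ → A) (y : A) :
    (seqPoly q F).eval y = ∑ k ∈ Finset.range q, F k * y ^ k := by
  simp [seqPoly, eval_finsetSum]

theorem seqPoly_mul (p q : ℕ) (F : ℕ → A) :
    seqPoly (p * q) F = ∑ u ∈ Finset.range p, (X ^ q) ^ u * seqPoly q fun k => F (u * q + k) := by
  rw [seqPoly, sum_range_mul]
  refine Finset.sum_congr rfl fun u _ => ?_
  rw [seqPoly, Finset.mul_sum]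
  refine Finset.sum_congr rfl fun k _ => ?_
  rw [← pow_mul, pow_add, mul_comm q]
  ring

theorem seqPoly_sum (p q : ℕ) (c : ℕ → A) (F : ℕ → ℕ → A) :
    seqPoly q (fun k => ∑ u ∈ Finset.range p, c u * F u k) =
      ∑ u ∈ Finset.range p, C (c u) * seqPoly q (F u) := by
  simp only [seqPoly, Finset.mul_sum, map_sum, Finset.sum_mul]
  rw [Finset.sum_comm]
  simp [mul_assoc]

/-- Reduction modulo `x^q - v`. -/
theorem dvd_seqPoly_sub (p q : ℕ) (F : ℕ → A) (v : A) :
    (X ^ q - C v) ∣ seqPoly (p * q) F -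
      seqPoly q fun k => ∑ u ∈ Finset.range p, v ^ u * F (u * q + k) := by
  rw [seqPoly_mul, seqPoly_sum p q (fun u => v ^ u) fun u k => F (u * q + k),
    ← Finset.sum_sub_distrib]
  refine Finset.dvd_sum fun u _ => ?_
  rw [← sub_mul, C_pow]
  exact (sub_dvd_pow_sub_pow _ _ _).mul_right _

variable {p : ℕ} {pinv : A} (hpinv : (p : A) * pinv = 1) {v y : ℕ → A}
include hpinv

/-- Chinese remaindering: the polynomial `H` reduces to `H i` modulo `x^q - v i`. -/
theorem dvd_seqPoly_interpolate (q : ℕ) (horth : ∀ i < p, ∀ j < p, ∑ u ∈ Finset.range p,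
      (v i * y j) ^ u = if i = j then (p : A) else 0) (H : ℕ → ℕ → A) {i : ℕ} (hi : i < p) :
    (X ^ q - C (v i)) ∣ seqPoly (p * q)
      (fun t => pinv * ∑ j ∈ Finset.range p, y j ^ (t / q) * H j (t % q)) - seqPoly q (H i) := by
  set G : ℕ → A := fun t => pinv * ∑ j ∈ Finset.range p, y j ^ (t / q) * H j (t % q) with hG
  suffices h : seqPoly q (fun k => ∑ u ∈ Finset.range p, v i ^ u * G (u * q + k)) =
      seqPoly q (H i) from h ▸ dvd_seqPoly_sub p q G (v i)
  refine Finset.sum_congr rfl fun k hk => ?_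
  have hk := Finset.mem_range.1 hk
  congr 2
  calc _ = ∑ u ∈ Finset.range p, ∑ j ∈ Finset.range p, pinv * H j k * (v i * y j) ^ u := by
        refine Finset.sum_congr rfl fun u _ => ?_
        rw [hG]
        dsimp only
        rw [Finset.mul_sum, Finset.mul_sum]
        refine Finset.sum_congr rfl fun j _ => ?_
        rw [Nat.mul_add_mod', Nat.mod_eq_of_lt hk, mul_comm u, Nat.mul_add_div (by omega),
          Nat.div_eq_of_lt hk, add_zero, mul_pow]
        ring
    _ = H i k := by
        rw [Finset.sum_comm]
        simp_rw [← Finset.mul_sum]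
        rw [Finset.sum_congr rfl fun j hj => by rw [horth i hi j (Finset.mem_range.1 hj)]]
        simp only [mul_ite, mul_zero, Finset.sum_ite_eq, Finset.mem_range, hi, if_true]
        rw [mul_right_comm, mul_comm pinv, hpinv, one_mul]

/-- Divisibility by all factors `x^q - v i` implies divisibility by `x^(p q) - v^p`. -/
theorem dvd_of_forall_dvd (q : ℕ) {w : A} (hp : 0 < p) (hv : ∀ i < p, v i ^ p = w)
    (hvy : ∀ i < p, v i * y i = 1)
    (hsum : ∀ u, 0 < u → u < p → ∑ i ∈ Finset.range p, y i ^ u = 0) {h : A[X]}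
    (hdvd : ∀ i < p, (X ^ q - C (v i)) ∣ h) : (X ^ (p * q) - C w) ∣ h := by
  -- The inner sum is the cofactor of X^q - v_i in X^(pq) - w. Lagrange interpolation of the
  -- constant 1 at the v_i gives this partition of unity, which replaces a coprimality argument and
  -- works over any commutative ring.
  have key : ∑ i ∈ Finset.range p, (C (pinv * y i ^ (p - 1)) *
      ∑ u ∈ Finset.range p, (X ^ q) ^ u * C (v i) ^ (p - 1 - u)) = (1 : A[X]) := by
    have h1 : ∀ i ∈ Finset.range p, (C (pinv * y i ^ (p - 1)) *
        ∑ u ∈ Finset.range p, (X ^ q : A[X]) ^ u * C (v i) ^ (p - 1 - u)) =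
        ∑ u ∈ Finset.range p, (X ^ q) ^ u * C (pinv * y i ^ u) := by
      intro i hi
      rw [Finset.mul_sum]
      refine Finset.sum_congr rfl fun u hu => ?_
      have hu := Finset.mem_range.1 hu
      rw [mul_left_comm, ← C_pow, ← C_mul, mul_assoc,
        show p - 1 = u + (p - 1 - u) by omega, pow_add, show u + (p - 1 - u) - u = p - 1 - u by omega,
        mul_assoc, ← mul_pow, mul_comm (y i), hvy i (Finset.mem_range.1 hi), one_pow, mul_one]
    rw [Finset.sum_congr rfl h1, Finset.sum_comm]
    simp_rw [← Finset.mul_sum, ← map_sum, ← Finset.mul_sum]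
    rw [Finset.sum_eq_single 0]
    · simp [mul_comm pinv, hpinv]
    · intro u hu hu0
      rw [hsum u (Nat.pos_of_ne_zero hu0) (Finset.mem_range.1 hu)]
      simp
    · intro h0; simp at h0; omega
  rw [← one_mul h, ← key, Finset.sum_mul]
  refine Finset.dvd_sum fun i hi => ?_
  have hi := Finset.mem_range.1 hi
  obtain ⟨g, rfl⟩ := hdvd i hi
  rw [mul_assoc, ← mul_assoc (∑ u ∈ _, _), geom_sum₂_mul, ← C_pow, hv i hi, ← pow_mul, mul_comm q]
  exact ⟨C (pinv * y i ^ (p - 1)) * g, by ring⟩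

end RadixAlgebra

/-! ### Arithmetic in a ring with a root of unity, with redundant expansions. -/

section KnownIn

variable {K : Type u} [Field K] {X A : Type u} [CommRing A] [Algebra K A]

/-- Coefficients of an expansion `a = ∑_{k < n} v_k z^k` belong to `S`. -/
def KnownIn (S : Set (X → K)) (z : A) (n : ℕ) (a : X → A) : Prop :=
  ∃ v : ℕ → X → K, (∀ k < n, v k ∈ S) ∧ ∀ x, a x = ∑ k ∈ Finset.range n, v k x • z ^ k

namespace KnownIn

variable {S T : Set (X → K)} {z : A} {n : ℕ} {a : X → A}

theorem mono (h : KnownIn S z n a) (hT : S ⊆ T) : KnownIn T z n a := by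
  obtain ⟨v, hv, ha⟩ := h
  exact ⟨v, fun k hk => hT (hv k hk), ha⟩

theorem congr {b : X → A} (h : KnownIn S z n a)
    (hab : ∀ x, b x = a x) : KnownIn S z n b := by rwa [funext hab]

theorem zero (h0 : (0 : X → K) ∈ S) : KnownIn S z n fun _ => 0 :=
  ⟨fun _ => 0, fun _ _ => h0, by simp⟩

/-- Multiplication by z shifts the expansion cyclically. No new quantity is computed: the set S
stays the same. This makes the twiddle factors of the Fourier transform free. -/
theorem pow_mul (hz : z ^ n = 1) (h : KnownIn S z n a) (e : ℕ) :
    KnownIn S z n fun x => z ^ e * a x := by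
  induction e with
  | zero => simpa using h
  | succ e ih =>
    obtain ⟨v, hv, ha⟩ := ih
    cases n with
    | zero =>
      refine ⟨v, hv, fun x => ?_⟩
      dsimp only at ha ⊢
      rw [pow_succ', mul_assoc, ha]; simp
    | succ n =>
      refine ⟨fun k => if k = 0 then v n else v (k - 1), fun k hk => ?_, fun x => ?_⟩
      · dsimp only
        split_ifs
        · exact hv n (Nat.lt_succ_self n)
        · exact hv (k - 1) (by omega)
      · dsimp only at ha ⊢
        rw [pow_succ', mul_assoc, ha, Finset.sum_range_succ, Finset.sum_range_succ', mul_add,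
          Finset.mul_sum]
        congr 1
        · refine Finset.sum_congr rfl fun k _ => ?_
          rw [mul_smul_comm, pow_succ' z k]; simp
        · rw [mul_smul_comm, ← pow_succ', hz]; simp

variable [DecidableEq K]

theorem sum {ι : Type*} (s : Finset ι) {a : ι → X → A} (h : ∀ i ∈ s, KnownIn S z n (a i)) :
    Obtainable S (n * (s.card + 1)) fun T => KnownIn T z n fun x => ∑ i ∈ s, a i x := by
  classical
  choose! v hv ha using h
  have := Obtainable.all (S := S) (c := s.card + 1) (Finset.range n)
    (Φ := fun k T => (∑ i ∈ s, v i k) ∈ T) (fun k _ T T' hT h => hT h)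
    fun k hk T hT => Obtainable.sum s fun i hi => hT (hv i hi k (Finset.mem_range.1 hk))
  rw [Finset.card_range] at this
  refine this.mono le_rfl fun T _ hT => ⟨fun k => ∑ i ∈ s, v i k,
    fun k hk => hT k (Finset.mem_range.2 hk), fun x => ?_⟩
  dsimp only
  rw [Finset.sum_congr rfl fun i hi => ha i hi x, Finset.sum_comm]
  simp only [Finset.sum_apply, Finset.sum_smul]

theorem smul {c : K} (hc : (fun _ => c) ∈ S) (h : KnownIn S z n a) :
    Obtainable S n fun T => KnownIn T z n fun x => algebraMap K A c * a x := by
  obtain ⟨v, hv, ha⟩ := h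
  have := Obtainable.all (S := S) (c := 1) (Finset.range n)
    (Φ := fun k T => (fun _ => c) * v k ∈ T) (fun k _ T T' hT h => hT h)
    fun k hk T hT => Obtainable.mul (hT hc) (hT (hv k (Finset.mem_range.1 hk)))
  rw [Finset.card_range, mul_one] at this
  refine this.mono le_rfl fun T _ hT => ⟨fun k => (fun _ => c) * v k,
    fun k hk => hT k (Finset.mem_range.2 hk), fun x => ?_⟩
  dsimp only
  rw [ha, Finset.mul_sum]
  refine Finset.sum_congr rfl fun k _ => ?_
  rw [Pi.mul_apply, mul_smul, ← Algebra.smul_def]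

end KnownIn

end KnownIn

/-! ### Matrix products by fast Fourier transforms. -/

section MatrixProducts

variable {K : Type u} [Field K] [DecidableEq K] {Ω A : Type u} [CommRing A] [Algebra K A]
variable (α β γ : Type) [Fintype β]

variable (K Ω) in
/-- Products of `α × β` by `β × γ` matrices with entries in `K` cost at most `c`. -/
def MatMulCost (c : ℕ) : Prop :=
  ∀ (S : Set (Ω → K)) (P : α → β → Ω → K) (Q : β → γ → Ω → K), (∀ i b, P i b ∈ S) →
    (∀ b j, Q b j ∈ S) → Obtainable S c fun T => ∀ i j, (∑ b, P i b * Q b j) ∈ T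

variable (K Ω) in
/-- Products of `α × β` by `β × γ` matrices cost at most `c`, for entries in `A` that are given by
expansions of length `n` in powers of `z`, if the constants `0` and `κ` are known. -/
def RingMatMulCost (κ : K) (z : A) (n c : ℕ) : Prop :=
  ∀ (S : Set (Ω → K)) (P : α → β → Ω → A) (Q : β → γ → Ω → A), (0 : Ω → K) ∈ S →
    (fun _ => κ) ∈ S → (∀ i b, KnownIn S z n (P i b)) → (∀ b j, KnownIn S z n (Q b j)) →
    Obtainable S c fun T => ∀ i j, KnownIn T z n fun x => ∑ b, P i b x * Q b j x

variable (K Ω) in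
/-- Products of `α × β` by `β × γ` matrices of polynomials over `A` modulo `x^q - z^(e q)` cost
at most `c`. -/
def CyclicMatMulCost (κ : K) (z : A) (n q e c : ℕ) : Prop :=
  ∀ (S : Set (Ω → K)) (F : α → β → ℕ → Ω → A) (G : β → γ → ℕ → Ω → A), (0 : Ω → K) ∈ S →
    (fun _ => κ) ∈ S → (∀ i b, ∀ k < q, KnownIn S z n (F i b k)) →
    (∀ b j, ∀ k < q, KnownIn S z n (G b j k)) →
    Obtainable S c fun T => ∃ H : α → γ → ℕ → Ω → A, (∀ i j, ∀ k < q, KnownIn T z n (H i j k)) ∧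
      ∀ i j x, (X ^ q - C (z ^ (e * q))) ∣
        (∑ b, seqPoly q (fun k => F i b k x) * seqPoly q (fun k => G b j k x)) -
          seqPoly q fun k => H i j k x

variable {α β γ}

/-- End of the Fourier recursion: for q = 1 the polynomials are constants and the products agree
exactly. -/
theorem RingMatMulCost.cyclic_one {κ : K} {z : A} {n c : ℕ}
    (h : RingMatMulCost K Ω α β γ κ z n c) (e : ℕ) :
    CyclicMatMulCost K Ω α β γ κ z n 1 e c := by
  intro S F G h0 hκ hF hG
  refine (h S (fun i b => F i b 0) (fun b j => G b j 0) h0 hκ (fun i b => hF i b 0 one_pos)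
    fun b j => hG b j 0 one_pos).mono le_rfl fun T _ hT =>
      ⟨fun i j _ x => ∑ b, F i b 0 x * G b j 0 x, fun i j k _ => hT i j, fun i j x => ?_⟩
  simp [seqPoly]

variable [Fintype α] [Fintype γ]

/-- Naive products. -/
theorem MatMulCost.ring {c : ℕ} (h : MatMulCost K Ω α β γ c) (κ : K) {z : A} {n : ℕ}
    (hz : z ^ n = 1) : RingMatMulCost K Ω α β γ κ z n
      (n * n * c + Fintype.card (α × γ) * (n * (n + 1))) := by
  intro S P Q h0 hκ hP hQ
  choose v hv hP using hP
  choose w hw hQ using hQ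
  have h₁ := Obtainable.all (S := S) (c := c) (Finset.range n ×ˢ Finset.range n)
    (Φ := fun k T => ∀ i j, (∑ b, v i b k.1 * w b j k.2) ∈ T)
    (fun k _ T T' hT h i j => hT (h i j)) fun k hk T hT => by
      rw [Finset.mem_product, Finset.mem_range, Finset.mem_range] at hk
      exact h T (fun i b => v i b k.1) (fun b j => w b j k.2) (fun i b => hT (hv i b _ hk.1))
        fun b j => hT (hw b j _ hk.2)
  rw [Finset.card_product, Finset.card_range] at h₁
  refine h₁.bind fun T hT hvw => ?_
  have hrow (i : α) (j : γ) : ∀ k ∈ Finset.range n, KnownIn T z n fun x =>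
      z ^ k * ∑ l ∈ Finset.range n, (∑ b, v i b k * w b j l) x • z ^ l := by
    intro k hk
    refine KnownIn.pow_mul hz ⟨fun l => ∑ b, v i b k * w b j l, fun l hl => ?_, fun x => rfl⟩ k
    exact hvw (k, l) (Finset.mem_product.2 ⟨hk, Finset.mem_range.2 hl⟩) i j
  have h₂ := Obtainable.all (S := T) (c := n * (n + 1)) (Finset.univ : Finset (α × γ))
    (Φ := fun ij T => KnownIn T z n fun x => ∑ k ∈ Finset.range n,
      z ^ k * ∑ l ∈ Finset.range n, (∑ b, v ij.1 b k * w b ij.2 l) x • z ^ l)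
    (fun k _ T T' hT h => h.mono hT) fun ij _ T' hT' => by
      have := KnownIn.sum (S := T') (z := z) (n := n) (Finset.range n)
        (fun k hk => (hrow ij.1 ij.2 k hk).mono hT')
      rwa [Finset.card_range] at this
  refine h₂.mono (by rw [Finset.card_univ]) fun T' _ h i j => ?_
  convert h (i, j) (Finset.mem_univ _) using 1
  funext x
  simp only [hP, hQ, Finset.sum_mul_sum]
  rw [Finset.sum_comm]
  refine Finset.sum_congr rfl fun k _ => ?_
  rw [Finset.sum_comm, Finset.mul_sum]
  refine Finset.sum_congr rfl fun l _ => ?_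
  rw [Finset.sum_apply, Finset.sum_smul, Finset.mul_sum]
  refine Finset.sum_congr rfl fun b _ => ?_
  rw [smul_mul_smul_comm, mul_smul_comm, Pi.mul_apply]

theorem sum_pow_mul_eq_ite {p L : ℕ} {z : A} (hz : z ^ (p * L) = 1)
    (hζ : ∀ m, ¬ p ∣ m → ∑ i ∈ Finset.range p, (z ^ L) ^ (m * i) = 0) (m : ℕ) :
    ∑ i ∈ Finset.range p, (z ^ L) ^ (m * i) = if p ∣ m then (p : A) else 0 := by
  split_ifs with h
  · obtain ⟨k, rfl⟩ := h
    rw [Finset.sum_congr rfl fun i _ => by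
      rw [← pow_mul, show L * (p * k * i) = p * L * (k * i) by ring, pow_mul, hz, one_pow]]
    simp
  · exact hζ m h

/-- The butterflies of the transform and of its inverse: the factors are powers of z, so only
additions are paid for. -/
theorem KnownIn.shifted_sums {ι : Type} [Fintype ι] {S : Set (Ω → K)} {z : A} {n : ℕ}
    (hz : z ^ n = 1) (p q : ℕ) {F : ι → ℕ → ℕ → Ω → A} (E : ℕ → ℕ → ℕ)
    (hF : ∀ t, ∀ u < p, ∀ k < q, KnownIn S z n (F t u k)) :
    Obtainable S (Fintype.card ι * (p * q) * (n * (p + 1))) fun T =>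
      ∀ t, ∀ i < p, ∀ k < q, KnownIn T z n fun x =>
        ∑ u ∈ Finset.range p, z ^ E i u * F t u k x := by
  have := Obtainable.all (S := S) (c := n * (p + 1))
    ((Finset.univ : Finset ι) ×ˢ (Finset.range p ×ˢ Finset.range q))
    (Φ := fun t T => KnownIn T z n fun x =>
      ∑ u ∈ Finset.range p, z ^ E t.2.1 u * F t.1 u t.2.2 x)
    (fun k _ T T' hT h => h.mono hT) fun t ht T hT => by
      simp only [Finset.mem_product, Finset.mem_univ, true_and, Finset.mem_range] at ht
      have := KnownIn.sum (S := T) (z := z) (n := n) (Finset.range p)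
        (a := fun u x => z ^ E t.2.1 u * F t.1 u t.2.2 x) fun u hu =>
          KnownIn.pow_mul hz ((hF _ _ (Finset.mem_range.1 hu) _ ht.2).mono hT) _
      rwa [Finset.card_range] at this
  refine this.mono (by simp [Finset.card_univ]) fun T _ h t i hi k hk => h (t, (i, k)) ?_
  simp [hi, hk]

/-- One step of the radix `p` fast Fourier transform. -/
theorem CyclicMatMulCost.step {κ : K} {z : A} {p L q c : ℕ} (hp : 0 < p) (hκ : (p : K) * κ = 1)
    (hz : z ^ (p * L) = 1) (hζ : ∀ m, ¬ p ∣ m → ∑ i ∈ Finset.range p, (z ^ L) ^ (m * i) = 0)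
    (hL : 0 < L) (hq : q ∣ L) (h : ∀ e, CyclicMatMulCost K Ω α β γ κ z (p * L) q e c) (e : ℕ) :
    CyclicMatMulCost K Ω α β γ κ z (p * L) (p * q) e
      (p * c + (Fintype.card (α × β) + Fintype.card (β × γ) + Fintype.card (α × γ)) *
        (p * q * (p * L * (p + 2)))) := by
  intro S F G h0 hκS hF hG
  set n := p * L with hn
  obtain ⟨L', rfl⟩ := hq
  have hq0 : 0 < q := Nat.pos_of_mul_pos_right hL
  have hn0 : 0 < n := Nat.mul_pos hp hL
  have hsub (a : ℕ) : (n - 1) * a + a = n * a := by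
    rw [Nat.sub_one_mul, Nat.sub_add_cancel (Nat.le_mul_of_pos_left a hn0)]
  -- With ζ = z^L, v_i = z^(eq) ζ^i are p roots of T^p = z^(epq), and y_i is the inverse of v_i
  -- because z^n = 1. The hypothesis q ∣ L keeps v_i of the form z^(e' q), as needed for the
  -- recursive call.
  let ex : ℕ → ℕ := fun i => e + i * L'
  let v : ℕ → A := fun i => z ^ (ex i * q)
  let y : ℕ → A := fun i => z ^ ((n - 1) * (ex i * q))
  have hzn (a : ℕ) : z ^ (n * a) = 1 := by rw [pow_mul, hz, one_pow]
  have hvy (i : ℕ) : v i * y i = 1 := by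
    simp only [v, y]
    rw [← pow_add, add_comm, hsub, hzn]
  have hvp (i : ℕ) : v i ^ p = z ^ (e * (p * q)) := by
    simp only [v, ex]
    rw [← pow_mul, show (e + i * L') * q * p = e * (p * q) + n * i by rw [hn]; ring, pow_add, hzn,
      mul_one]
  have hsum : ∀ u, 0 < u → u < p → ∑ i ∈ Finset.range p, y i ^ u = 0 := by
    intro u hu hup
    have hnd : ¬ p ∣ (n - 1) * u := by
      intro hd
      have h2 : p ∣ (n - 1) * u + u := by
        rw [hsub, hn, mul_assoc]
        exact dvd_mul_right _ _
      exact absurd (Nat.le_of_dvd hu ((Nat.dvd_add_right hd).1 h2)) (by omega)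
    have h3 : ∀ i ∈ Finset.range p, y i ^ u =
        z ^ ((n - 1) * (e * q) * u) * (z ^ (q * L')) ^ ((n - 1) * u * i) := by
      intro i _
      simp only [y, ex]
      rw [← pow_mul, ← pow_mul, ← pow_add]
      congr 1
      ring
    rw [Finset.sum_congr rfl h3, ← Finset.mul_sum, hζ _ hnd, mul_zero]
  have horth : ∀ i < p, ∀ j < p, ∑ u ∈ Finset.range p, (v i * y j) ^ u =
      if i = j then (p : A) else 0 := by
    intro i hi j hj
    have h3 : ∀ u ∈ Finset.range p, (v i * y j) ^ u =
        (z ^ (q * L')) ^ ((i + (n - 1) * j) * u) := by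
      intro u _
      simp only [v, y, ex]
      rw [← pow_add, ← pow_mul, show ((e + i * L') * q + (n - 1) * ((e + j * L') * q)) =
        ((n - 1) + 1) * (e * q) + q * L' * (i + (n - 1) * j) by ring, Nat.sub_add_cancel hn0,
        pow_mul, pow_add, hzn, one_mul, pow_mul, pow_mul _ _ u]
    rw [Finset.sum_congr rfl h3, sum_pow_mul_eq_ite hz hζ]
    congr 1
    rw [eq_iff_iff]
    have h4 : i + (n - 1) * j + j = i + n * j := by rw [add_assoc, hsub]
    constructor
    · intro hd
      have h5 : i + n * j ≡ j [MOD p] := by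
        rw [← h4]
        exact (Nat.ModEq.add_right j ((Nat.modEq_zero_iff_dvd).2 hd)).trans (by simp; rfl)
      have h6 : i ≡ j [MOD p] := by
        refine Nat.ModEq.trans ?_ h5
        rw [hn, mul_assoc]
        exact (Nat.add_mul_mod_self_left _ _ _).symm
      rw [Nat.ModEq, Nat.mod_eq_of_lt hi, Nat.mod_eq_of_lt hj] at h6
      exact h6
    · rintro rfl
      rw [add_comm, hsub, hn, mul_assoc]
      exact dvd_mul_right _ _
  have hlt {u k : ℕ} (hu : u < p) (hk : k < q) : u * q + k < p * q := by
    have := Nat.mul_le_mul_right q (Nat.succ_le_of_lt hu)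
    rw [Nat.succ_mul] at this
    omega
  have hpinv : (p : A) * algebraMap K A κ = 1 := by
    rw [← map_natCast (algebraMap K A), ← map_mul, hκ, map_one]
  have h₁ := KnownIn.shifted_sums (S := S) (ι := α × β) hz p q
    (F := fun t u k => F t.1 t.2 (u * q + k)) (fun i u => ex i * q * u)
    fun t u hu k hk => hF _ _ _ (hlt hu hk)
  -- The chain is: reduction of the entries of F and of G modulo all X^q - v_s, the p matrix
  -- products modulo these factors, and the inverse transform, whose final scaling by κ = 1/p costs
  -- n per coefficient.
  refine Obtainable.mono (h₁.bind fun T₁ hT₁ hF₁ => (KnownIn.shifted_sums (S := T₁) (ι := β × γ) hz p q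
    (F := fun t u k => G t.1 t.2 (u * q + k)) (fun i u => ex i * q * u)
    fun t u hu k hk => (hG _ _ _ (hlt hu hk)).mono hT₁).bind fun T₂ hT₂ hG₂ =>
    (Obtainable.all (S := T₂) (c := c) (Finset.range p)
      (Φ := fun s T => ∃ H : α → γ → ℕ → Ω → A, (∀ i j, ∀ k < q, KnownIn T z n (H i j k)) ∧
        ∀ i j x, (X ^ q - C (v s)) ∣ (∑ b,
          seqPoly q (fun k => ∑ u ∈ Finset.range p, v s ^ u * F i b (u * q + k) x) *
          seqPoly q (fun k => ∑ u ∈ Finset.range p, v s ^ u * G b j (u * q + k) x)) -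
            seqPoly q fun k => H i j k x)
      (fun s _ T T' hT ⟨H, hH, hdvd⟩ => ⟨H, fun i j k hk => (hH i j k hk).mono hT, hdvd⟩)
      fun s hs T hT => h (ex s) T
        (fun i b k x => ∑ u ∈ Finset.range p, v s ^ u * F i b (u * q + k) x)
        (fun b j k x => ∑ u ∈ Finset.range p, v s ^ u * G b j (u * q + k) x)
        (hT (hT₂ (hT₁ h0))) (hT (hT₂ (hT₁ hκS))) (fun i b k hk => ?_) fun b j k hk => ?_).bind
          (c' := Fintype.card (α × γ) * (p * q) * (n * (p + 1)) +
            Fintype.card (α × γ) * (p * q) * n)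
          fun T₃ hT₃ hH₃ => ?_) (c := Fintype.card (α × β) * (p * q) * (n * (p + 1)) +
            (Fintype.card (β × γ) * (p * q) * (n * (p + 1)) + ((Finset.range p).card * c +
              (Fintype.card (α × γ) * (p * q) * (n * (p + 1)) +
            Fintype.card (α × γ) * (p * q) * n)))) ?_ fun T _ hT => hT
  · refine ((hF₁ (i, b) s (Finset.mem_range.1 hs) k hk).mono (hT₂.trans hT)).congr fun x => ?_
    simp only [v, ← pow_mul]
  · refine ((hG₂ (b, j) s (Finset.mem_range.1 hs) k hk).mono hT).congr fun x => ?_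
    simp only [v, ← pow_mul]
  · choose! H hH hdvd using hH₃
    refine (KnownIn.shifted_sums (S := T₃) (ι := α × γ) hz p q (F := fun t u k => H u t.1 t.2 k)
      (fun u j => (n - 1) * (ex j * q) * u) fun t u hu k hk =>
        hH u (Finset.mem_range.2 hu) t.1 t.2 k hk).bind fun T₄ hT₄ hH₄ => ?_
    refine (Obtainable.all (S := T₄) (c := n)
      ((Finset.univ : Finset (α × γ)) ×ˢ (Finset.range p ×ˢ Finset.range q))
      (Φ := fun t T => KnownIn T z n fun x => algebraMap K A κ * ∑ j ∈ Finset.range p,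
        z ^ ((n - 1) * (ex j * q) * t.2.1) * H j t.1.1 t.1.2 t.2.2 x)
      (fun k _ T T' hT h => h.mono hT) fun t ht T hT => ?_).mono ?_ fun T₅ hT₅ hH₅ =>
        ⟨fun i j k x => algebraMap K A κ * ∑ s ∈ Finset.range p, y s ^ (k / q) * H s i j (k % q) x,
          fun i j k hk => ?_, fun i j x => ?_⟩
    · simp only [Finset.mem_product, Finset.mem_univ, true_and, Finset.mem_range] at ht
      exact KnownIn.smul (hT (hT₄ (hT₃ (hT₂ (hT₁ hκS))))) ((hH₄ t.1 t.2.1 ht.1 t.2.2 ht.2).mono hT)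
    · simp [Finset.card_univ]
    · refine (hH₅ ((i, j), (k / q, k % q)) ?_).congr fun x => ?_
      · simp only [Finset.mem_product, Finset.mem_univ, true_and, Finset.mem_range]
        exact ⟨Nat.div_lt_of_lt_mul (by rwa [mul_comm]), Nat.mod_lt _ hq0⟩
      · simp only [y, ← pow_mul]
    · refine dvd_of_forall_dvd hpinv q hp (fun s _ => hvp s) (fun s _ => hvy s) hsum fun s hs => ?_
      have hred := hdvd s (Finset.mem_range.2 hs) i j x
      have hint := dvd_seqPoly_interpolate hpinv q horth (fun s k => H s i j k x) hs
      have hprod : (X ^ q - C (v s)) ∣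
          (∑ b, seqPoly (p * q) (fun k => F i b k x) * seqPoly (p * q) (fun k => G b j k x)) -
          ∑ b, seqPoly q (fun k => ∑ u ∈ Finset.range p, v s ^ u * F i b (u * q + k) x) *
          seqPoly q (fun k => ∑ u ∈ Finset.range p, v s ^ u * G b j (u * q + k) x) := by
        rw [← Finset.sum_sub_distrib]
        refine Finset.dvd_sum fun b _ => ?_
        exact dvd_mul_sub_mul (dvd_seqPoly_sub p q _ _) (dvd_seqPoly_sub p q _ _)
      convert (hprod.add hred).sub hint using 1
      ring
  · rw [Finset.card_range]
    exact (Nat.le_add_right _ ((Fintype.card (α × β) + Fintype.card (β × γ)) *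
      (p * q * n))).trans_eq (by ring)

/-- Radix `p` fast Fourier transform of length `p ^ j`. -/
theorem RingMatMulCost.cyclic_pow {κ : K} {z : A} {p L c : ℕ} (hp : 0 < p) (hκ : (p : K) * κ = 1)
    (hz : z ^ (p * L) = 1) (hζ : ∀ m, ¬ p ∣ m → ∑ i ∈ Finset.range p, (z ^ L) ^ (m * i) = 0)
    (hL : 0 < L) (h : RingMatMulCost K Ω α β γ κ z (p * L) c) (j : ℕ)
    (hj : ∀ i < j, p ^ i ∣ L) (e : ℕ) :
    CyclicMatMulCost K Ω α β γ κ z (p * L) (p ^ j) e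
      (p ^ j * (c + j * ((Fintype.card (α × β) + Fintype.card (β × γ) + Fintype.card (α × γ)) *
        (p * L * (p + 2))))) := by
  induction j generalizing e with
  | zero => simpa using h.cyclic_one e
  | succ j ih =>
    rw [pow_succ']
    convert CyclicMatMulCost.step hp hκ hz hζ hL (hj j (Nat.lt_succ_self j))
      (ih fun i hi => hj i (by omega)) e using 1
    ring

/-- If `y ^ M = z`, then products of elements that are given by expansions of length `n M` in powers
of `y` reduce to products of polynomials whose coefficients are expansions of length `n` in powers
of `z`. -/
theorem CyclicMatMulCost.ring {κ : K} {y z : A} {p L M c : ℕ} (hp : 2 ≤ p)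
    (hM : 0 < M) (hy : y ^ M = z) (hz : z ^ (p * L) = 1)
    (h : CyclicMatMulCost K Ω α β γ κ z (p * L) (p * M) 0 c) :
    RingMatMulCost K Ω α β γ κ y (p * (L * M))
      (c + Fintype.card (α × γ) * M * (p * L * (p + 1))) := by
  intro S P Q h0 hκ hP hQ
  set n := p * L with hn
  have hnM : p * (L * M) = n * M := by rw [hn, mul_assoc]
  rw [hnM] at hP hQ ⊢
  -- As y^(lM + k) = z^l y^k, regrouping gives a polynomial of degree < M in y with coefficients
  -- expanded in z. Padding with zeros prepares the cyclic product of length p M.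
  have split (a : Ω → A) (ha : KnownIn S y (n * M) a) : ∃ F : ℕ → Ω → A,
      (∀ k, KnownIn S z n (F k)) ∧ (∀ k, M ≤ k → ∀ x, F k x = 0) ∧
        ∀ x, a x = ∑ k ∈ Finset.range M, F k x * y ^ k := by
    obtain ⟨v, hv, ha⟩ := ha
    refine ⟨fun k x => if k < M then ∑ l ∈ Finset.range n, v (l * M + k) x • z ^ l else 0,
      fun k => ?_, fun k hk x => if_neg (by omega), fun x => ?_⟩
    · dsimp only
      split_ifs with hk
      · refine ⟨fun l => v (l * M + k), fun l hl => hv _ ?_, fun x => rfl⟩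
        have := Nat.mul_le_mul_right M (Nat.succ_le_of_lt hl)
        rw [Nat.succ_mul] at this
        omega
      · exact KnownIn.zero h0
    · rw [ha, sum_range_mul, Finset.sum_comm]
      refine Finset.sum_congr rfl fun k hk => ?_
      dsimp only
      rw [if_pos (Finset.mem_range.1 hk), Finset.sum_mul]
      refine Finset.sum_congr rfl fun l _ => ?_
      rw [smul_mul_assoc, ← hy, ← pow_mul, ← pow_add, mul_comm M]
  choose F hF hF0 hPF using fun i b => split (P i b) (hP i b)
  choose G hG hG0 hQG using fun b j => split (Q b j) (hQ b j)
  have hMp : M ≤ p * M := Nat.le_mul_of_pos_left M (by omega)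
  have trunc (f : ℕ → A) (hf : ∀ k, M ≤ k → f k = 0) : seqPoly (p * M) f = seqPoly M f := by
    rw [seqPoly, seqPoly]
    symm
    refine Finset.sum_subset (Finset.range_mono hMp) fun k _ hk => ?_
    rw [hf k (by simpa using hk), map_zero, zero_mul]
  refine (h S F G h0 hκ (fun i b k _ => hF i b k) fun b j k _ => hG b j k).bind
    fun T hT ⟨H, hH, hdvd⟩ => ?_
  have heq (i : α) (j : γ) (x : Ω) : ∑ b, P i b x * Q b j x =
      ∑ u ∈ Finset.range M, y ^ u * ∑ s ∈ Finset.range p, z ^ s * H i j (s * M + u) x := by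
    cases subsingleton_or_nontrivial A with
    | inl hA => exact Subsingleton.elim _ _
    | inr hA =>
    -- The products have degree < 2M ≤ pM, so the congruence modulo X^(pM) - 1 is an equality and
    -- can be evaluated at y.
    have h1 : (∑ b, seqPoly (p * M) (fun k => F i b k x) * seqPoly (p * M) (fun k => G b j k x)) -
        seqPoly (p * M) (fun k => H i j k x) = 0 := by
      by_contra hne
      have hmon : (X ^ (p * M) - C (z ^ (0 * (p * M))) : A[X]).Monic :=
        monic_X_pow_sub_C _ (Nat.mul_pos (by omega) hM).ne'
      refine hmon.not_dvd_of_degree_lt hne ?_ (hdvd i j x)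
      rw [degree_X_pow_sub_C (Nat.mul_pos (by omega) hM)]
      rw [← mem_degreeLT]
      refine Submodule.sub_mem _ (Submodule.sum_mem _ fun b _ => ?_)
        (mem_degreeLT.2 (degree_seqPoly_lt _ _))
      rw [trunc _ (fun k hk => hF0 i b k hk x), trunc _ (fun k hk => hG0 b j k hk x), mem_degreeLT,
        degree_lt_iff_coeff_zero]
      intro t ht
      have h2M := Nat.mul_le_mul_right M hp
      have hdF := natDegree_le_sub_one (degree_seqPoly_lt M fun k => F i b k x)
      have hdG := natDegree_le_sub_one (degree_seqPoly_lt M fun k => G b j k x)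
      exact coeff_eq_zero_of_natDegree_lt (natDegree_mul_le.trans_lt (by omega))
    have h2 := congrArg (eval y) h1
    rw [eval_sub, eval_zero, sub_eq_zero, eval_finsetSum] at h2
    have h3 : ∑ b, P i b x * Q b j x = eval y (seqPoly (p * M) fun k => H i j k x) := by
      rw [← h2]
      refine Finset.sum_congr rfl fun b _ => ?_
      rw [eval_mul, trunc _ (fun k hk => hF0 i b k hk x), trunc _ (fun k hk => hG0 b j k hk x),
        eval_seqPoly, eval_seqPoly, hPF, hQG]
    -- Degrees M and above fold back through y^(sM + u) = z^s y^u; only shifts and additions are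
    -- needed.
    rw [h3, eval_seqPoly, sum_range_mul, Finset.sum_comm]
    refine Finset.sum_congr rfl fun u _ => ?_
    rw [Finset.mul_sum]
    refine Finset.sum_congr rfl fun s _ => ?_
    rw [← hy, ← pow_mul, pow_add, mul_comm M]
    ring
  refine (Obtainable.all (S := T) (c := n * (p + 1))
    ((Finset.univ : Finset (α × γ)) ×ˢ Finset.range M)
    (Φ := fun t T => KnownIn T z n fun x =>
      ∑ s ∈ Finset.range p, z ^ s * H t.1.1 t.1.2 (s * M + t.2) x)
    (fun k _ T T' hT h => h.mono hT) fun t ht T' hT' => ?_).mono (by simp [Finset.card_univ])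
      fun T' _ hB i j => ?_
  · simp only [Finset.mem_product, Finset.mem_univ, true_and, Finset.mem_range] at ht
    have := KnownIn.sum (S := T') (z := z) (n := n) (Finset.range p)
      (a := fun s x => z ^ s * H t.1.1 t.1.2 (s * M + t.2) x) fun s hs =>
        KnownIn.pow_mul hz ((hH _ _ _ ?_).mono hT') _
    · rwa [Finset.card_range] at this
    · have := Nat.mul_le_mul_right M (Nat.succ_le_of_lt (Finset.mem_range.1 hs))
      rw [Nat.succ_mul] at this
      omega
  · have hB' : ∀ u ∈ Finset.range M, KnownIn T' z n fun x =>
        ∑ s ∈ Finset.range p, z ^ s * H i j (s * M + u) x := fun u hu =>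
      hB ((i, j), u) (by simpa using hu)
    choose! w hw hB' using hB'
    refine ⟨fun k => w (k % M) (k / M), fun k hk => ?_, fun x => ?_⟩
    · exact hw _ (Finset.mem_range.2 (Nat.mod_lt _ hM)) _
        (Nat.div_lt_of_lt_mul (by rwa [mul_comm]))
    · dsimp only at hB' ⊢
      rw [heq, sum_range_mul, Finset.sum_comm]
      refine Finset.sum_congr rfl fun u hu => ?_
      have hu' := Finset.mem_range.1 hu
      rw [hB' u hu, Finset.mul_sum]
      refine Finset.sum_congr rfl fun l _ => ?_
      rw [mul_smul_comm, ← hy, ← pow_mul, ← pow_add, Nat.mul_add_mod', Nat.mod_eq_of_lt hu',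
        mul_comm l, Nat.mul_add_div hM, Nat.div_eq_of_lt hu', add_zero, add_comm u]

end MatrixProducts

/-- The residues m i modulo the prime p are a permutation of all residues. Zero divisors are
allowed, so ζ^m ≠ 1 would not be enough. For p = 3 and m ≡ 2 the identity is 1 + ζ² + ζ⁴ = (1 - ζ +
ζ²)(1 + ζ + ζ²). -/
theorem sum_pow_mul_eq_zero {A : Type u} [CommRing A] {p : ℕ} (hp : p = 2 ∨ p = 3) {ζ : A}
    (hζ : ∑ i ∈ Finset.range p, ζ ^ i = 0) {m : ℕ} (hm : ¬ p ∣ m) :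
    ∑ i ∈ Finset.range p, ζ ^ (m * i) = 0 := by
  have h1 : ζ ^ p = 1 := by
    rw [← sub_eq_zero, ← geom_sum_mul, hζ, zero_mul]
  have h2 : ∀ i, ζ ^ (m * i) = ζ ^ (m % p * i) := fun i => by
    rw [pow_mul, pow_mul]
    congr 1
    conv_lhs => rw [← Nat.mod_add_div m p, pow_add, pow_mul, h1, one_pow, mul_one]
  have hlt : m % p < p := Nat.mod_lt _ (by omega)
  have hne : m % p ≠ 0 := fun h => hm (Nat.dvd_of_mod_eq_zero h)
  rw [Finset.sum_congr rfl fun i _ => h2 i]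
  generalize m % p = r at hlt hne
  rcases hp with rfl | rfl
  · obtain rfl : r = 1 := by omega
    simpa using hζ
  · simp only [Finset.sum_range_succ, Finset.sum_range_zero] at hζ ⊢
    obtain rfl | rfl : r = 1 ∨ r = 2 := by omega
    · simpa using hζ
    · norm_num at hζ ⊢
      linear_combination (1 - ζ + ζ ^ 2) * hζ

/-! ### Quasi-linear products of matrices of power series over any field. -/

section Remainder

variable {K : Type u} [Field K]

theorem coeff_seqPoly {A : Type u} [CommRing A] (q : ℕ) (F : ℕ → A) {l : ℕ} (hl : l < q) :
    (seqPoly q F).coeff l = F l := by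
  simp [seqPoly, finsetSum_coeff, hl]

/-- Coefficients of a remainder modulo `1 + x^L + ⋯ + x^(q L)`. -/
theorem coeff_eq_sub_of_dvd {L q : ℕ} (hq : 0 < q) (v : ℕ → K) {R : K[X]}
    (hR : R.degree < (q * L : ℕ))
    (h : (∑ i ∈ Finset.range (q + 1), (X ^ L) ^ i) ∣ seqPoly ((q + 1) * L) v - R) {l : ℕ}
    (hl : l < L) : R.coeff l = v l - v (q * L + l) := by
  set Φ : K[X] := ∑ i ∈ Finset.range (q + 1), (X ^ L) ^ i with hΦ
  have hrest : (∑ i ∈ Finset.range q, (X ^ L) ^ i : K[X]).degree < (q * L : ℕ) := by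
    rw [← mem_degreeLT]
    refine Submodule.sum_mem _ fun i hi => ?_
    rw [mem_degreeLT, ← pow_mul, degree_X_pow]
    exact_mod_cast (by
      rw [mul_comm L]; exact Nat.mul_lt_mul_of_pos_right (Finset.mem_range.1 hi) (by omega))
  have hΦ' : Φ = X ^ (q * L) + ∑ i ∈ Finset.range q, (X ^ L) ^ i := by
    rw [hΦ, Finset.sum_range_succ, ← pow_mul, mul_comm L, add_comm]
  have hmon : Φ.Monic := hΦ' ▸ monic_X_pow_add hrest
  have hdeg : Φ.degree = (q * L : ℕ) := by
    rw [hΦ', degree_add_eq_left_of_degree_lt (by rwa [degree_X_pow]), degree_X_pow]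
  -- Subtracting Φ times the top block of v cancels that block and subtracts it from each of the q
  -- lower ones, which leaves degree < q L = deg Φ.
  set w : ℕ → K := fun t => v t - v (q * L + t % L) with hw
  have hsplit : seqPoly ((q + 1) * L) v - Φ * seqPoly L (fun t => v (q * L + t)) =
      seqPoly (q * L) w := by
    rw [seqPoly_mul, seqPoly_mul, hΦ, Finset.sum_mul, ← Finset.sum_sub_distrib,
      Finset.sum_range_succ, sub_self, add_zero]
    refine Finset.sum_congr rfl fun u _ => ?_
    rw [← mul_sub]
    congr 1
    rw [seqPoly, seqPoly, seqPoly, ← Finset.sum_sub_distrib]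
    refine Finset.sum_congr rfl fun t ht => ?_
    simp only [hw]
    rw [Nat.mul_add_mod', Nat.mod_eq_of_lt (Finset.mem_range.1 ht), map_sub, sub_mul]
  have hR' : seqPoly (q * L) w - R = 0 := by
    by_contra hne
    refine hmon.not_dvd_of_degree_lt hne ?_ ?_
    · rw [hdeg, ← mem_degreeLT]
      exact Submodule.sub_mem _ (mem_degreeLT.2 (degree_seqPoly_lt _ _)) (mem_degreeLT.2 hR)
    · rw [← hsplit, sub_right_comm]
      exact h.sub (dvd_mul_right _ _)
  rw [← sub_eq_zero.1 hR', coeff_seqPoly _ _ (hl.trans_le (Nat.le_mul_of_pos_left L hq)), hw]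
  dsimp only
  rw [Nat.mod_eq_of_lt hl]

end Remainder

section FastProducts

variable {K : Type u} [Field K] [DecidableEq K] {Ω A : Type u} [CommRing A] [Algebra K A]
variable {α β γ : Type} [Fintype β]

theorem RingMatMulCost.mono {κ : K} {z : A} {n c c' : ℕ} (h : RingMatMulCost K Ω α β γ κ z n c)
    (hc : c ≤ c') : RingMatMulCost K Ω α β γ κ z n c' :=
  fun S P Q h0 hκ hP hQ => (h S P Q h0 hκ hP hQ).mono hc fun _ _ h => h

variable [Fintype α] [Fintype γ]

/-- The cubic bound survives the recursion because ⌈k/2⌉ ≤ 2k/3 and p (2/3)³ ≤ 8/9 < 1. For p = 3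
the spare 15 k³ ≥ 60 k covers the linear terms. -/
theorem fast_cost_le {p k : ℕ} (hp : p = 2 ∨ p = 3) (hk : 2 ≤ k) :
    p * (135 * (k - k / 2) ^ 3) + p * p * (p + 2) * (k / 2 + 1) + p * (p + 1) ≤ 135 * k ^ 3 := by
  have hl : 3 * (k - k / 2) ≤ 2 * k := by omega
  have hj : k / 2 + 1 ≤ k := by omega
  generalize k - k / 2 = l at hl
  generalize k / 2 + 1 = j at hj
  have h1 : (3 * l) ^ 3 ≤ (2 * k) ^ 3 := Nat.pow_le_pow_left hl 3
  have h2 : 4 * k ≤ k ^ 3 := by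
    calc 4 * k = 2 ^ 2 * k := by norm_num
      _ ≤ k ^ 2 * k := Nat.mul_le_mul_right _ (Nat.pow_le_pow_left hk 2)
      _ = k ^ 3 := by ring
  rw [mul_pow, mul_pow] at h1
  rcases hp with rfl | rfl <;> omega

/-- Products in a ring that contains a root of unity of order `p ^ (k + 1)`, by recursive use of
fast Fourier transforms. -/
theorem MatMulCost.ring_pow {κ : K} {p c W : ℕ} (hp : p = 2 ∨ p = 3) (hκ : (p : K) * κ = 1)
    (h : MatMulCost K Ω α β γ c) (hc : c ≤ W)
    (hW : Fintype.card (α × β) + Fintype.card (β × γ) + Fintype.card (α × γ) ≤ W) {k : ℕ}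
    (hk : 0 < k) (y : A) (hζ : ∑ i ∈ Finset.range p, (y ^ p ^ k) ^ i = 0) :
    RingMatMulCost K Ω α β γ κ y (p * p ^ k) (W * (135 * k ^ 3 * p ^ k)) := by
  induction k using Nat.strong_induction_on generalizing y with
  | _ k ih =>
  have hy : y ^ (p * p ^ k) = 1 := by
    rw [mul_comm, pow_mul, ← sub_eq_zero, ← geom_sum_mul, hζ, zero_mul]
  rcases Nat.lt_or_ge k 2 with hk2 | hk2
  · obtain rfl : k = 1 := by omega
    refine (h.ring κ hy).mono ?_
    rw [pow_one]
    calc _ ≤ p * p * (p * p) * W + W * (p * p * (p * p + 1)) :=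
          Nat.add_le_add (Nat.mul_le_mul_left _ hc) (Nat.mul_le_mul_right _ (by omega))
      _ = W * (p * p * (p * p) + p * p * (p * p + 1)) := by ring
      _ ≤ _ := Nat.mul_le_mul_left W (by rcases hp with rfl | rfl <;> norm_num)
  -- The exponent k is halved: z = y^M has the same property with l in place of k, in the same ring
  -- A. The transform has length p M = p^(k/2 + 1), and the divisibilities it needs hold since k/2 ≤
  -- l.
  · set l := k - k / 2 with hl
    set M := p ^ (k / 2) with hM
    have hlk : p ^ l * M = p ^ k := by rw [hM, ← pow_add]; congr 1; omega
    have hζ' : ∑ i ∈ Finset.range p, ((y ^ M) ^ p ^ l) ^ i = 0 := by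
      rw [← hζ]
      refine Finset.sum_congr rfl fun i _ => ?_
      rw [← pow_mul y, mul_comm M, hlk]
    have hp0 : 0 < p := by omega
    have h1 := ih l (by omega) (by omega) (y ^ M) hζ'
    have hz : (y ^ M) ^ (p * p ^ l) = 1 := by
      rw [← pow_mul, show M * (p * p ^ l) = p * (p ^ l * M) by ring, hlk, hy]
    have h2 := h1.cyclic_pow hp0 hκ hz (fun m hm => sum_pow_mul_eq_zero hp hζ' hm)
      (pow_pos hp0 l) (k / 2 + 1) (fun i hi => pow_dvd_pow p (by omega)) 0
    rw [pow_succ' p (k / 2), ← hM] at h2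
    have h3 := CyclicMatMulCost.ring (by omega) (pow_pos hp0 _) rfl hz h2
    rw [hlk] at h3
    refine h3.mono ?_
    set W' := Fintype.card (α × β) + Fintype.card (β × γ) + Fintype.card (α × γ)
    calc _ ≤ p * M * (W * (135 * l ^ 3 * p ^ l) + (k / 2 + 1) * (W * (p * p ^ l * (p + 2)))) +
          W * M * (p * p ^ l * (p + 1)) := by gcongr; omega
      _ = W * (p ^ l * M * (p * (135 * l ^ 3) + p * p * (p + 2) * (k / 2 + 1) + p * (p + 1))) := by
          ring
      _ ≤ W * (p ^ k * (135 * k ^ 3)) := by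
          rw [hlk]
          exact Nat.mul_le_mul_left _ (Nat.mul_le_mul_left _ (fast_cost_le hp hk2))
      _ = _ := by ring

/-- The inverse transform divides by p, so radix 2 fails in characteristic 2; there 3 = 1. -/
theorem exists_radix (K : Type u) [Field K] :
    ∃ (p : ℕ) (κ : K), (p = 2 ∨ p = 3) ∧ (p : K) * κ = 1 := by
  by_cases h : (2 : K) = 0
  · refine ⟨3, 1, Or.inr rfl, ?_⟩
    rw [mul_one, Nat.cast_ofNat, show (3 : K) = 2 + 1 by norm_num, h, zero_add]
  · exact ⟨2, 2⁻¹, Or.inl rfl, by simpa using mul_inv_cancel₀ h⟩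

/-- Truncated products of matrices of power series, in quasi-linear time. -/
theorem MatMulCost.powerSeries {c W : ℕ} (h : MatMulCost K Ω α β γ c) (hc : c ≤ W) (hW0 : 0 < W)
    (hW : Fintype.card (α × β) + Fintype.card (β × γ) + Fintype.card (α × γ) ≤ W) (B : ℕ)
    {S : Set (Ω → K)} {P : α → β → Ω → PowerSeries K} {Q : β → γ → Ω → PowerSeries K}
    (hP : ∀ i b, ∀ l < B, (fun x => PowerSeries.coeff l (P i b x)) ∈ S)
    (hQ : ∀ b j, ∀ l < B, (fun x => PowerSeries.coeff l (Q b j x)) ∈ S) :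
    Obtainable S (820 * W * (B * (Nat.log 2 B + 2) ^ 3)) fun T =>
      ∀ i j, ∀ l < B, (fun x => PowerSeries.coeff l (∑ b, P i b x * Q b j x)) ∈ T := by
  rcases Nat.eq_zero_or_pos B with rfl | hB
  · exact Obtainable.of (by simp) _
  obtain ⟨p, κ, hp, hκ⟩ := exists_radix K
  have hp1 : 1 < p := by omega
  -- With 2B ≤ p^k = L the product of two truncations has degree < L, so nothing is lost in the
  -- quotient ring; minimality of k gives L ≤ 6B, and 135 · 6 = 810 stays below 820.
  set k := Nat.clog p (2 * B) with hk
  have hk0 : 0 < k := Nat.clog_pos hp1 (by omega)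
  have hBk : 2 * B ≤ p ^ k := Nat.le_pow_clog hp1 _
  have hpk : p ^ (k - 1) < 2 * B := Nat.pow_pred_clog_lt_self hp1 (by omega)
  have hkB : p ^ k ≤ 6 * B := by
    have hks : p ^ k = p ^ (k - 1) * p := by rw [← pow_succ, Nat.sub_add_cancel hk0]
    have := Nat.mul_le_mul_left (p ^ (k - 1)) (show p ≤ 3 by omega)
    omega
  have hklog : k ≤ Nat.log 2 B + 2 := by
    have h1 : 2 ^ (k - 1) ≤ 2 * B := (Nat.pow_le_pow_left hp1 _).trans hpk.le
    have h2 := Nat.le_log_of_pow_le (by norm_num) h1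
    rw [mul_comm, Nat.log_mul_base (by norm_num) (by omega)] at h2
    omega
  obtain ⟨q, rfl⟩ : ∃ q, p = q + 1 := ⟨p - 1, by omega⟩
  set L := (q + 1) ^ k with hL
  -- Dividing by this polynomial, and not by x^(pL) - 1, forces the powers of z^L to sum to zero,
  -- which is the property that the transform requires.
  set Φ : K[X] := ∑ i ∈ Finset.range (q + 1), (X ^ L) ^ i with hΦ
  let A := K[X] ⧸ Ideal.span {Φ}
  let mk : K[X] →ₐ[K] A := Ideal.Quotient.mkₐ K (Ideal.span {Φ})
  let z : A := mk X
  have hζ : ∑ i ∈ Finset.range (q + 1), (z ^ L) ^ i = 0 := by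
    have : mk Φ = 0 := Ideal.Quotient.eq_zero_iff_mem.2 (Ideal.mem_span_singleton_self _)
    simpa [hΦ, z] using this
  have hmk (n : ℕ) (f : ℕ → K) : mk (seqPoly n f) = ∑ l ∈ Finset.range n, f l • z ^ l := by
    simp [seqPoly, z, ← smul_eq_C_mul]
  have htr (f : PowerSeries K) : PowerSeries.trunc B f = seqPoly B fun l => PowerSeries.coeff l f := by
    ext i
    rw [PowerSeries.coeff_trunc]
    split_ifs with hi
    · rw [coeff_seqPoly _ _ hi]
    · exact ((degree_lt_iff_coeff_zero _ _).1 (degree_seqPoly_lt _ _) i (by omega)).symm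
  have hring := h.ring_pow (A := A) hp hκ hc hW hk0 z hζ
  rw [← hL] at hring
  have hcost : 1 + (1 + (W * (135 * k ^ 3 * L) + Fintype.card (α × γ) * B)) ≤
      820 * W * (B * (Nat.log 2 B + 2) ^ 3) := by
    set t := Nat.log 2 B + 2 with ht
    have ht3 : 2 ^ 3 ≤ t ^ 3 := Nat.pow_le_pow_left (by omega) 3
    have h1 : W * (135 * k ^ 3 * L) ≤ W * (135 * t ^ 3 * (6 * B)) := by gcongr
    have h2 : Fintype.card (α × γ) * B ≤ W * B := Nat.mul_le_mul_right _ (by omega)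
    have h3 : 1 ≤ W * B := Nat.mul_pos hW0 hB
    have h4 : W * B * 8 ≤ W * B * t ^ 3 := Nat.mul_le_mul_left _ ht3
    have h5 : W * (135 * t ^ 3 * (6 * B)) = 810 * (W * B * t ^ 3) := by ring
    have h6 : 820 * W * (B * t ^ 3) = 820 * (W * B * t ^ 3) := by ring
    omega
  have hBL : B ≤ (q + 1) * L := by
    have := Nat.le_mul_of_pos_left L (show 0 < q + 1 by omega); omega
  have hknown {T : Set (Ω → K)} (h0 : (0 : Ω → K) ∈ T) {f : Ω → PowerSeries K}
      (hf : ∀ l < B, (fun x => PowerSeries.coeff l (f x)) ∈ T) :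
      KnownIn T z ((q + 1) * L) fun x => mk (PowerSeries.trunc B (f x)) := by
    refine ⟨fun l x => if l < B then PowerSeries.coeff l (f x) else 0, fun l _ => ?_, fun x => ?_⟩
    · by_cases hl : l < B
      · simpa only [if_pos hl] using hf l hl
      · simp only [if_neg hl]; exact h0
    · dsimp only
      rw [htr, hmk, ← Finset.sum_subset (Finset.range_mono hBL)]
      · exact Finset.sum_congr rfl fun l hl => by rw [if_pos (Finset.mem_range.1 hl)]
      · intro l _ hl
        rw [if_neg (by simpa using hl), zero_smul]
  refine Obtainable.mono ((Obtainable.const 0).bind fun S₁ hS₁ h0 => (Obtainable.const κ).bind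
    fun S₂ hS₂ hκS => (hring S₂ (fun i b x => mk (PowerSeries.trunc B (P i b x)))
      (fun b j x => mk (PowerSeries.trunc B (Q b j x))) (hS₂ h0) hκS (fun i b => ?_)
        fun b j => ?_).bind fun T hT hprod => ?_) hcost fun T _ hT => hT
  · exact hknown (hS₂ h0) fun l hl => hS₂ (hS₁ (hP i b l hl))
  · exact hknown (hS₂ h0) fun l hl => hS₂ (hS₁ (hQ b j l hl))
  · choose v hv hprod using hprod
    have hcoeff (i : α) (j : γ) (l : ℕ) (hl : l < B) :
        (fun x => PowerSeries.coeff l (∑ b, P i b x * Q b j x)) =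
          v i j l - v i j (q * L + l) := by
      funext x
      set R : K[X] := ∑ b, PowerSeries.trunc B (P i b x) * PowerSeries.trunc B (Q b j x) with hR
      have h1 : PowerSeries.coeff l (∑ b, P i b x * Q b j x) = R.coeff l := by
        rw [map_sum, hR, finsetSum_coeff]
        refine Finset.sum_congr rfl fun b _ => ?_
        rw [PowerSeries.coeff_mul_eq_coeff_trunc_mul_trunc _ _ hl, ← Polynomial.coe_mul,
          Polynomial.coeff_coe]
      rw [h1]
      refine coeff_eq_sub_of_dvd (by omega) (fun l => v i j l x) ?_ ?_ (show l < L by omega)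
      · rw [hR, ← mem_degreeLT]
        refine Submodule.sum_mem _ fun b _ => ?_
        rw [mem_degreeLT, degree_lt_iff_coeff_zero]
        intro t ht
        have hd1 := natDegree_le_sub_one (PowerSeries.degree_trunc_lt (P i b x) B)
        have hd2 := natDegree_le_sub_one (PowerSeries.degree_trunc_lt (Q b j x) B)
        have := Nat.le_mul_of_pos_left L (show 0 < q by omega)
        exact coeff_eq_zero_of_natDegree_lt (natDegree_mul_le.trans_lt (by omega))
      · rw [← Ideal.mem_span_singleton, ← Ideal.Quotient.eq]
        change mk _ = mk _
        rw [hmk, ← hprod i j x, hR, map_sum]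
        simp only [map_mul]
    refine (Obtainable.all (S := T) (c := 1) ((Finset.univ : Finset (α × γ)) ×ˢ Finset.range B)
      (Φ := fun t T => (fun x => PowerSeries.coeff t.2 (∑ b, P t.1.1 b x * Q b t.1.2 x)) ∈ T)
      (fun t _ T T' hT h => hT h) fun t ht T' hT' => ?_).mono (by simp [Finset.card_univ])
        fun T' _ hT' i j l hl => hT' ((i, j), l) (by simpa using hl)
    simp only [Finset.mem_product, Finset.mem_univ, true_and, Finset.mem_range] at ht
    rw [hcoeff _ _ _ ht]
    have hqL : (q + 1) * L = q * L + L := Nat.succ_mul q L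
    exact Obtainable.sub (hT' (hv _ _ _ (by omega))) (hT' (hv _ _ _ (by omega)))

end FastProducts

/-- A quasi-linear function, in terms of which the costs of subroutines are bounded. -/
def quasilin (B : ℕ) : ℕ := (B + 1) * (Nat.log 2 B + 2) ^ 4

theorem quasilin_mono {B B' : ℕ} (h : B ≤ B') : quasilin B ≤ quasilin B' :=
  Nat.mul_le_mul (by omega) (Nat.pow_le_pow_left (by have := Nat.log_mono_right (b := 2) h; omega) 4)

theorem mul_log_pow_le_quasilin (B : ℕ) : B * (Nat.log 2 B + 2) ^ 3 * 2 ≤ quasilin B := by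
  rw [quasilin, pow_succ _ 3, ← mul_assoc]
  exact Nat.mul_le_mul (Nat.mul_le_mul_right _ (by omega)) (by omega)

theorem succ_mul_log_le_quasilin (B : ℕ) : (B + 1) * (Nat.log 2 B + 2) * 8 ≤ quasilin B := by
  rw [quasilin, pow_succ' _ 3, ← mul_assoc]
  exact Nat.mul_le_mul_left _ (Nat.pow_le_pow_left (show 2 ≤ Nat.log 2 B + 2 by omega) 3)

/-! ### Inversion and products of power series. -/

section Series

variable {K : Type u} [Field K]

/-- The Newton step doubles the precision because h⁻¹ - (2g - h g²) = h (h⁻¹ - g)². -/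
theorem coeff_inv_eq_of_coeff_eq {h g : PowerSeries K} (h0 : PowerSeries.constantCoeff h ≠ 0)
    {N : ℕ} (hg : ∀ l < N, PowerSeries.coeff l g = PowerSeries.coeff l h⁻¹) {l : ℕ}
    (hl : l < 2 * N) :
    PowerSeries.coeff l h⁻¹ = PowerSeries.coeff l g + PowerSeries.coeff l g -
      PowerSeries.coeff l (h * g * g) := by
  have h1 : h * h⁻¹ = 1 := PowerSeries.mul_inv_cancel h h0
  have h2 : (PowerSeries.X : PowerSeries K) ^ N ∣ h⁻¹ - g :=
    PowerSeries.X_pow_dvd_iff.2 fun m hm => by rw [map_sub, hg m hm, sub_self]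
  have h3 : (PowerSeries.X : PowerSeries K) ^ (2 * N) ∣ h⁻¹ - (g + g - h * g * g) := by
    rw [show h⁻¹ - (g + g - h * g * g) = h * ((h⁻¹ - g) * (h⁻¹ - g)) by
      linear_combination (g + g - h⁻¹) * h1, two_mul, pow_add]
    exact (mul_dvd_mul h2 h2).mul_left _
  have h4 := PowerSeries.X_pow_dvd_iff.1 h3 l hl
  rw [map_sub, map_sub, map_add, sub_eq_zero] at h4
  exact h4

variable [DecidableEq K] {Ω : Type u}

theorem matMulCost_unit : MatMulCost K Ω Unit Unit Unit 1 := by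
  intro S P Q hP hQ
  exact (Obtainable.mul (hP () ()) (hQ () ())).mono le_rfl fun T _ hT i j => by simpa using hT

variable {S : Set (Ω → K)} {f g h : Ω → PowerSeries K}

theorem Obtainable.mulSeries (B : ℕ) (hf : ∀ l < B, (fun x => PowerSeries.coeff l (f x)) ∈ S)
    (hg : ∀ l < B, (fun x => PowerSeries.coeff l (g x)) ∈ S) :
    Obtainable S (2460 * (B * (Nat.log 2 B + 2) ^ 3)) fun T =>
      ∀ l < B, (fun x => PowerSeries.coeff l (f x * g x)) ∈ T := by
  refine (matMulCost_unit.powerSeries (W := 3) (by norm_num) (by norm_num) (by simp) B (S := S)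
    (P := fun _ _ => f) (Q := fun _ _ => g) (fun _ _ => hf) fun _ _ => hg).mono (by omega)
      fun T _ hT l hl => ?_
  simpa using hT () () l hl

/-- Newton iteration. -/
theorem Obtainable.invSeries (h0 : ∀ x, PowerSeries.constantCoeff (h x) ≠ 0) (k : ℕ) {N c : ℕ}
    (hN : N ≤ 2 ^ k) (hc : 2460 * (N * (Nat.log 2 N + 2) ^ 3) ≤ c)
    (hh : ∀ l < N, (fun x => PowerSeries.coeff l (h x)) ∈ S) :
    Obtainable S (2 + k * (1 + 2 * c + N)) fun T =>
      ∀ l < N, (fun x => PowerSeries.coeff l (h x)⁻¹) ∈ T := by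
  induction k generalizing N with
  | zero =>
    rcases Nat.eq_zero_or_pos N with rfl | hN0
    · exact Obtainable.of (by simp) _
    obtain rfl : N = 1 := by simp at hN; omega
    refine ((Obtainable.const 1).bind fun T hT h1 => Obtainable.div h1 (hT (hh 0 one_pos)) ?_).mono
      (by omega) fun T _ hT l hl => ?_
    · simpa using h0
    · obtain rfl : l = 0 := by omega
      convert hT using 1
      funext x
      simp
  | succ k ih =>
    -- Half the precision, rounded up. The same c bounds the products on all levels.
    set N' := (N + 1) / 2 with hN'
    rw [pow_succ] at hN
    have hlog : Nat.log 2 N' ≤ Nat.log 2 N := by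
      rcases Nat.eq_zero_or_pos N with rfl | hN0
      · simp [hN']
      · exact Nat.log_mono_right (by omega)
    rcases Nat.eq_zero_or_pos N with rfl | hN0
    · exact Obtainable.of (by simp) _
    have hc' : 2460 * (N' * (Nat.log 2 N' + 2) ^ 3) ≤ c := le_trans (by gcongr; omega) hc
    refine Obtainable.mono ((ih (by omega) hc' fun l hl => hh l (by omega)).bind fun T₁ hT₁ hinv =>
      (Obtainable.const 0).bind fun T₂ hT₂ hz => ?_) (c := 2 + k * (1 + 2 * c + N') +
        (1 + (c + (c + N)))) ?_ fun T _ hT => hT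
    · set g : Ω → PowerSeries K := fun x => PowerSeries.mk fun l =>
        if l < N' then PowerSeries.coeff l (h x)⁻¹ else 0 with hg
      have hgT (l : ℕ) : (fun x => PowerSeries.coeff l (g x)) ∈ T₂ := by
        simp only [hg, PowerSeries.coeff_mk]
        by_cases hl : l < N'
        · simpa only [if_pos hl] using hT₂ (hinv l hl)
        · simpa only [if_neg hl] using hz
      refine ((Obtainable.mulSeries N (fun l hl => hT₂ (hT₁ (hh l hl))) fun l _ => hgT l).mono hc
        fun T _ hT => hT).bind fun T₃ hT₃ hhg => ((Obtainable.mulSeries N hhg fun l _ =>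
          hT₃ (hgT l)).mono hc fun T _ hT => hT).bind fun T₄ hT₄ hhgg => ?_
      have := Obtainable.all (S := T₄) (c := 1) (Finset.range N)
        (Φ := fun l T => (fun x => PowerSeries.coeff l (h x)⁻¹) ∈ T) (fun l _ T T' hT h => hT h)
        fun l hl T hT => ?_
      · rw [Finset.card_range, mul_one] at this
        exact this.mono le_rfl fun T _ hT l hl => hT l (Finset.mem_range.2 hl)
      -- Coefficients below N' are already known. Above, those of g vanish, so that of the inverse
      -- is minus that of h g².
      · by_cases hlN : l < N'
        · exact Obtainable.of (hT (hT₄ (hT₃ (hT₂ (hinv l hlN))))) _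
        · have hl := Finset.mem_range.1 hl
          refine (Obtainable.sub (hT (hT₄ (hT₃ hz))) (hT (hhgg l hl))).mono le_rfl
            fun T _ hT => ?_
          convert hT using 1
          funext x
          rw [coeff_inv_eq_of_coeff_eq (h0 x) (g := g x) (N := N')
            (fun l hl => by simp [hg, hl]) (by omega)]
          simp [hg, hlN]
    · have := Nat.mul_le_mul_left k (show 1 + 2 * c + N' ≤ 1 + 2 * c + N by omega)
      have h2 : (k + 1) * (1 + 2 * c + N) = k * (1 + 2 * c + N) + (1 + 2 * c + N) :=
        Nat.succ_mul _ _
      omega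

/-- Charging every Newton level at full precision costs one more logarithm than a product; this is
the fourth power in `quasilin`. -/
theorem Obtainable.invSeries_quasilin (h0 : ∀ x, PowerSeries.constantCoeff (h x) ≠ 0) (N : ℕ)
    (hh : ∀ l < N, (fun x => PowerSeries.coeff l (h x)) ∈ S) :
    Obtainable S (5000 * quasilin N) fun T =>
      ∀ l < N, (fun x => PowerSeries.coeff l (h x)⁻¹) ∈ T := by
  refine (Obtainable.invSeries h0 (Nat.log 2 N + 1) (Nat.lt_pow_succ_log_self (by norm_num) N).le
    le_rfl hh).mono ?_ fun T _ hT => hT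
  have h1 := succ_mul_log_le_quasilin N
  set t := Nat.log 2 N + 2 with ht
  have h2 : (t - 1) * (1 + 2 * (2460 * (N * t ^ 3)) + N) ≤
      t * (1 + 2 * (2460 * (N * t ^ 3)) + N) := Nat.mul_le_mul_right _ (by omega)
  have h3 : t * (1 + 2 * (2460 * (N * t ^ 3)) + N) = (N + 1) * t + 4920 * (N * t ^ 4) := by ring
  have h4 : N * t ^ 4 ≤ quasilin N := Nat.mul_le_mul_right _ (by omega)
  have h5 : Nat.log 2 N + 1 = t - 1 := by omega
  have h6 : 1 ≤ (N + 1) * t := Nat.mul_pos (by omega) (by omega)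
  rw [h5]
  omega

theorem Obtainable.mulSeries_quasilin (B : ℕ)
    (hf : ∀ l < B, (fun x => PowerSeries.coeff l (f x)) ∈ S)
    (hg : ∀ l < B, (fun x => PowerSeries.coeff l (g x)) ∈ S) :
    Obtainable S (1230 * quasilin B) fun T =>
      ∀ l < B, (fun x => PowerSeries.coeff l (f x * g x)) ∈ T :=
  (Obtainable.mulSeries B hf hg).mono (by have := mul_log_pow_le_quasilin B; omega)
    fun _ _ h => h

end Series

/-! ### Trees for products, series quotients and products modulo f. -/

section Trees

variable {K : Type u} [Field K]

theorem zero_eq_of_degree_lt {Ω : Type u} {f : Ω → K[X]} {N l : ℕ} (hf : ∀ x, (f x).degree < N)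
    (hl : N ≤ l) : (fun x => (f x).coeff l) = 0 :=
  funext fun x => (degree_lt_iff_coeff_zero _ _).1 (hf x) l hl

variable [DecidableEq K]

theorem exists_mul_tree (N M : ℕ) : ∃ t : CTree K (List ℕ), t.depth ≤ 20000 * quasilin (N + M) ∧
    ∀ p q : K[X], p.degree < N → q.degree < M →
      t.eval (firstCoeffs p N ++ firstCoeffs q M) = some (firstCoeffs (p * q) (N + M - 1)) := by
  -- The instances are only the admissible inputs, so coefficients beyond the degree bounds are
  -- identically the quantity 0.
  let Ω := {x : K[X] × K[X] // x.1.degree < N ∧ x.2.degree < M}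
  let ins : List (Ω → K) := ((List.range N).map fun i x => x.1.1.coeff i) ++
    (List.range M).map fun i x => x.1.2.coeff i
  let outs : List (Ω → K) := (List.range (N + M - 1)).map fun i x => (x.1.1 * x.1.2).coeff i
  have h : Obtainable {f | f ∈ ins} (20000 * quasilin (N + M)) fun T => ∀ f ∈ outs, f ∈ T := by
    refine ((Obtainable.const 0).bind fun T hT h0 => (Obtainable.mulSeries_quasilin (N + M - 1)
      (f := fun x : Ω => (x.1.1 : PowerSeries K)) (g := fun x : Ω => (x.1.2 : PowerSeries K))
      (fun l _ => ?_) fun l _ => ?_)).mono ?_ fun T _ hT f hf => ?_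
    · simp only [coeff_coe]
      by_cases hl : l < N
      · exact hT (List.mem_append_left _ (List.mem_map.2 ⟨l, List.mem_range.2 hl, rfl⟩))
      · rw [zero_eq_of_degree_lt (fun x => x.2.1) (by omega)]
        exact h0
    · simp only [coeff_coe]
      by_cases hl : l < M
      · exact hT (List.mem_append_right _ (List.mem_map.2 ⟨l, List.mem_range.2 hl, rfl⟩))
      · rw [zero_eq_of_degree_lt (fun x => x.2.2) (by omega)]
        exact h0
    · have h1 := quasilin_mono (show N + M - 1 ≤ N + M by omega)
      have h2 := succ_mul_log_le_quasilin (N + M)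
      have h3 : 1 ≤ (N + M + 1) * (Nat.log 2 (N + M) + 2) := Nat.mul_pos (by omega) (by omega)
      omega
    · obtain ⟨l, hl, rfl⟩ := List.mem_map.1 hf
      simpa only [← Polynomial.coe_mul, coeff_coe] using hT l (List.mem_range.1 hl)
  obtain ⟨t, ht, hval⟩ := h.exists_tree
  refine ⟨t, ht, fun p q hp hq => ?_⟩
  simpa [ins, outs, firstCoeffs, Function.comp_def] using hval ⟨(p, q), hp, hq⟩

theorem exists_quo_tree (N : ℕ) : ∃ t : CTree K (List ℕ), t.depth ≤ 20000 * quasilin N ∧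
    ∀ g h : K[X], h.coeff 0 ≠ 0 → t.eval (firstCoeffs g N ++ firstCoeffs h N) =
      some ((List.range N).map fun i =>
        PowerSeries.coeff i ((g : PowerSeries K) * (h : PowerSeries K)⁻¹)) := by
  let Ω := {x : K[X] × K[X] // x.2.coeff 0 ≠ 0}
  let ins : List (Ω → K) := ((List.range N).map fun i x => x.1.1.coeff i) ++
    (List.range N).map fun i x => x.1.2.coeff i
  let outs : List (Ω → K) := (List.range N).map fun i x =>
    PowerSeries.coeff i ((x.1.1 : PowerSeries K) * (x.1.2 : PowerSeries K)⁻¹)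
  have h : Obtainable {f | f ∈ ins} (20000 * quasilin N) fun T => ∀ f ∈ outs, f ∈ T := by
    refine ((Obtainable.invSeries_quasilin (h := fun x : Ω => (x.1.2 : PowerSeries K))
      (fun x => ?_) N fun l hl => ?_).bind fun T hT hinv => Obtainable.mulSeries_quasilin N
        (f := fun x : Ω => (x.1.1 : PowerSeries K)) (fun l hl => ?_) hinv).mono ?_
          fun T _ hT f hf => ?_
    · simpa [← PowerSeries.coeff_zero_eq_constantCoeff_apply, coeff_coe] using x.2
    · simp only [coeff_coe]
      exact List.mem_append_right _ (List.mem_map.2 ⟨l, List.mem_range.2 hl, rfl⟩)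
    · simp only [coeff_coe]
      exact hT (List.mem_append_left _ (List.mem_map.2 ⟨l, List.mem_range.2 hl, rfl⟩))
    · omega
    · obtain ⟨l, hl, rfl⟩ := List.mem_map.1 hf
      exact hT l (List.mem_range.1 hl)
  obtain ⟨t, ht, hval⟩ := h.exists_tree
  refine ⟨t, ht, fun g h hh => ?_⟩
  simpa [ins, outs, firstCoeffs, Function.comp_def] using hval ⟨(g, h), hh⟩

theorem exists_mulRem_tree (n : ℕ) : ∃ t : CTree K (List ℕ), t.depth ≤ 20000 * quasilin (2 * n) ∧
    ∀ f p q : K[X], f.degree = n → p.degree < n → q.degree < n →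
      t.eval (firstCoeffs f (n + 1) ++ firstCoeffs p n ++ firstCoeffs q n) =
        some (firstCoeffs (p * q % f) n) := by
  let Ω := {x : K[X] × K[X] × K[X] // x.1.degree = n ∧ x.2.1.degree < n ∧ x.2.2.degree < n}
  let ins : List (Ω → K) := ((List.range (n + 1)).map fun i x => x.1.1.coeff i) ++
    ((List.range n).map fun i x => x.1.2.1.coeff i) ++ (List.range n).map fun i x => x.1.2.2.coeff i
  let outs : List (Ω → K) := (List.range n).map fun i x => (x.1.2.1 * x.1.2.2 % x.1.1).coeff i
  have h : Obtainable {f | f ∈ ins} (20000 * quasilin (2 * n)) fun T => ∀ f ∈ outs, f ∈ T := by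
    rcases Nat.eq_zero_or_pos n with rfl | hn
    · exact Obtainable.of (by simp [outs]) _
    have hf (l : ℕ) (hl : l ≤ n) : (fun x : Ω => x.1.1.coeff l) ∈ {f | f ∈ ins} :=
      List.mem_append_left _ (List.mem_append_left _ (List.mem_map.2 ⟨l, List.mem_range.2 (by omega), rfl⟩))
    have hp (l : ℕ) (hl : l < n) : (fun x : Ω => x.1.2.1.coeff l) ∈ {f | f ∈ ins} :=
      List.mem_append_left _ (List.mem_append_right _ (List.mem_map.2 ⟨l, List.mem_range.2 hl, rfl⟩))
    have hq (l : ℕ) (hl : l < n) : (fun x : Ω => x.1.2.2.coeff l) ∈ {f | f ∈ ins} :=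
      List.mem_append_right _ (List.mem_map.2 ⟨l, List.mem_range.2 hl, rfl⟩)
    -- The quantities obtained are p q to precision 2n, the inverse of the reversed f, the n - 1
    -- coefficients of the reversed quotient, f times the quotient modulo x^n, and the difference of
    -- the two products.
    refine ((Obtainable.const 0).bind fun T₁ hT₁ h0 => (Obtainable.mulSeries_quasilin (2 * n)
      (f := fun x : Ω => (x.1.2.1 : PowerSeries K)) (g := fun x : Ω => (x.1.2.2 : PowerSeries K))
      (fun l _ => ?_) fun l _ => ?_).bind fun T₂ hT₂ hpq => (Obtainable.invSeries_quasilin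
        (h := fun x : Ω => (reflect n x.1.1 : PowerSeries K)) (fun x => ?_) n fun l hl => ?_).bind
      fun T₃ hT₃ hinv => (Obtainable.mulSeries_quasilin (n - 1)
        (f := fun x : Ω => (reflect (2 * n - 2) (x.1.2.1 * x.1.2.2) : PowerSeries K))
        (fun l hl => ?_) fun l hl => hinv l (by omega)).bind fun T₄ hT₄ hquo =>
      (Obtainable.mulSeries_quasilin n (f := fun x : Ω => (x.1.1 : PowerSeries K))
        (g := fun x : Ω => ((x.1.2.1 * x.1.2.2 / x.1.1 : K[X]) : PowerSeries K)) (fun l hl => ?_)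
          fun l hl => ?_).bind fun T₅ hT₅ hprod => Obtainable.all (c := 1) (Finset.range n)
            (Φ := fun l T => (fun x : Ω => (x.1.2.1 * x.1.2.2 % x.1.1).coeff l) ∈ T)
              (fun l _ T T' hT h => hT h) fun l hl T hT => ?_).mono ?_ fun T _ hT f hf => ?_
    · simp only [coeff_coe]
      by_cases hl : l < n
      · exact hT₁ (hp l hl)
      · rw [zero_eq_of_degree_lt (fun x => x.2.2.1) (by omega)]
        exact h0
    · simp only [coeff_coe]
      by_cases hl : l < n
      · exact hT₁ (hq l hl)
      · rw [zero_eq_of_degree_lt (fun x => x.2.2.2) (by omega)]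
        exact h0
    · rw [← PowerSeries.coeff_zero_eq_constantCoeff_apply, coeff_coe]
      exact coeff_reflect_zero_ne_zero x.2.1
    · simp only [coeff_coe, coeff_reflect_of_le _ hl.le]
      exact hT₂ (hT₁ (hf _ (by omega)))
    · simp only [coeff_coe]
      simp only [coeff_reflect_of_le (N := 2 * n - 2) _ (show l ≤ 2 * n - 2 by omega)]
      have := hpq (2 * n - 2 - l) (by omega)
      simp only [← Polynomial.coe_mul, coeff_coe] at this
      exact hT₃ this
    · simp only [coeff_coe]
      exact hT₄ (hT₃ (hT₂ (hT₁ (hf l hl.le))))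
    · simp only [coeff_coe]
      by_cases hln : l + 2 ≤ n
      · convert hquo (n - 2 - l) (by omega) using 1
        funext x
        have h1 := natDegree_le_sub_one x.2.2.1
        have h2 := natDegree_le_sub_one x.2.2.2
        exact coeff_div_eq_coeff_reflect x.2.1 (by omega) (natDegree_mul_le.trans (by omega))
          (by omega)
      -- The quotient has degree at most n - 2, so the coefficient n - 1 is 0.
      · convert hT₄ (hT₃ (hT₂ h0)) using 1
        funext x
        rw [coeff_mul_div_eq_sum x.2.1 (Or.inl x.2.2.1) x.2.2.2, Finset.Ico_eq_empty (by omega),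
          Finset.sum_empty]
    · have hl := Finset.mem_range.1 hl
      have h1 := hpq l (by omega)
      have h2 := hprod l hl
      simp only [← Polynomial.coe_mul, coeff_coe] at h1 h2
      refine (Obtainable.sub (hT (hT₅ (hT₄ (hT₃ h1)))) (hT h2)).mono le_rfl fun T _ hT => ?_
      convert hT using 1
      funext x
      rw [EuclideanDomain.mod_eq_sub_mul_div, coeff_sub]
      rfl
    · have h1 := quasilin_mono (show n - 1 ≤ 2 * n by omega)
      have h2 := quasilin_mono (show n ≤ 2 * n by omega)
      have h3 := succ_mul_log_le_quasilin (2 * n)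
      have h4 : (2 * n + 1) * 1 ≤ (2 * n + 1) * (Nat.log 2 (2 * n) + 2) :=
        Nat.mul_le_mul_left _ (by omega)
      rw [Finset.card_range]
      omega
    · obtain ⟨l, hl, rfl⟩ := List.mem_map.1 hf
      exact hT l (Finset.mem_range.2 (List.mem_range.1 hl))
  obtain ⟨t, ht, hval⟩ := h.exists_tree
  refine ⟨t, ht, fun f p q hf hp hq => ?_⟩
  simpa [ins, outs, firstCoeffs, Function.comp_def] using hval ⟨(f, p, q), hf, hp, hq⟩

end Trees

/-! ### Rectangular products of polynomial matrices. -/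

section MatrixTrees

variable {K : Type u} [Field K] [DecidableEq K]

theorem MultipliesRect.matMulCost {t : CTree K (List ℕ)} {N : ℕ} (ht : MultipliesRect t N)
    (Ω : Type u) : MatMulCost K Ω (Fin N) (Fin (N ^ 2)) (Fin N) t.depth := by
  intro S P Q hP hQ
  let ins : List (Ω → K) :=
    ((List.finRange N).flatMap fun i => (List.finRange (N ^ 2)).map fun k => P i k) ++
    (List.finRange (N ^ 2)).flatMap fun k => (List.finRange N).map fun j => Q k j
  let outs : List (Ω → K) :=
    (List.finRange N).flatMap fun i => (List.finRange N).map fun j => ∑ b, P i b * Q b j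
  have hins : ∀ f ∈ ins, f ∈ S := by
    intro f hf
    simp only [ins, List.mem_append, List.mem_flatMap, List.mem_map] at hf
    rcases hf with ⟨i, -, k, -, rfl⟩ | ⟨k, -, j, -, rfl⟩
    exacts [hP i k, hQ k j]
  refine (Obtainable.tree t hins (outs := outs) fun x => ?_).mono le_rfl fun T _ hT i j =>
    hT _ ?_
  · have := ht (Matrix.of fun i k => P i k x) (Matrix.of fun k j => Q k j x)
    simpa [ins, outs, entryList, List.map_flatMap, Function.comp_def, Matrix.mul_apply] using this
  · simp only [outs, List.mem_flatMap, List.mem_map]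
    exact ⟨i, List.mem_finRange _, j, List.mem_finRange _, rfl⟩

/-- Both matrices are padded with zeros and the inner dimension is cut into `q / N ^ 2 + 1` blocks
of size N². Each block is one product over power series at precision 2m - 1, and the results are
added. -/
theorem exists_matMul_tree {t : CTree K (List ℕ)} {N : ℕ} (ht : MultipliesRect t N) (hN : 0 < N)
    {r s : ℕ} (hr : r ≤ N) (hs : s ≤ N) (q m : ℕ) : ∃ T : CTree K (List ℕ),
      T.depth ≤ 1000 * ((t.depth + 3 * N ^ 3) * (q / N ^ 2 + 1) * quasilin (2 * m)) ∧
      ∀ (P : Matrix (Fin r) (Fin q) K[X]) (Q : Matrix (Fin q) (Fin s) K[X]),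
        (∀ i j, (P i j).degree < m) → (∀ i j, (Q i j).degree < m) →
        T.eval (polyEntryList P m ++ polyEntryList Q m) =
          some (polyEntryList (P * Q) (2 * m - 1)) := by
  -- The summand 3N³ dominates the total size 2N³ + N² of the factors and the product, whose entries
  -- have to be transformed.
  set W := t.depth + 3 * N ^ 3 with hW
  set B := 2 * m - 1 with hB
  set nb := q / N ^ 2 + 1 with hnb
  have hN3 : 0 < N ^ 3 := pow_pos hN 3
  let Ω := {x : Matrix (Fin r) (Fin q) K[X] × Matrix (Fin q) (Fin s) K[X] //
    (∀ i j, (x.1 i j).degree < m) ∧ ∀ i j, (x.2 i j).degree < m}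
  let ins : List (Ω → K) :=
    ((List.finRange r).flatMap fun i => (List.finRange q).flatMap fun k =>
      (List.range m).map fun l x => (x.1.1 i k).coeff l) ++
    (List.finRange q).flatMap fun k => (List.finRange s).flatMap fun j =>
      (List.range m).map fun l x => (x.1.2 k j).coeff l
  let outs : List (Ω → K) := (List.finRange r).flatMap fun i => (List.finRange s).flatMap fun j =>
    (List.range B).map fun l x => ((x.1.1 * x.1.2) i j).coeff l
  let Pf : ℕ → ℕ → Ω → K[X] := fun i k x =>
    if h : i < r ∧ k < q then x.1.1 ⟨i, h.1⟩ ⟨k, h.2⟩ else 0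
  let Qf : ℕ → ℕ → Ω → K[X] := fun k j x =>
    if h : k < q ∧ j < s then x.1.2 ⟨k, h.1⟩ ⟨j, h.2⟩ else 0
  have hPf {T : Set (Ω → K)} (hT : {f | f ∈ ins} ⊆ T) (h0 : (fun _ => 0) ∈ T) (i k l : ℕ) :
      (fun x => (Pf i k x).coeff l) ∈ T := by
    by_cases h : i < r ∧ k < q
    · simp only [Pf, dif_pos h]
      by_cases hl : l < m
      · refine hT (List.mem_append_left _ ?_)
        simp only [List.mem_flatMap, List.mem_map, List.mem_range]
        exact ⟨_, List.mem_finRange _, _, List.mem_finRange _, l, hl, rfl⟩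
      · rw [zero_eq_of_degree_lt (fun x => x.2.1 _ _) (not_lt.1 hl)]
        exact h0
    · simpa only [Pf, dif_neg h, coeff_zero] using h0
  have hQf {T : Set (Ω → K)} (hT : {f | f ∈ ins} ⊆ T) (h0 : (fun _ => 0) ∈ T) (k j l : ℕ) :
      (fun x => (Qf k j x).coeff l) ∈ T := by
    by_cases h : k < q ∧ j < s
    · simp only [Qf, dif_pos h]
      by_cases hl : l < m
      · refine hT (List.mem_append_right _ ?_)
        simp only [List.mem_flatMap, List.mem_map, List.mem_range]
        exact ⟨_, List.mem_finRange _, _, List.mem_finRange _, l, hl, rfl⟩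
      · rw [zero_eq_of_degree_lt (fun x => x.2.2 _ _) (not_lt.1 hl)]
        exact h0
    · simpa only [Qf, dif_neg h, coeff_zero] using h0
  have hq : q ≤ nb * N ^ 2 := by
    rw [hnb, mul_comm]
    exact (Nat.lt_mul_div_succ q (pow_pos hN 2)).le
  have hmul (i : Fin r) (j : Fin s) (l : ℕ) : (fun x : Ω => ((x.1.1 * x.1.2) i j).coeff l) =
      ∑ blk ∈ Finset.range nb, fun x => PowerSeries.coeff l (∑ b : Fin (N ^ 2),
        (Pf i (blk * N ^ 2 + b) x : PowerSeries K) * (Qf (blk * N ^ 2 + b) j x : PowerSeries K)) := by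
    funext x
    rw [Finset.sum_apply, ← map_sum]
    have h1 (blk : ℕ) : ∑ b : Fin (N ^ 2),
        (Pf i (blk * N ^ 2 + b) x : PowerSeries K) * (Qf (blk * N ^ 2 + b) j x : PowerSeries K) =
          ∑ b ∈ Finset.range (N ^ 2), ((Pf i (blk * N ^ 2 + b) x * Qf (blk * N ^ 2 + b) j x : K[X]) :
            PowerSeries K) := by
      simp only [Finset.sum_range, Polynomial.coe_mul]
    rw [Finset.sum_congr rfl fun blk _ => h1 blk, ← sum_range_mul (fun k =>
      ((Pf i k x * Qf k j x : K[X]) : PowerSeries K)), map_sum, Matrix.mul_apply, finsetSum_coeff,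
      ← Finset.sum_subset (Finset.range_subset_range.2 hq) fun k _ hk => ?_, Finset.sum_range]
    · refine Finset.sum_congr rfl fun k _ => ?_
      rw [coeff_coe]
      simp [Pf, Qf]
    · have hk : ¬ k < q := by simpa using hk
      simp [Pf, hk]
  have h : Obtainable {f | f ∈ ins} (1000 * (W * nb * quasilin (2 * m)))
      fun T => ∀ f ∈ outs, f ∈ T := by
    refine ((Obtainable.const 0).bind fun T₁ hT₁ h0 => (Obtainable.all
      (c := 820 * W * (B * (Nat.log 2 B + 2) ^ 3)) (Finset.range nb)
      (Φ := fun blk T => ∀ (i j : Fin N), ∀ l < B, (fun x => PowerSeries.coeff l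
        (∑ b : Fin (N ^ 2), (Pf i (blk * N ^ 2 + b) x : PowerSeries K) *
          (Qf (blk * N ^ 2 + b) j x : PowerSeries K))) ∈ T)
      (fun blk _ T T' hT h i j l hl => hT (h i j l hl)) fun blk _ T hT =>
        MatMulCost.powerSeries (P := fun i b x => (Pf i (blk * N ^ 2 + b) x : PowerSeries K))
          (Q := fun b j x => (Qf (blk * N ^ 2 + b) j x : PowerSeries K))
          (ht.matMulCost Ω) (Nat.le_add_right _ _) (by omega) ?_ B
          (fun i b l _ => ?_) fun b j l _ => ?_).bind fun T₂ hT₂ hprod =>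
      Obtainable.all (c := nb + 1) ((Finset.univ : Finset (Fin r × Fin s)) ×ˢ Finset.range B)
        (Φ := fun y T => (fun x : Ω => ((x.1.1 * x.1.2) y.1.1 y.1.2).coeff y.2) ∈ T)
        (fun y _ T T' hT h => hT h) fun y hy T hT => ?_).mono ?_ fun T _ hT f hf => ?_
    · simp only [Fintype.card_prod, Fintype.card_fin]
      rw [show N * N ^ 2 + N ^ 2 * N + N * N = 2 * N ^ 3 + N ^ 2 by ring]
      have : N ^ 2 ≤ N ^ 3 := Nat.pow_le_pow_right hN (by norm_num)
      omega
    · simp only [coeff_coe]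
      exact hPf (hT₁.trans hT) (hT h0) _ _ _
    · simp only [coeff_coe]
      exact hQf (hT₁.trans hT) (hT h0) _ _ _
    · simp only [Finset.mem_product, Finset.mem_univ, true_and, Finset.mem_range] at hy
      rw [hmul, ← Finset.card_range nb]
      simp only [Finset.card_range]
      refine (Obtainable.sum (Finset.range nb) fun blk hblk => hT (hprod blk hblk
        ⟨y.1.1, y.1.1.2.trans_le hr⟩ ⟨y.1.2, y.1.2.2.trans_le hs⟩ y.2 hy)).mono (by simp)
          fun _ _ h => h
    · simp only [Finset.card_product, Finset.card_univ, Fintype.card_prod, Fintype.card_fin,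
        Finset.card_range]
      have hL := (mul_log_pow_le_quasilin B).trans (quasilin_mono (show B ≤ 2 * m by omega))
      have hL2 : B + 1 ≤ quasilin (2 * m) := by
        have h1 := (succ_mul_log_le_quasilin B).trans (quasilin_mono (show B ≤ 2 * m by omega))
        have h2 : (B + 1) * 1 ≤ (B + 1) * (Nat.log 2 B + 2) := Nat.mul_le_mul_left _ (by omega)
        omega
      have hrs : r * s ≤ W := by
        have h1 := Nat.mul_le_mul hr hs
        have : N * N * 1 ≤ N * N * N := Nat.mul_le_mul_left _ hN
        have : N ^ 3 = N * N * N := by ring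
        omega
      have hnb1 : 1 ≤ nb := Nat.succ_pos _
      have hW1 : 1 ≤ W := by omega
      have e1 : nb * (820 * W * (B * (Nat.log 2 B + 2) ^ 3)) ≤ 410 * (W * nb * quasilin (2 * m)) := by
        calc nb * (820 * W * (B * (Nat.log 2 B + 2) ^ 3))
            = 410 * (W * nb * (B * (Nat.log 2 B + 2) ^ 3 * 2)) := by ring
          _ ≤ _ := by gcongr
      have e2 : r * s * B * (nb + 1) ≤ 2 * (W * nb * quasilin (2 * m)) := by
        calc r * s * B * (nb + 1) ≤ W * quasilin (2 * m) * (2 * nb) := by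
              gcongr <;> omega
          _ = _ := by ring
      have e3 : 1 ≤ W * nb * quasilin (2 * m) :=
        Nat.mul_pos (Nat.mul_pos hW1 hnb1) (by omega)
      omega
    · simp only [outs, List.mem_flatMap, List.mem_map, List.mem_range] at hf
      obtain ⟨i, -, j, -, l, hl, rfl⟩ := hf
      exact hT ((i, j), l) (by simpa using hl)
  obtain ⟨T, hT, hval⟩ := h.exists_tree
  refine ⟨T, hT, fun P Q hP hQ => ?_⟩
  simpa [ins, outs, polyEntryList, firstCoeffs, List.map_flatMap, Function.comp_def] using
    hval ⟨(P, Q), hP, hQ⟩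

end MatrixTrees

/-! ### Operation count of the algorithm. -/

theorem le_ceilSqrt_mul_self (d : ℕ) : d ≤ ceilSqrt d * ceilSqrt d := by
  have := Nat.lt_succ_sqrt (d - 1)
  simp only [ceilSqrt, Nat.succ_eq_add_one] at this ⊢
  omega

theorem ceilDiv_ceilSqrt_le (d : ℕ) : d ⌈/⌉ ceilSqrt d ≤ ceilSqrt d :=
  (ceilDiv_le_iff_le_mul (Nat.succ_pos _)).2 (le_ceilSqrt_mul_self d)

theorem ceilSqrt_le {d : ℕ} (hd : 0 < d) : (ceilSqrt d : ℝ) ≤ 2 * Real.sqrt d := by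
  have h1 : (Nat.sqrt (d - 1) : ℝ) ≤ Real.sqrt d :=
    Real.le_sqrt_of_sq_le (by exact_mod_cast (Nat.sqrt_le' (d - 1)).trans (Nat.sub_le d 1))
  have h2 : 1 ≤ Real.sqrt d := Real.one_le_sqrt.2 (by exact_mod_cast hd)
  rw [ceilSqrt]
  push_cast
  linarith

section Cost

variable {K : Type u}

theorem costLE_addSub (z : ℕ) (o : ArithOp) (N : ℕ) (p q : RefPoly) :
    (addSub (K := K) z o N p q).CostLE N :=
  ((Build.CostLE.loop N (c := 1) fun i => Build.CostLE.arith o (p i) (q i)).bind_pure).mono (by simp)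

/-- The inner dimensions ℓ and ℓ + 1 satisfy k m ≤ n + m. Since t < m, each of the three small
products involves at most 3m input coefficients. -/
theorem costLE_simultaneousTruncatedModularMultiplication (S : Subroutines K)
    {n m r s R U V : ℕ} (z : ℕ) (f : RefPoly) (p q : ℕ → RefPoly) (hm : 0 < m)
    (hquo : (S.quo (n - 1)).depth ≤ R)
    (hmul : ∀ N M, N + M ≤ 3 * m → (S.mul N M).depth ≤ U)
    (hmat : ∀ k, k * m ≤ n + m → (S.matMul r k s m).depth ≤ V) :
    (simultaneousTruncatedModularMultiplication S z n r s f p q m).CostLE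
      (s * R + (V + (V + r * (s * (3 * U + 3 * m))))) := by
  set ℓ : ℕ := if n ≤ m then 0 else (n - m - 1) / m with hℓ
  have hℓn : ℓ * m ≤ n ∧ (n : ℤ) - m - 1 - ℓ * m < m := by
    by_cases h : n ≤ m
    · rw [hℓ, if_pos h]
      simp only [zero_mul, Nat.zero_le, Nat.cast_zero, sub_zero, true_and]
      omega
    · have h1 := Nat.div_add_mod (n - m - 1) m
      have h2 := Nat.mod_lt (n - m - 1) hm
      have h3 : ℓ * m = m * ((n - m - 1) / m) := by rw [hℓ, if_neg h, mul_comm]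
      refine ⟨by omega, ?_⟩
      have : ((ℓ * m : ℕ) : ℤ) = ℓ * m := by push_cast; ring
      omega
  unfold simultaneousTruncatedModularMultiplication
  refine Build.CostLE.bind (Build.CostLE.loop s fun j =>
    ((Build.CostLE.call _ _).bind_pure).mono hquo) fun qbarList =>
    Build.CostLE.bind (((Build.CostLE.call _ _).bind_pure).mono (hmat _ ?_)) fun A =>
    Build.CostLE.bind (((Build.CostLE.call _ _).bind_pure).mono (hmat _ ?_)) fun B =>
    Build.CostLE.bind_pure (Build.CostLE.loop r fun i => Build.CostLE.loop s fun j =>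
      Build.CostLE.mono (Build.CostLE.bind (((Build.CostLE.call _ _).bind_pure).mono (hmul _ _ ?_))
        fun D => Build.CostLE.bind (costLE_addSub _ _ _ _ _) fun AB =>
        Build.CostLE.bind (costLE_addSub _ _ _ _ _) fun hbar =>
        Build.CostLE.bind (((Build.CostLE.call _ _).bind_pure).mono (hmul _ _ (by omega))) fun pq =>
        Build.CostLE.bind (((Build.CostLE.call _ _).bind_pure).mono (hmul _ _ (by omega))) fun hf =>
        costLE_addSub _ _ _ _ _) (by omega))
  · change (ℓ + 1) * m ≤ n + m
    rw [Nat.succ_mul]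
    omega
  · change ℓ * m ≤ n + m
    omega
  · change ((n : ℤ) - m - 1 - ℓ * m).toNat + ((m : ℤ) + ((n : ℤ) - m - 1 - ℓ * m) - 1).toNat ≤ 3 * m
    omega

/-- The term with factor 3 collects r baby steps, s - 1 giant steps and s series quotients, where s
≤ r = ⌈√d⌉; the initial 2 counts the constants 0 and 1. -/
theorem depth_truncatedPowers_le [Zero K] [One K] (S : Subroutines K) {n m d R U V : ℕ}
    (hm : 0 < m) (hrem : (S.mulRem n).depth ≤ R) (hquo : (S.quo (n - 1)).depth ≤ R)
    (hmul : ∀ N M, N + M ≤ 3 * m → (S.mul N M).depth ≤ U)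
    (hmat : ∀ k, k * m ≤ n + m →
      (S.matMul (ceilSqrt d) k (d ⌈/⌉ ceilSqrt d) m).depth ≤ V) :
    (truncatedPowers S n m d).depth ≤
      2 + 3 * (ceilSqrt d * R) + 2 * V + ceilSqrt d * ceilSqrt d * (3 * U + 3 * m) := by
  have hs := ceilDiv_ceilSqrt_le d
  unfold truncatedPowers
  rw [CTree.depth_map]
  refine Build.CostLE.mono (Build.CostLE.bind (Build.CostLE.const _) fun z =>
    Build.CostLE.bind (Build.CostLE.const _) fun one => Build.CostLE.bind_pure
    (Build.CostLE.bind (Build.CostLE.iterates (fun p => ((Build.CostLE.call _ _).bind_pure).mono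
      hrem) _ _) fun ahat => Build.CostLE.bind (Build.CostLE.iterates (fun p =>
        ((Build.CostLE.call _ _).bind_pure).mono hrem) _ _) fun abar => Build.CostLE.bind_pure
          (costLE_simultaneousTruncatedModularMultiplication S z _ _ _ hm hquo hmul hmat))) ?_ _
  have h1 : (d ⌈/⌉ ceilSqrt d - 1) * R ≤ ceilSqrt d * R := Nat.mul_le_mul_right _ (by omega)
  have h2 : d ⌈/⌉ ceilSqrt d * R ≤ ceilSqrt d * R := Nat.mul_le_mul_right _ (by omega)
  have h3 : ceilSqrt d * (d ⌈/⌉ ceilSqrt d * (3 * U + 3 * m)) ≤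
      ceilSqrt d * ceilSqrt d * (3 * U + 3 * m) := by
    rw [mul_assoc]
    exact Nat.mul_le_mul_left _ (Nat.mul_le_mul_right _ hs)
  omega

end Cost

section Subroutines

variable {K : Type u} [Field K] [DecidableEq K]

/-- Correctness is required for every shape, so the tree for max r s is used; the cost is needed
only when s ≤ r, where the maximum is r. -/
theorem exists_subroutines {D : ℕ → ℕ}
    (h : ∀ N : ℕ, 0 < N → ∃ T : CTree K (List ℕ), MultipliesRect T N ∧ T.depth ≤ D N) :
    ∃ S : Subroutines K, S.Correct ∧
      (∀ N M, (S.mul N M).depth ≤ 20000 * quasilin (N + M)) ∧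
      (∀ n, (S.mulRem n).depth ≤ 20000 * quasilin (2 * n)) ∧
      (∀ N, (S.quo N).depth ≤ 20000 * quasilin N) ∧
      ∀ r q s m, 0 < r → s ≤ r → (S.matMul r q s m).depth ≤
        1000 * ((D r + 3 * r ^ 3) * (q / r ^ 2 + 1) * quasilin (2 * m)) := by
  have hmat (r q s m : ℕ) : ∃ T : CTree K (List ℕ), (0 < r → s ≤ r → T.depth ≤
      1000 * ((D r + 3 * r ^ 3) * (q / r ^ 2 + 1) * quasilin (2 * m))) ∧
      ∀ (P : Matrix (Fin r) (Fin q) K[X]) (Q : Matrix (Fin q) (Fin s) K[X]),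
        (∀ i j, (P i j).degree < m) → (∀ i j, (Q i j).degree < m) →
        T.eval (polyEntryList P m ++ polyEntryList Q m) =
          some (polyEntryList (P * Q) (2 * m - 1)) := by
    rcases Nat.eq_zero_or_pos (max r s) with h0 | hN
    · obtain rfl : r = 0 := by omega
      exact ⟨.leaf [], fun h => absurd h (lt_irrefl 0), fun P Q _ _ => by
        simp [CTree.eval, polyEntryList]⟩
    · obtain ⟨t, ht, htD⟩ := h _ hN
      obtain ⟨T, hT, hval⟩ := exists_matMul_tree ht hN (le_max_left r s) (le_max_right r s) q m
      refine ⟨T, fun _ hs => hT.trans ?_, hval⟩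
      rw [max_eq_left hs] at htD ⊢
      gcongr
  choose mul hmulD hmul using exists_mul_tree (K := K)
  choose quo hquoD hquo using exists_quo_tree (K := K)
  choose mulRem hmulRemD hmulRem using exists_mulRem_tree (K := K)
  choose matMul hmatD hmat using hmat
  exact ⟨⟨mul, mulRem, quo, matMul⟩, ⟨hmul, hmulRem, hquo, hmat⟩, hmulD, hmulRemD, hquoD, hmatD⟩

/-- The cost includes the 2N³ input nodes, so N³ ≤ C₀ N^ω for all N ≥ 1. -/
theorem FeasibleRectExponent.three_le {ω C₀ : ℝ} (h : FeasibleRectExponent K ω C₀) : 3 ≤ ω := by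
  by_contra! hω
  obtain ⟨N, hN, hN0⟩ := (((tendsto_rpow_atTop (sub_pos.2 hω)).comp
    tendsto_natCast_atTop_atTop).eventually_gt_atTop C₀ |>.and
      (Filter.eventually_gt_atTop 0)).exists
  obtain ⟨T, -, hT⟩ := h N hN0
  have hNr : (0 : ℝ) < N := by exact_mod_cast hN0
  have h1 : (N : ℝ) ^ 3 ≤ C₀ * (N : ℝ) ^ ω := by
    refine le_trans ?_ hT
    have : N ^ 3 ≤ T.cost (N * N ^ 2 + N ^ 2 * N) := by
      rw [CTree.cost, show N * N ^ 2 + N ^ 2 * N = N ^ 3 + N ^ 3 by ring]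
      omega
    exact_mod_cast this
  have h2 : (N : ℝ) ^ 3 = (N : ℝ) ^ (3 - ω) * (N : ℝ) ^ ω := by
    rw [← Real.rpow_add hNr, sub_add_cancel]
    norm_cast
  rw [h2] at h1
  exact absurd (le_of_mul_le_mul_right h1 (Real.rpow_pos_of_pos hNr ω)) (not_le.2 hN)

end Subroutines

/-! ### Comparison with c(d). -/

/-- From B ≤ 3c ≤ (2 + c)³ and log 2 > 1/2, the binary logarithm is at most 6 log(2 + c), and 2 ≤ 4
log(2 + c). -/
theorem quasilin_le {B : ℕ} {c : ℝ} (hc : 1 ≤ c) (hB : (B : ℝ) ≤ 3 * c) :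
    (quasilin B : ℝ) ≤ (B + 1) * (10 * Real.log (2 + c)) ^ 4 := by
  have hlog2 : (1 / 2 : ℝ) < Real.log 2 := by linarith [Real.log_two_gt_d9]
  have h2 : Real.log 2 ≤ Real.log (2 + c) := Real.log_le_log (by norm_num) (by linarith)
  have h1 : Real.log B ≤ 3 * Real.log (2 + c) := by
    rcases Nat.eq_zero_or_pos B with rfl | hB0
    · simp only [Nat.cast_zero, Real.log_zero]
      linarith
    · rw [← Real.log_rpow (by linarith)]
      refine Real.log_le_log (by exact_mod_cast hB0) (hB.trans ?_)
      rw [show (3 : ℝ) = (3 : ℕ) by norm_num, Real.rpow_natCast]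
      push_cast
      nlinarith [pow_pos (show 0 < c by linarith) 3, sq_nonneg c]
  have h3 : (Nat.log 2 B : ℝ) ≤ 6 * Real.log (2 + c) := by
    refine (Real.natLog_le_logb B 2).trans ?_
    rw [Real.logb, Nat.cast_ofNat, div_le_iff₀ (by linarith)]
    nlinarith
  have h4 : (Nat.log 2 B : ℝ) + 2 ≤ 10 * Real.log (2 + c) := by linarith
  rw [quasilin]
  push_cast
  gcongr

/-- One bound for each source of cost: the input size, the baby and giant steps, the r s small
products, and, by the last two together, the matrix products: r^ω per block, times the number of
blocks, times m. -/
theorem bicost_bounds {ω : ℝ} (hω : 3 ≤ ω) {n m d : ℕ} (hm : 0 < m) (hd : 0 < d) :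
    (n : ℝ) + m ≤ bicost ω m n d ∧
    (ceilSqrt d : ℝ) * (2 * n + 1) ≤ 4 * bicost ω m n d ∧
    (ceilSqrt d : ℝ) * ceilSqrt d * m ≤ 4 * bicost ω m n d ∧
    (ceilSqrt d : ℝ) ^ ω * (m + n / d) ≤ 2 ^ ω * bicost ω m n d ∧
    ((n + m : ℝ) / m / (ceilSqrt d : ℝ) ^ 2 + 1) * m ≤ 2 * (m + n / d) := by
  have hm1 : (1 : ℝ) ≤ m := by exact_mod_cast hm
  have hd1 : (1 : ℝ) ≤ d := by exact_mod_cast hd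
  have hd0 : (0 : ℝ) < d := by linarith
  have hn0 : (0 : ℝ) ≤ n := Nat.cast_nonneg n
  set r : ℝ := (ceilSqrt d : ℝ) with hr
  set σ := Real.sqrt d with hσ
  have hσ1 : 1 ≤ σ := Real.one_le_sqrt.2 hd1
  have hσ2 : σ * σ = d := Real.mul_self_sqrt hd0.le
  have hrσ : r ≤ 2 * σ := ceilSqrt_le hd
  have hr1 : 1 ≤ r := Nat.one_le_cast.2 (Nat.succ_pos _)
  have hdr : (d : ℝ) ≤ r ^ 2 := by rw [pow_two, hr]; exact_mod_cast le_ceilSqrt_mul_self d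
  set p := (d : ℝ) ^ (ω / 2) with hp
  -- The place where ω ≥ 3 enters: d^(3/2) ≤ d^(ω/2), hence n √d ≤ (n/d) d^(ω/2).
  have hσd : σ * d ≤ p := by
    rw [hσ, Real.sqrt_eq_rpow, ← Real.rpow_add_one hd0.ne', hp]
    exact Real.rpow_le_rpow_of_exponent_le hd1 (by linarith)
  have hdp : (d : ℝ) ≤ p := by nlinarith
  have hrp : r ^ ω ≤ 2 ^ ω * p := by
    calc r ^ ω ≤ (2 * σ) ^ ω := Real.rpow_le_rpow (by linarith) hrσ (by linarith)
      _ = 2 ^ ω * p := by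
        rw [Real.mul_rpow (by norm_num) (by linarith), hσ, Real.sqrt_eq_rpow, ← Real.rpow_mul hd0.le,
          hp, one_div_mul_eq_div]
  set E : ℝ := m + n / d with hE
  have hnd : 0 ≤ (n : ℝ) / d := by positivity
  have hndd : (n : ℝ) / d * d = n := div_mul_cancel₀ _ hd0.ne'
  set c := bicost ω m n d with hc
  have hcE : c = E * p := rfl
  have hmc : m * p ≤ c := by
    rw [hcE]
    gcongr
    linarith
  have hnc : (n : ℝ) / d * p ≤ c := by
    rw [hcE]
    gcongr
    linarith
  have hpc : p ≤ c := by nlinarith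
  have hc1 : 1 ≤ c := by linarith
  have hmc1 : (m : ℝ) ≤ c := by nlinarith
  have hnmc : (n : ℝ) + m ≤ c := by nlinarith
  have hσc : σ * (2 * n + 1) ≤ 2 * c := by
    have h1 : σ * n ≤ n / d * p := by
      calc σ * n = n / d * (σ * d) := by rw [mul_left_comm, hndd]
        _ ≤ _ := by gcongr
    have h2 : σ ≤ m * p := by
      calc σ ≤ σ * d := le_mul_of_one_le_right (by linarith) hd1
        _ ≤ p := hσd
        _ ≤ m * p := le_mul_of_one_le_left (by linarith) hm1
    have h3 : (n : ℝ) / d * p + m * p = c := by rw [hcE]; ring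
    linarith
  have hrc : r * (2 * n + 1) ≤ 4 * c := by
    calc r * (2 * n + 1) ≤ 2 * σ * (2 * n + 1) := by gcongr
      _ = 2 * (σ * (2 * n + 1)) := by ring
      _ ≤ 4 * c := by linarith
  have hrm : r * r * m ≤ 4 * c := by
    calc r * r * m ≤ 2 * σ * (2 * σ) * m := by gcongr
      _ = 4 * (m * d) := by rw [← hσ2]; ring
      _ ≤ 4 * (m * p) := by gcongr
      _ ≤ 4 * c := by linarith
  refine ⟨hnmc, hrc, hrm, ?_, ?_⟩
  · calc r ^ ω * E ≤ 2 ^ ω * p * E := by gcongr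
      _ = 2 ^ ω * c := by rw [hcE]; ring
  · have e1 : ((n + m : ℝ) / m / r ^ 2 + 1) * m = n / r ^ 2 + m / r ^ 2 + m := by
      field_simp
    have e2 : (n : ℝ) / r ^ 2 ≤ n / d := by gcongr
    have e3 : (m : ℝ) / r ^ 2 ≤ m := div_le_self (by linarith) (one_le_pow₀ hr1)
    linarith

/-- In units of c q, with q = (10 log(2 + c))⁴, the steps modulo f take 3 · 80000, the small
products 1000000 and the two matrix products 2 · 18000 C₀ 2^ω; the remainder of the constant is
slack. -/
theorem cost_le_bicost {ω C₀ : ℝ} (hω : 3 ≤ ω) {n m d X : ℕ} (hm : 0 < m) (hd : 0 < d)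
    (hX : (X : ℝ) ≤ 3 * (C₀ * (ceilSqrt d : ℝ) ^ ω)) (hC₀ : 0 ≤ C₀) {R U V : ℕ}
    (hR : R ≤ 20000 * quasilin (2 * n)) (hU : U ≤ 20000 * quasilin (3 * m))
    (hV : V ≤ 1000 * (X * ((n + m) / m / ceilSqrt d ^ 2 + 1) * quasilin (2 * m))) :
    (3 * n + 1 + (2 + 3 * (ceilSqrt d * R) + 2 * V + ceilSqrt d * ceilSqrt d * (3 * U + 3 * m)) : ℝ) ≤
      ((1300000 + 40000 * (C₀ * 2 ^ ω)) * 10 ^ 4) * bicost ω m n d *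
        Real.log (2 + bicost ω m n d) ^ 4 := by
  obtain ⟨hnmc, hrc, hrm, hrω, hE⟩ := bicost_bounds hω (n := n) hm hd
  have hm1 : (1 : ℝ) ≤ m := by exact_mod_cast hm
  have hn0 : (0 : ℝ) ≤ n := Nat.cast_nonneg n
  have hnd : 0 ≤ (n : ℝ) / d := by positivity
  set c := bicost ω m n d with hc
  have hc1 : 1 ≤ c := by linarith
  set r : ℝ := (ceilSqrt d : ℝ) with hr
  have hr0 : 0 ≤ r := Nat.cast_nonneg _
  generalize (m : ℝ) + n / d = E at hrω hE
  set q : ℝ := (10 * Real.log (2 + c)) ^ 4 with hq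
  have hlog : (1 / 2 : ℝ) < Real.log (2 + c) := by
    have h2 : Real.log 2 ≤ Real.log (2 + c) := Real.log_le_log (by norm_num) (by linarith)
    linarith [Real.log_two_gt_d9]
  have hq1 : 1 ≤ q := one_le_pow₀ (by linarith)
  have hmq : q ≤ m * q := le_mul_of_one_le_left (by linarith) hm1
  have hR' : (R : ℝ) ≤ 20000 * ((2 * n + 1) * q) := by
    have h := quasilin_le hc1 (B := 2 * n) (by push_cast; linarith)
    have h2 : (R : ℝ) ≤ 20000 * quasilin (2 * n) := (Nat.cast_le.2 hR).trans_eq (by rw [Nat.cast_mul, Nat.cast_ofNat])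
    push_cast at h
    linarith
  have hU' : (U : ℝ) ≤ 80000 * (m * q) := by
    have h := quasilin_le hc1 (B := 3 * m) (by push_cast; linarith)
    have h2 : (U : ℝ) ≤ 20000 * quasilin (3 * m) := (Nat.cast_le.2 hU).trans_eq (by rw [Nat.cast_mul, Nat.cast_ofNat])
    have h3 : ((3 * m : ℕ) + 1 : ℝ) * q ≤ 4 * (m * q) := by
      push_cast
      linarith
    linarith
  have hV' : (V : ℝ) ≤ 18000 * (C₀ * 2 ^ ω) * (c * q) := by
    have h := quasilin_le hc1 (B := 2 * m) (by push_cast; linarith)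
    have h1 : (quasilin (2 * m) : ℝ) ≤ 3 * (m * q) := by
      refine h.trans ?_
      push_cast
      linarith
    have h2 : ((((n + m) / m / ceilSqrt d ^ 2 + 1 : ℕ) : ℝ)) ≤ (n + m) / m / r ^ 2 + 1 := by
      rw [Nat.cast_add, Nat.cast_one]
      gcongr
      refine Nat.cast_div_le.trans ?_
      rw [Nat.cast_pow]
      gcongr
      exact_mod_cast Nat.cast_div_le (α := ℝ) (m := n + m) (n := m)
    calc (V : ℝ) ≤ 1000 * (X * ((n + m) / m / ceilSqrt d ^ 2 + 1 : ℕ) * quasilin (2 * m)) := by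
          refine (Nat.cast_le.2 hV).trans_eq ?_
          rw [Nat.cast_mul, Nat.cast_mul, Nat.cast_mul, Nat.cast_ofNat]
      _ ≤ 1000 * (3 * (C₀ * r ^ ω) * ((n + m) / m / r ^ 2 + 1) * (3 * (m * q))) := by
          gcongr
      _ = 9000 * C₀ * r ^ ω * q * (((n + m) / m / r ^ 2 + 1) * m) := by ring
      _ ≤ 9000 * C₀ * r ^ ω * q * (2 * E) := by gcongr
      _ = 18000 * C₀ * q * (r ^ ω * E) := by ring
      _ ≤ 18000 * C₀ * q * (2 ^ ω * c) := by gcongr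
      _ = 18000 * (C₀ * 2 ^ ω) * (c * q) := by ring
  have hcq : c ≤ c * q := le_mul_of_one_le_right (by linarith) hq1
  have hrR : r * R ≤ 80000 * (c * q) := by
    calc r * R ≤ r * (20000 * ((2 * n + 1) * q)) := by gcongr
      _ = 20000 * q * (r * (2 * n + 1)) := by ring
      _ ≤ 20000 * q * (4 * c) := by gcongr
      _ = _ := by ring
  have hrU : r * r * (3 * U + 3 * m) ≤ 1000000 * (c * q) := by
    have h1 : (m : ℝ) ≤ m * q := le_mul_of_one_le_right (by linarith) hq1
    calc r * r * (3 * U + 3 * m) ≤ r * r * (240003 * (m * q)) := by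
          gcongr
          linarith
      _ = 240003 * q * (r * r * m) := by ring
      _ ≤ 240003 * q * (4 * c) := by gcongr
      _ ≤ 1000000 * (c * q) := by linarith
  have hfin : (1300000 + 40000 * (C₀ * 2 ^ ω)) * 10 ^ 4 * c * Real.log (2 + c) ^ 4 =
      1300000 * (c * q) + 40000 * (C₀ * 2 ^ ω) * (c * q) := by
    rw [hq]
    ring
  have hpos : 0 ≤ C₀ * 2 ^ ω * (c * q) := by positivity
  rw [hfin]
  linarith

theorem mainTheorem12 :
    -- correctness, whatever correct subroutines are used
    (∀ (K : Type u) [Field K] [DecidableEq K] (S : Subroutines K), S.Correct →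
      ∀ (n m d : ℕ) (f a b : K[X]), 0 < m → 0 < d →
        f.degree = n → a.degree < n → b.degree < n →
        (truncatedPowers S n m d).eval (firstCoeffs f (n + 1) ++ firstCoeffs a n ++ firstCoeffs b n) =
          some ((List.range d).flatMap fun k => firstCoeffs (a ^ k * b % f) m)) ∧
    -- complexity: the constants depend only on the exponent and on its constant
    (∀ ω₂ C₀ : ℝ, ∃ (C : ℝ) (e : ℕ), ∀ (K : Type u) [Field K] [DecidableEq K],
      FeasibleRectExponent K ω₂ C₀ →
        ∃ S : Subroutines K, S.Correct ∧
          ∀ n m d : ℕ, 0 < m → 0 < d →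
            ((truncatedPowers S n m d).cost (3 * n + 1) : ℝ) ≤
              C * bicost ω₂ m n d * Real.log (2 + bicost ω₂ m n d) ^ e) := by
  refine ⟨fun K _ _ S hS n m d f a b hm hd hf ha hb => eval_truncatedPowers hS hm hd hf ha hb,
    fun ω C₀ => ⟨(1300000 + 40000 * (C₀ * 2 ^ ω)) * 10 ^ 4, 4, fun K _ _ h => ?_⟩⟩
  have hω := h.three_le
  have hfeas (N : ℕ) (hN : 0 < N) : ∃ T : CTree K (List ℕ), MultipliesRect T N ∧
      (T.depth + 2 * (N : ℝ) ^ 3) ≤ C₀ * (N : ℝ) ^ ω := by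
    obtain ⟨T, hT, hc⟩ := h N hN
    refine ⟨T, hT, le_of_eq_of_le ?_ hc⟩
    rw [CTree.cost]
    push_cast
    ring
  -- The case N = 1 of feasibility.
  have hC₀ : 0 ≤ C₀ := by
    obtain ⟨T, -, hT⟩ := hfeas 1 one_pos
    simp only [Nat.cast_one, one_pow, Real.one_rpow, mul_one] at hT
    have : (0 : ℝ) ≤ T.depth := Nat.cast_nonneg _
    linarith
  obtain ⟨S, hS, hmul, hrem, hquo, hmat⟩ := exists_subroutines (K := K)
    (D := fun N => ⌊C₀ * (N : ℝ) ^ ω⌋₊) fun N hN => by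
      obtain ⟨T, hT, hc⟩ := hfeas N hN
      exact ⟨T, hT, Nat.le_floor (by linarith [pow_nonneg (Nat.cast_nonneg (α := ℝ) N) 3])⟩
  refine ⟨S, hS, fun n m d hm hd => ?_⟩
  have hr : 0 < ceilSqrt d := Nat.succ_pos _
  have hdepth := depth_truncatedPowers_le S (n := n) (d := d)
    (V := 1000 * ((⌊C₀ * (ceilSqrt d : ℝ) ^ ω⌋₊ + 3 * ceilSqrt d ^ 3) *
      ((n + m) / m / ceilSqrt d ^ 2 + 1) * quasilin (2 * m))) hm (hrem n)
    ((hquo _).trans (Nat.mul_le_mul_left _ (quasilin_mono (by omega))))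
    (fun N M h => (hmul N M).trans (Nat.mul_le_mul_left _ (quasilin_mono h)))
    fun k hk => (hmat _ k _ m hr (ceilDiv_ceilSqrt_le d)).trans (by
      gcongr
      exact (Nat.le_div_iff_mul_le hm).2 hk)
  refine le_trans ?_ (cost_le_bicost hω hm hd (X := ⌊C₀ * (ceilSqrt d : ℝ) ^ ω⌋₊ + 3 * ceilSqrt d ^ 3)
    ?_ hC₀ le_rfl le_rfl le_rfl)
  · rw [CTree.cost]
    exact_mod_cast Nat.add_le_add_left hdepth (3 * n + 1)
  -- The inputs alone give 2r³ ≤ C₀ r^ω, so the summand 3r³ is absorbed into the factor 3.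
  · obtain ⟨T, -, hT⟩ := hfeas _ hr
    have h1 : (0 : ℝ) ≤ T.depth := Nat.cast_nonneg _
    have h2 := Nat.floor_le (show 0 ≤ C₀ * (ceilSqrt d : ℝ) ^ ω by positivity)
    push_cast
    linarith
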